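/- Let $S$ be a locally compact Hausdorff topological semigroup with identity $e$ (jointly continuous multiplication). Let $M(S)$ be the Banach space of bounded complex Radon measures on $S$ with the total variation norm, and let $M_a(S)$ be the set of $\mu\in M(S)$ for which the maps $x\mapsto\delta_x*|\mu|$ and $x\mapsto|\mu|*\delta_x$ from $S$ to $M(S)$ are continuous for the weak topology $\sigma(M(S),M(S)')$. Assume that $S$ is a foundation semigroup, i.e. $S$ is the closure of $\bigcup\{\operatorname{supp}\mu:\mu\in M_a(S)\}$. Let $\omega:S\to(0,\infty)$ be a weight function, i.e. continuous with $\omega(st)\le\omega(s)\omega(t)$ for all $s,t\in S$. Let $M(S,\omega)$ be the space of (possibly unbounded) complex Radon measures $\mu$ on $S$ with $\omega\mu\in M(S)$, with norm $\|\mu\|_\omega=\int_S\omega\,d|\mu|$ and convolution $\int f\,d(\mu*\nu)=\int\!\!\int f(xy)\,d\mu(x)\,d\nu(y)$ ($f$ continuous with compact support), and let $M_a(S,\omega)=\{\mu\in M(S,\omega):\omega\mu\in M_a(S)\}$. Let $X$ be a complex Banach space. A left weighted $S$-module structure on $X$ is a left action of $S$ on $X$ by linear maps with $e\cdot x=x$,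 such that $s\mapsto s\cdot x$ is continuous for every $x\in X$ and there is $K>0$ with $\|s\cdot x\|\le K\,\omega(s)\,\|x\|$ for all $s\in S$, $x\in X$. Right structures are defined similarly; a two-sided structure consists of a left and a right one with $s\cdot(x\cdot t)=(s\cdot x)\cdot t$. A left Banach $M_a(S,\omega)$-module structure on $X$ is a bilinear action with $(\mu*\nu)\cdot x=\mu\cdot(\nu\cdot x)$ and $\|\mu\cdot x\|\le K\|\mu\|_\omega\|x\|$ for some $K>0$; it is neo-unital if every element of $X$ has the form $\mu\cdot y$ with $\mu\in M_a(S,\omega)$, $y\in X$. Right structures are defined similarly; a two-sided structure consists of a left and a right one with $\mu\cdot(x\cdot\nu)=(\mu\cdot x)\cdot\nu$, and is neo-unital if every element of $X$ has the form $\mu\cdot y\cdot\nu$. Then $M_a(S,\omega)$ is a Banach algebra under convolution and $\|\cdot\|_\omega$ (a complete linear subspace of $M(S,\omega)$ in which convolutions exist uniquely, convolution being bilinear, associative and submultiplicative), and $X$ is a weighted $S$-module if and only if it is a neo-unital Banach $M_a(S,\omega)$-module, in the following sense, for left, for right and for two-sided modules: 1. for every weighted $S$-module structure on $X$ there is exactly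 one neo-unital Banach $M_a(S,\omega)$-module structure on $X$ with $$\mu\cdot x=\int_S s\cdot x\,d\mu(s)\qquad\Bigl(\text{respectively } x\cdot\mu=\int_S x\cdot s\,d\mu(s),\ \text{respectively both}\Bigr)$$ for all $\mu\in M_a(S,\omega)$, $x\in X$, the integrals being absolutely convergent Bochner integrals; 2. for every neo-unital Banach $M_a(S,\omega)$-module structure on $X$ there is exactly one weighted $S$-module structure on $X$ for which these formulas hold, again with absolutely convergent Bochner integrals. -/

import Mathlib

open MeasureTheory

namespace WeightedSemigroup

/-! ### Bounded complex Radon measures -/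

section Radon

variable (S : Type*) [TopologicalSpace S] [MeasurableSpace S] [BorelSpace S]

/-- A measure dominated by a finite Radon measure is Radon. -/
theorem innerRegular_of_le {S : Type*} [TopologicalSpace S] [MeasurableSpace S] [BorelSpace S]
    [T2Space S] {μ ν : Measure S} [IsFiniteMeasure ν] [ν.InnerRegular] (h : μ ≤ ν) :
    μ.InnerRegular := by
  have hμ : IsFiniteMeasure μ := isFiniteMeasure_of_le ν h
  refine ⟨fun A hA r hr => ?_⟩
  obtain ⟨K, hKA, hK, hlt⟩ := hA.exists_isCompact_sdiff_lt (μ := ν) (measure_ne_top ν A)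
    (ε := μ A - r) (tsub_pos_of_lt hr).ne'
  refine ⟨K, hKA, hK, ?_⟩
  have h1 : μ (A \ K) < μ A - r := (h _).trans_lt hlt
  have h2 : μ A ≤ μ K + μ (A \ K) := by
    rw [← measure_union Set.disjoint_sdiff_right (hA.diff hK.measurableSet)]
    exact measure_mono (by rw [Set.union_sdiff_self]; exact Set.subset_union_right)
  by_contra hcon
  rw [not_lt] at hcon
  have hr' : r ≠ ⊤ := ne_top_of_lt hr
  have h3 : μ K + μ (A \ K) < r + (μ A - r) :=
    ENNReal.add_lt_add_of_le_of_lt (ne_top_of_le_ne_top hr' hcon) hcon h1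
  rw [add_tsub_cancel_of_le hr.le] at h3
  exact absurd h2 (not_le.2 h3)

/-- `M(S)`: the bounded complex Radon measures on `S`, i.e. the complex Borel measures whose
total variation is a finite measure that is inner regular for compact sets. -/
def radonSubmodule [T2Space S] : Submodule ℂ (ComplexMeasure S) where
  carrier := {ν | IsFiniteMeasure ν.variation ∧ ν.variation.InnerRegular}
  zero_mem' := by
    simp only [Set.mem_ofPred_eq, VectorMeasure.variation_zero]
    exact ⟨inferInstance, inferInstance⟩
  add_mem' := by
    rintro μ ν ⟨hμ, hμ'⟩ ⟨hν, hν'⟩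
    exact ⟨isFiniteMeasure_of_le _ VectorMeasure.variation_add_le,
      innerRegular_of_le VectorMeasure.variation_add_le⟩
  smul_mem' := by
    rintro c μ ⟨hμ, hμ'⟩
    simp only [Set.mem_ofPred_eq, VectorMeasure.variation_smul]
    exact ⟨inferInstance, inferInstance⟩

/-- `M(S)` as a type. -/
abbrev RadonMeasure [T2Space S] : Type _ := radonSubmodule S

namespace RadonMeasure

variable {S} [T2Space S]

/-- The total variation measure `|ν|`. -/
noncomputable def abs (ν : RadonMeasure S) : Measure S := (ν : ComplexMeasure S).variation

instance (ν : RadonMeasure S) : IsFiniteMeasure ν.abs := ν.2.1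

instance (ν : RadonMeasure S) : ν.abs.InnerRegular := ν.2.2

/-- The total variation norm `‖ν‖ = |ν|(S)`. -/
noncomputable instance : Norm (RadonMeasure S) := ⟨fun ν => ν.abs.real Set.univ⟩

theorem norm_def (ν : RadonMeasure S) : ‖ν‖ = ν.abs.real Set.univ := rfl

theorem normCore : NormedSpace.Core ℂ (RadonMeasure S) where
  norm_nonneg ν := measureReal_nonneg
  norm_smul c ν := by
    have : (c • ν).abs = ‖c‖₊ • ν.abs :=
      VectorMeasure.variation_smul (μ := (ν : ComplexMeasure S)) (c := c)
    rw [norm_def, norm_def, this]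
    simp [measureReal_def]
  norm_triangle μ ν := by
    have h : (μ + ν).abs ≤ μ.abs + ν.abs :=
      VectorMeasure.variation_add_le (μ := (μ : ComplexMeasure S)) (ν := (ν : ComplexMeasure S))
    rw [norm_def, norm_def, norm_def, ← measureReal_add_apply]
    exact ENNReal.toReal_mono (measure_ne_top _ _) (h _)
  norm_eq_zero_iff ν := by
    constructor
    · intro h
      have h0 : ν.abs Set.univ = 0 := by
        rw [norm_def, measureReal_eq_zero_iff] at h
        exact h
      have h1 : (ν : ComplexMeasure S).variation = 0 := Measure.measure_univ_eq_zero.1 h0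
      exact Subtype.ext (VectorMeasure.variation_eq_zero.1 h1)
    · rintro rfl
      have : (0 : RadonMeasure S).abs = 0 :=
        VectorMeasure.variation_zero (X := S) (V := ℂ)
      rw [norm_def, this]
      simp

noncomputable instance : NormedAddCommGroup (RadonMeasure S) := NormedAddCommGroup.ofCore normCore

noncomputable instance : NormedSpace ℂ (RadonMeasure S) := NormedSpace.ofCore normCore

/-- A finite positive Radon measure, regarded as an element of `M(S)`. -/
noncomputable def ofMeasure (ρ : Measure S) [IsFiniteMeasure ρ] [ρ.InnerRegular] :
    RadonMeasure S where
  val := ρ.toSignedMeasure.toComplexMeasure 0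
  property := by
    have h : (ρ.toSignedMeasure.toComplexMeasure 0).variation ≤ ρ := by
      refine VectorMeasure.variation_le_of_forall_enorm_le fun E hE => ?_
      have h1 : (ρ.toSignedMeasure.toComplexMeasure 0) E = ((ρ.real E : ℝ) : ℂ) := by
        rw [SignedMeasure.toComplexMeasure_apply, Measure.toSignedMeasure_apply_measurable hE]
        rfl
      rw [h1, ← ofReal_norm, Complex.norm_real, Real.norm_of_nonneg measureReal_nonneg,
        ofReal_measureReal]
    exact ⟨isFiniteMeasure_of_le _ h, innerRegular_of_le h⟩

end RadonMeasure

end Radon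

/-! ### The algebra `M_a(S)` and foundation semigroups -/

section Ma

variable {S : Type*} [TopologicalSpace S] [T2Space S] [MeasurableSpace S] [BorelSpace S]

instance isFiniteMeasure_map (ρ : Measure S) [IsFiniteMeasure ρ] (φ : C(S, S)) :
    IsFiniteMeasure (ρ.map φ) := Measure.isFiniteMeasure_map ρ φ

instance innerRegular_map (ρ : Measure S) [ρ.InnerRegular] (φ : C(S, S)) :
    (ρ.map φ).InnerRegular := Measure.InnerRegular.map_of_continuous φ.continuous

variable [Monoid S] [ContinuousMul S]

/-- `δ_x * |μ|`, the image of `|μ|` under `y ↦ x * y`. -/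
noncomputable def diracMulAbs (x : S) (μ : RadonMeasure S) : RadonMeasure S :=
  RadonMeasure.ofMeasure (μ.abs.map (ContinuousMap.mulLeft x))

/-- `|μ| * δ_x`, the image of `|μ|` under `y ↦ y * x`. -/
noncomputable def absMulDirac (μ : RadonMeasure S) (x : S) : RadonMeasure S :=
  RadonMeasure.ofMeasure (μ.abs.map (ContinuousMap.mulRight x))

variable (S) in
/-- `M_a(S)`: the measures `μ ∈ M(S)` for which `x ↦ δ_x * |μ|` and `x ↦ |μ| * δ_x` are continuous
from `S` into `M(S)` with its weak topology `σ(M(S), M(S)')`. -/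
def Ma : Set (RadonMeasure S) :=
  {μ | ∀ F : RadonMeasure S →L[ℂ] ℂ,
    Continuous (fun x : S => F (diracMulAbs x μ)) ∧ Continuous (fun x : S => F (absMulDirac μ x))}

variable (S) in
/-- `S` is a foundation semigroup: it is the closure of the union of the supports of the
measures in `M_a(S)`. -/
def IsFoundation : Prop :=
  closure (⋃ μ ∈ Ma S, μ.abs.support) = Set.univ

end Ma

/-! ### Weight functions and `M(S, ω)` -/

/-- A weight function on `S`: continuous, submultiplicative, with values in `(0, ∞)`. (Strict
positivity is what is needed for `1 / ω` to make sense; `ω` and `1 / ω` are then continuous, hence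
bounded on compact sets.) -/
structure WeightFunction (S : Type*) [TopologicalSpace S] [Mul S] where
  /-- The underlying function. -/
  toFun : S → ℝ
  pos' : ∀ x, 0 < toFun x
  continuous' : Continuous toFun
  map_mul_le' : ∀ x y, toFun (x * y) ≤ toFun x * toFun y

instance (S : Type*) [TopologicalSpace S] [Mul S] :
    CoeFun (WeightFunction S) (fun _ => S → ℝ) := ⟨WeightFunction.toFun⟩

section Weighted

variable {S : Type*} [TopologicalSpace S] [T2Space S] [MeasurableSpace S] [BorelSpace S]
  [Monoid S]

/-- `M(S, ω)`: the (possibly unbounded) complex Radon measures `μ` on `S` with `ωμ ∈ M(S)`.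
As `ω` is continuous and strictly positive, `μ ↦ ωμ` is a linear bijection of this space onto
`M(S)`, with inverse `ν ↦ ω⁻¹ν`. An element `μ` is recorded by the bounded measure `ωμ`,
see `WeightedMeasure.mulWeight`; the norm is `‖μ‖_ω = ‖ωμ‖ = ∫ ω d|μ|`. -/
def WeightedMeasure (_ω : WeightFunction S) : Type _ := RadonMeasure S

namespace WeightedMeasure

variable {ω : WeightFunction S}

noncomputable instance : NormedAddCommGroup (WeightedMeasure ω) :=
  inferInstanceAs (NormedAddCommGroup (RadonMeasure S))

noncomputable instance : NormedSpace ℂ (WeightedMeasure ω) :=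
  inferInstanceAs (NormedSpace ℂ (RadonMeasure S))

/-- The isometric isomorphism `μ ↦ ωμ` of `M(S, ω)` onto `M(S)`. -/
noncomputable def mulWeight : WeightedMeasure ω ≃ₗᵢ[ℂ] RadonMeasure S :=
  LinearIsometryEquiv.refl ℂ (RadonMeasure S)

/-- The total variation `|μ| = ω⁻¹ |ωμ|` of `μ ∈ M(S, ω)`. -/
noncomputable def abs (μ : WeightedMeasure ω) : Measure S :=
  (mulWeight μ).abs.withDensity (fun s => ENNReal.ofReal (ω s)⁻¹)

/-- The integral `∫ f dμ = ∫ ω⁻¹ f d(ωμ)` of a vector-valued function against `μ ∈ M(S, ω)`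
(a Bochner integral, meaningful when `f` is `|μ|`-integrable). -/
noncomputable def integral {X : Type*} [NormedAddCommGroup X] [NormedSpace ℂ X]
    (μ : WeightedMeasure ω) (f : S → X) : X :=
  VectorMeasure.integral (mulWeight μ : ComplexMeasure S) (fun s => (ω s)⁻¹ • f s)
    (ContinuousLinearMap.lsmul ℝ ℂ : ℂ →L[ℝ] X →L[ℝ] X).flip

/-- `σ = μ * ν`: the complex Radon measure `σ` is the convolution of `μ` and `ν`, i.e.
`∫ f dσ = ∫∫ f(xy) dμ(x) dν(y)` for every continuous `f` with compact support. -/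
def IsConvolution (μ ν σ : WeightedMeasure ω) : Prop :=
  ∀ f : S → ℂ, Continuous f → HasCompactSupport f →
    σ.integral f = ν.integral (fun y => μ.integral (fun x => f (x * y)))

end WeightedMeasure

open WeightedMeasure

variable [ContinuousMul S]

/-- `M_a(S, ω)`: the measures `μ ∈ M(S, ω)` with `ωμ ∈ M_a(S)`. -/
def weightedMa (ω : WeightFunction S) : Set (WeightedMeasure ω) :=
  {μ | mulWeight μ ∈ Ma S}

/-- A subset of `M(S, ω)` is a Banach algebra for convolution and the norm `‖·‖_ω`: it is a complete
linear subspace, any two of its members have exactly one convolution, which again belongs to the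
set, and convolution is bilinear, associative and submultiplicative. -/
structure IsConvolutionBanachAlgebra {ω : WeightFunction S} (A : Set (WeightedMeasure ω)) :
    Prop where
  zero_mem : 0 ∈ A
  add_mem : ∀ μ ∈ A, ∀ ν ∈ A, μ + ν ∈ A
  smul_mem : ∀ (c : ℂ), ∀ μ ∈ A, c • μ ∈ A
  complete : IsComplete A
  existsUnique_conv : ∀ μ ∈ A, ∀ ν ∈ A, ∃! σ : WeightedMeasure ω, IsConvolution μ ν σ
  conv_mem : ∀ μ ∈ A, ∀ ν ∈ A, ∀ σ, IsConvolution μ ν σ → σ ∈ A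
  norm_conv_le : ∀ μ ∈ A, ∀ ν ∈ A, ∀ σ, IsConvolution μ ν σ → ‖σ‖ ≤ ‖μ‖ * ‖ν‖
  add_conv : ∀ μ₁ ∈ A, ∀ μ₂ ∈ A, ∀ ν ∈ A, ∀ σ₁ σ₂,
    IsConvolution μ₁ ν σ₁ → IsConvolution μ₂ ν σ₂ → IsConvolution (μ₁ + μ₂) ν (σ₁ + σ₂)
  conv_add : ∀ μ ∈ A, ∀ ν₁ ∈ A, ∀ ν₂ ∈ A, ∀ σ₁ σ₂,
    IsConvolution μ ν₁ σ₁ → IsConvolution μ ν₂ σ₂ → IsConvolution μ (ν₁ + ν₂) (σ₁ + σ₂)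
  smul_conv : ∀ (c : ℂ), ∀ μ ∈ A, ∀ ν ∈ A, ∀ σ,
    IsConvolution μ ν σ → IsConvolution (c • μ) ν (c • σ)
  conv_smul : ∀ (c : ℂ), ∀ μ ∈ A, ∀ ν ∈ A, ∀ σ,
    IsConvolution μ ν σ → IsConvolution μ (c • ν) (c • σ)
  conv_assoc : ∀ μ ∈ A, ∀ ν ∈ A, ∀ η ∈ A, ∀ α β γ,
    IsConvolution μ ν α → IsConvolution ν η β → IsConvolution α η γ → IsConvolution μ β γ

/-! ### Modules -/

variable {X : Type*} [NormedAddCommGroup X] [NormedSpace ℂ X]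

/-- `X`, with the (unital, linear) left action `s.x = a s x` of `S`, is a left weighted Banach
`S`-module. -/
structure IsLeftWeightedModule (ω : WeightFunction S) (a : S →* Module.End ℂ X) : Prop where
  continuous : ∀ x, Continuous (fun s => a s x)
  bound : ∃ K > 0, ∀ s x, ‖a s x‖ ≤ K * ω s * ‖x‖

/-- `X`, with the (unital, linear) right action `x.s = b (op s) x` of `S`, is a right weighted
Banach `S`-module. -/
structure IsRightWeightedModule (ω : WeightFunction S) (b : Sᵐᵒᵖ →* Module.End ℂ X) : Prop where
  continuous : ∀ x, Continuous (fun s => b (MulOpposite.op s) x)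
  bound : ∃ K > 0, ∀ s x, ‖b (MulOpposite.op s) x‖ ≤ K * ω s * ‖x‖

/-- `X` is a two-sided weighted Banach `S`-module: `s.(x.t) = (s.x).t`. -/
structure IsTwoSidedWeightedModule (ω : WeightFunction S) (a : S →* Module.End ℂ X)
    (b : Sᵐᵒᵖ →* Module.End ℂ X) : Prop where
  left : IsLeftWeightedModule ω a
  right : IsRightWeightedModule ω b
  compat : ∀ s t x, a s (b (MulOpposite.op t) x) = b (MulOpposite.op t) (a s x)

/-- A map `M_a(S, ω) × X → X` is bilinear and bounded. -/
structure IsBoundedBilinear (ω : WeightFunction S) (m : weightedMa ω → X → X) : Prop where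
  map_add : ∀ μ x y, m μ (x + y) = m μ x + m μ y
  map_smul : ∀ μ (c : ℂ) x, m μ (c • x) = c • m μ x
  add_map : ∀ (μ ν σ : weightedMa ω) (x : X),
    (σ : WeightedMeasure ω) = μ + ν → m σ x = m μ x + m ν x
  smul_map : ∀ (c : ℂ) (μ σ : weightedMa ω) (x : X),
    (σ : WeightedMeasure ω) = c • (μ : WeightedMeasure ω) → m σ x = c • m μ x
  bound : ∃ K > 0, ∀ (μ : weightedMa ω) (x : X), ‖m μ x‖ ≤ K * ‖(μ : WeightedMeasure ω)‖ * ‖x‖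

/-- `X`, with the action `μ.x = m μ x`, is a left Banach `M_a(S, ω)`-module. -/
structure IsLeftBanachModule (ω : WeightFunction S) (m : weightedMa ω → X → X) : Prop
    extends IsBoundedBilinear ω m where
  assoc : ∀ (μ ν σ : weightedMa ω) (x : X),
    IsConvolution (μ : WeightedMeasure ω) ν σ → m σ x = m μ (m ν x)

/-- `X`, with the action `x.μ = n μ x`, is a right Banach `M_a(S, ω)`-module. -/
structure IsRightBanachModule (ω : WeightFunction S) (n : weightedMa ω → X → X) : Prop
    extends IsBoundedBilinear ω n where
  assoc : ∀ (μ ν σ : weightedMa ω) (x : X),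
    IsConvolution (μ : WeightedMeasure ω) ν σ → n σ x = n ν (n μ x)

/-- Left neo-unital Banach `M_a(S, ω)`-module: `X = M_a(S, ω) X`. -/
structure IsLeftNeoUnitalModule (ω : WeightFunction S) (m : weightedMa ω → X → X) : Prop
    extends IsLeftBanachModule ω m where
  neoUnital : ∀ x, ∃ μ y, x = m μ y

/-- Right neo-unital Banach `M_a(S, ω)`-module: `X = X M_a(S, ω)`. -/
structure IsRightNeoUnitalModule (ω : WeightFunction S) (n : weightedMa ω → X → X) : Prop
    extends IsRightBanachModule ω n where
  neoUnital : ∀ x, ∃ μ y, x = n μ y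

/-- Two-sided neo-unital Banach `M_a(S, ω)`-module: `μ.(x.ν) = (μ.x).ν`, and
`X = M_a(S, ω) X M_a(S, ω)`. -/
structure IsTwoSidedNeoUnitalModule (ω : WeightFunction S) (m n : weightedMa ω → X → X) :
    Prop where
  left : IsLeftBanachModule ω m
  right : IsRightBanachModule ω n
  compat : ∀ μ ν x, m μ (n ν x) = n ν (m μ x)
  neoUnital : ∀ x, ∃ μ ν y, x = m μ (n ν y)

/-- The action `m` of `M_a(S, ω)` is the integrated form of the family of maps `s ↦ T s` on `X`:
for all `μ` and `x` the integral `∫ T s x dμ(s)` converges absolutely and equals `m μ x`. -/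
def IsIntegratedForm (ω : WeightFunction S) (T : S → X → X) (m : weightedMa ω → X → X) : Prop :=
  ∀ (μ : weightedMa ω) (x : X),
    Integrable (fun s => T s x) (μ : WeightedMeasure ω).abs ∧
      m μ x = (μ : WeightedMeasure ω).integral (fun s => T s x)

end Weighted

end WeightedSemigroup

/-!
# Weighted modules over a foundation semigroup

Write `μ ↦ ωμ` to pass from `M(S, ω)` to `M(S)`. There, translation by `x` becomes, up to the factor
`ω(x)`, the contraction `wtrans ω x`, and convolution becomes `conv ω α β = ∫ wtrans ω x β dα(x)`, a
Bochner integral in `M(S)`. It exists because `x ↦ wtrans ω x β` is norm continuous for `β ∈ M_a(S)`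
(`continuous_wtrans`), and this norm continuity is the analytic core of the proof.

*From weak to norm continuity.* Weak continuity of `x ↦ δ_x * |μ|` gives setwise continuity
(`LeftSetwise`). By Dini's theorem such a family is uniformly countably additive over compact sets of
parameters, hence uniformly absolutely continuous with respect to a single measure (`exists_unifAC`).
This makes the class of these measures solid (`LeftSetwise.of_ac`); it also makes a Dunford–Pettis
argument work, by which the translates of a convolution `μ * ν` of two such measures are norm
continuous (`continuous_push_rconv`). In a foundation semigroup there are probability measures `ρ` in
`M_a(S)` that concentrate at the identity (`IsFoundation.hasApproxUnit`). Since `ρ * ν → ν` weakly, the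
Hahn–Banach theorem puts `ν` into the closed subspace of measures with norm continuous translates
(`LeftSetwise.ofMeasure_mem`). So `M_a(S)` is a closed, solid subspace (`mem_Ma_iff`, `maSubmodule`).

*From `S` to `M_a(S, ω)`.* The integrated form of a weighted action is multiplicative, because
`conv` is itself the integrated form of translation (`IsLeftWeightedModule.integrated_conv`). The
measures `ω(1) ρ` form a bounded approximate unit (`unitFilter`) for the algebra and for the module,
and Cohen's factorization theorem (`cohen_factorization`) shows that the module is neo-unital.

*From `M_a(S, ω)` to `S`.* Put `s·(μ·y) = (δ_s * μ)·y`. This is well defined, since the right side is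
the limit of `(δ_s * e)·(μ·y)` along the approximate unit `e` (`exists_action_maTrans`), and writing
`μ·(ν·y)` as `∫ (δ_s * ν)·y dμ(s)` shows that the given module is the integrated form
(`apply_apply_eq_pair`).

Right modules are left modules for the opposite multiplication on the same space, `oppMonoid`, which
leaves the spaces of measures unchanged. Two-sided modules combine both cases, as bounded operators
commute with the integrals.
-/

open MeasureTheory

set_option linter.unusedSectionVars false

namespace WeightedSemigroup

open Filter Topology Set
open scoped ENNReal NNReal

/-! ### Densities and completeness of the space of bounded Radon measures -/

section Basics

variable {S : Type*} [TopologicalSpace S] [T2Space S] [MeasurableSpace S] [BorelSpace S]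

theorem exists_delta_of_absolutelyContinuous {α : Type*} [MeasurableSpace α] {μ ν : Measure α}
    [IsFiniteMeasure μ] [IsFiniteMeasure ν] (h : μ ≪ ν) {ε : ℝ≥0∞} (hε : ε ≠ 0) :
    ∃ δ > 0, ∀ E, MeasurableSet E → ν E < δ → μ E < ε := by
  obtain ⟨δ, hδ, H⟩ := exists_pos_setLIntegral_lt_of_measure_lt
    (μ := ν) (f := μ.rnDeriv ν) (Measure.lintegral_rnDeriv_lt_top μ ν).ne hε
  refine ⟨δ, hδ, fun E hE hEδ => ?_⟩
  have := H E hEδ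
  rwa [Measure.setLIntegral_rnDeriv h] at this

theorem innerRegular_of_absolutelyContinuous {μ ν : Measure S} [IsFiniteMeasure μ]
    [IsFiniteMeasure ν] [ν.InnerRegular] (h : μ ≪ ν) : μ.InnerRegular := by
  refine ⟨fun A hA r hr => ?_⟩
  obtain ⟨δ, hδ, H⟩ := exists_delta_of_absolutelyContinuous h
    (ε := μ A - r) (tsub_pos_of_lt hr).ne'
  obtain ⟨K, hKA, hK, hlt⟩ := hA.exists_isCompact_sdiff_lt (μ := ν) (measure_ne_top ν A) hδ.ne'
  refine ⟨K, hKA, hK, ?_⟩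
  have h1 : μ (A \ K) < μ A - r := H _ (hA.diff hK.measurableSet) hlt
  have h2 : μ A ≤ μ K + μ (A \ K) := by
    rw [← measure_union Set.disjoint_sdiff_right (hA.diff hK.measurableSet)]
    exact measure_mono (by rw [Set.union_sdiff_self]; exact Set.subset_union_right)
  by_contra hcon
  rw [not_lt] at hcon
  have hr' : r ≠ ⊤ := ne_top_of_lt hr
  have h3 : μ K + μ (A \ K) < r + (μ A - r) :=
    ENNReal.add_lt_add_of_le_of_lt (ne_top_of_le_ne_top hr' hcon) hcon h1
  rw [add_tsub_cancel_of_le hr.le] at h3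
  exact absurd h2 (not_le.2 h3)

/-- A weighted sum of countably many finite Radon measures dominates a multiple of each of them and is
again a finite Radon measure. -/
theorem exists_radon_dominating (lam : ℕ → Measure S) [∀ n, IsFiniteMeasure (lam n)]
    [∀ n, (lam n).InnerRegular] :
    ∃ (ρ : Measure S) (c : ℕ → ℝ≥0), IsFiniteMeasure ρ ∧ ρ.InnerRegular ∧
      (∀ n, 0 < c n) ∧ ∀ n E, MeasurableSet E → c n * lam n E ≤ ρ E := by
  obtain ⟨c, hc, hsum⟩ := ENNReal.exists_pos_tsum_mul_lt_of_countable one_ne_zero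
    (fun n => lam n univ) (fun n => measure_ne_top _ _)
  refine ⟨Measure.sum fun n => c n • lam n, c, ⟨?_⟩, inferInstance, hc, fun n E hE => ?_⟩
  · rw [Measure.sum_apply _ MeasurableSet.univ]
    refine lt_of_le_of_lt (le_of_eq ?_) (hsum.trans ENNReal.one_lt_top)
    refine tsum_congr fun n => ?_
    rw [Measure.smul_apply, mul_comm]; rfl
  · rw [Measure.sum_apply _ hE]
    exact ENNReal.le_tsum (f := fun n => (c n • lam n) E) n

theorem exists_radon_dominating_ac (lam : ℕ → Measure S) [∀ n, IsFiniteMeasure (lam n)]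
    [∀ n, (lam n).InnerRegular] :
    ∃ ρ : Measure S, IsFiniteMeasure ρ ∧ ρ.InnerRegular ∧ ∀ n, lam n ≪ ρ := by
  obtain ⟨ρ, c, h1, h2, hc, h⟩ := exists_radon_dominating lam
  refine ⟨ρ, h1, h2, fun n => Measure.AbsolutelyContinuous.mk fun E hE h0 => ?_⟩
  have := h n E hE
  rw [h0, nonpos_iff_eq_zero, mul_eq_zero] at this
  exact this.resolve_left (by exact_mod_cast (hc n).ne')

namespace RadonMeasure

theorem abs_apply_le_norm (α : RadonMeasure S) (E : Set S) : α.abs.real E ≤ ‖α‖ :=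
  measureReal_mono (subset_univ E)

theorem norm_apply_le_abs (α : RadonMeasure S) (E : Set S) :
    ‖(α : ComplexMeasure S) E‖ ≤ α.abs.real E :=
  VectorMeasure.norm_measure_le_variation (measure_ne_top α.abs E)

/-- The Radon measure `f ρ` with density `f` with respect to a finite Radon measure `ρ`
(zero if `f` is not integrable). -/
noncomputable def dens (ρ : Measure S) [IsFiniteMeasure ρ] [ρ.InnerRegular] (f : S → ℂ) :
    RadonMeasure S where
  val := ρ.withDensityᵥ f
  property := by
    by_cases hf : Integrable f ρ
    · have h : (ρ.withDensityᵥ f).variation = ρ.withDensity (fun x => ‖f x‖ₑ) :=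
        Measure.variation_withDensityᵥ hf
      have h1 : IsFiniteMeasure (ρ.withDensityᵥ f).variation := by
        rw [h]
        exact isFiniteMeasure_withDensity (ne_of_lt hf.2)
      refine ⟨h1, innerRegular_of_absolutelyContinuous (ν := ρ) ?_⟩
      rw [h]
      exact withDensity_absolutelyContinuous _ _
    · have : ρ.withDensityᵥ f = 0 := by simp [Measure.withDensityᵥ, hf]
      rw [this]
      exact (radonSubmodule S).zero_mem

section dens

variable {ρ : Measure S} [IsFiniteMeasure ρ] [ρ.InnerRegular] {f g : S → ℂ}

theorem dens_apply (hf : Integrable f ρ) {E : Set S} (hE : MeasurableSet E) :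
    (dens ρ f : ComplexMeasure S) E = ∫ x in E, f x ∂ρ :=
  withDensityᵥ_apply hf hE

theorem abs_dens (hf : Integrable f ρ) : (dens ρ f).abs = ρ.withDensity (fun x => ‖f x‖ₑ) :=
  Measure.variation_withDensityᵥ hf

theorem norm_dens (hf : Integrable f ρ) : ‖dens ρ f‖ = ∫ x, ‖f x‖ ∂ρ := by
  rw [norm_def, abs_dens hf, measureReal_def, withDensity_apply _ MeasurableSet.univ,
    setLIntegral_univ, integral_norm_eq_lintegral_enorm hf.aestronglyMeasurable]

theorem dens_add (hf : Integrable f ρ) (hg : Integrable g ρ) :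
    dens ρ (f + g) = dens ρ f + dens ρ g :=
  Subtype.ext (withDensityᵥ_add hf hg)

theorem dens_smul (c : ℂ) : dens ρ (c • f) = c • dens ρ f :=
  Subtype.ext (withDensityᵥ_smul f c)

theorem dens_sub (hf : Integrable f ρ) (hg : Integrable g ρ) :
    dens ρ (f - g) = dens ρ f - dens ρ g :=
  Subtype.ext (withDensityᵥ_sub hf hg)

theorem ext_apply {α β : RadonMeasure S} (h : ∀ E, MeasurableSet E →
    (α : ComplexMeasure S) E = (β : ComplexMeasure S) E) : α = β :=
  Subtype.ext (VectorMeasure.ext h)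

theorem dens_congr (h : f =ᵐ[ρ] g) : dens ρ f = dens ρ g := by
  by_cases hf : Integrable f ρ
  · refine ext_apply fun E hE => ?_
    rw [dens_apply hf hE, dens_apply (hf.congr h) hE]
    exact integral_congr_ae (ae_restrict_of_ae h)
  · have hg : ¬ Integrable g ρ := fun hg => hf (hg.congr h.symm)
    refine Subtype.ext ?_
    change ρ.withDensityᵥ f = ρ.withDensityᵥ g
    simp [Measure.withDensityᵥ, hf, hg]

variable (ρ) in
/-- The isometric embedding `L¹(ρ) → M(S)`, `f ↦ f ρ`. -/
noncomputable def densL : Lp ℂ 1 ρ →ₗᵢ[ℂ] RadonMeasure S where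
  toFun f := dens ρ f
  map_add' f g := by
    rw [← dens_add (L1.integrable_coeFn f) (L1.integrable_coeFn g)]
    exact dens_congr (Lp.coeFn_add f g)
  map_smul' c f := by
    rw [RingHom.id_apply, ← dens_smul]
    exact dens_congr (Lp.coeFn_smul c f)
  norm_map' f := by
    change ‖dens ρ f‖ = ‖f‖
    rw [norm_dens (L1.integrable_coeFn f), L1.norm_eq_integral_norm]

theorem densL_toL1 (hf : Integrable f ρ) : densL ρ (hf.toL1 f) = dens ρ f :=
  dens_congr hf.coeFn_toL1

end dens

theorem ofMeasure_apply (ρ : Measure S) [IsFiniteMeasure ρ] [ρ.InnerRegular] {E : Set S}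
    (hE : MeasurableSet E) : (ofMeasure ρ : ComplexMeasure S) E = ((ρ.real E : ℝ) : ℂ) := by
  change (ρ.toSignedMeasure.toComplexMeasure 0) E = _
  rw [SignedMeasure.toComplexMeasure_apply, Measure.toSignedMeasure_apply_measurable hE]
  rfl

theorem ofMeasure_eq_dens_one (ρ : Measure S) [IsFiniteMeasure ρ] [ρ.InnerRegular] :
    ofMeasure ρ = dens ρ (fun _ => 1) := by
  refine ext_apply fun E hE => ?_
  rw [ofMeasure_apply ρ hE, dens_apply (integrable_const _) hE]
  simp

@[simp]
theorem abs_ofMeasure (ρ : Measure S) [IsFiniteMeasure ρ] [ρ.InnerRegular] :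
    (ofMeasure ρ).abs = ρ := by
  rw [ofMeasure_eq_dens_one, abs_dens (integrable_const _)]
  simp

theorem norm_ofMeasure (ρ : Measure S) [IsFiniteMeasure ρ] [ρ.InnerRegular] :
    ‖ofMeasure ρ‖ = ρ.real univ := by
  rw [norm_def, abs_ofMeasure]

/-- Radon–Nikodym theorem for complex Radon measures. -/
theorem exists_eq_dens (α : RadonMeasure S) (ρ : Measure S) [IsFiniteMeasure ρ] [ρ.InnerRegular]
    (h : α.abs ≪ ρ) : ∃ f : S → ℂ, Measurable f ∧ Integrable f ρ ∧ α = dens ρ f := by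
  set a : ComplexMeasure S := α.1 with ha
  have key : ∀ E, ρ E = 0 → a E = 0 := by
    intro E h0
    have h1 : α.abs E = 0 := h h0
    have h2 := norm_apply_le_abs α E
    rw [measureReal_def, h1, ENNReal.toReal_zero] at h2
    exact norm_le_zero_iff.1 h2
  have hac : a ≪ᵥ ρ.toENNRealVectorMeasure := by
    refine VectorMeasure.AbsolutelyContinuous.mk fun E hE h0 => key E ?_
    rwa [Measure.toENNRealVectorMeasure_apply_measurable hE] at h0
  rw [ComplexMeasure.absolutelyContinuous_ennreal_iff] at hac
  have hr := SignedMeasure.withDensityᵥ_rnDeriv_eq _ ρ hac.1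
  have hi := SignedMeasure.withDensityᵥ_rnDeriv_eq _ ρ hac.2
  set r := (ComplexMeasure.re a).rnDeriv ρ
  set i := (ComplexMeasure.im a).rnDeriv ρ
  have hrI : Integrable r ρ := SignedMeasure.integrable_rnDeriv _ _
  have hiI : Integrable i ρ := SignedMeasure.integrable_rnDeriv _ _
  have hfI : Integrable (fun x => (r x : ℂ) + (i x : ℂ) * Complex.I) ρ :=
    hrI.ofReal.add (hiI.ofReal.mul_const _)
  refine ⟨fun x => r x + i x * Complex.I, ?_, hfI, ?_⟩
  · have h1 : Measurable r := SignedMeasure.measurable_rnDeriv _ _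
    have h2 : Measurable i := SignedMeasure.measurable_rnDeriv _ _
    fun_prop
  · refine ext_apply fun E hE => ?_
    rw [dens_apply hfI hE, integral_add hrI.ofReal.restrict
      (hiI.ofReal.mul_const _).restrict, integral_mul_const, integral_complex_ofReal,
      integral_complex_ofReal, ← withDensityᵥ_apply hrI hE, ← withDensityᵥ_apply hiI hE, hr, hi]
    exact (Complex.re_add_im _).symm

/-- Two complex Radon measures have densities with respect to a common finite Radon measure. -/
theorem exists_eq_dens₂ (α β : RadonMeasure S) : ∃ (ρ : Measure S) (_ : IsFiniteMeasure ρ)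
    (_ : ρ.InnerRegular) (f g : S → ℂ), Integrable f ρ ∧ Integrable g ρ ∧
      α = dens ρ f ∧ β = dens ρ g := by
  obtain ⟨f, -, hf, hαf⟩ := exists_eq_dens α (α.abs + β.abs)
    (Measure.le_add_right le_rfl).absolutelyContinuous
  obtain ⟨g, -, hg, hβg⟩ := exists_eq_dens β (α.abs + β.abs)
    (Measure.le_add_left le_rfl).absolutelyContinuous
  exact ⟨_, inferInstance, inferInstance, f, g, hf, hg, hαf, hβg⟩

/-- A Cauchy sequence in `M(S)` lives in the isometric copy of `L¹(ρ)`, for a finite Radon measure `ρ`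
that dominates all its members. -/
instance : CompleteSpace (RadonMeasure S) := by
  refine Metric.complete_of_cauchySeq_tendsto fun u hu => ?_
  obtain ⟨ρ, h1, h2, hac⟩ := exists_radon_dominating_ac fun n => (u n).abs
  choose f _ hf hfu using fun n => exists_eq_dens (u n) ρ (hac n)
  have hu' : ∀ n, u n = densL ρ ((hf n).toL1 (f n)) := fun n => by
    rw [densL_toL1]; exact hfu n
  have hc : CauchySeq fun n => (hf n).toL1 (f n) := by
    have h := (funext hu' : u = _) ▸ hu
    rw [CauchySeq, show (fun n => densL ρ ((hf n).toL1 (f n))) =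
      densL ρ ∘ fun n => (hf n).toL1 (f n) from rfl, ← Filter.map_map,
      (densL ρ).isometry.isUniformInducing.cauchy_map_iff] at h
    exact h
  obtain ⟨g, hg⟩ := cauchySeq_tendsto_of_complete hc
  refine ⟨densL ρ g, ?_⟩
  rw [show u = _ from funext hu']
  exact ((densL ρ).continuous.tendsto g).comp hg

end RadonMeasure

end Basics

/-! ### Integrals of vector-valued functions against complex Radon measures -/

section Pairing

variable {S : Type*} [TopologicalSpace S] [T2Space S] [MeasurableSpace S] [BorelSpace S]
variable {X : Type*} [NormedAddCommGroup X] [NormedSpace ℂ X]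

/-- A finite Radon measure is concentrated on a `σ`-compact set. -/
theorem exists_ae_mem_iUnion_isCompact (ρ : Measure S) [IsFiniteMeasure ρ] [ρ.InnerRegular] :
    ∃ K : ℕ → Set S, (∀ n, IsCompact (K n)) ∧ ∀ᵐ x ∂ρ, x ∈ ⋃ n, K n := by
  choose K hK1 hK hlt using fun n : ℕ =>
    MeasurableSet.univ.exists_isCompact_sdiff_lt (μ := ρ) (measure_ne_top ρ univ)
      (ε := ((n : ℝ≥0∞) + 1)⁻¹) (by simp)
  refine ⟨K, hK, ?_⟩
  rw [ae_iff]
  refine le_antisymm (ENNReal.le_of_forall_pos_le_add fun ε hε _ => ?_) zero_le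
  obtain ⟨n, hn⟩ := ENNReal.exists_inv_nat_lt (a := ε) (by simpa using hε.ne')
  rw [zero_add]
  refine le_trans (measure_mono ?_) ((hlt n).le.trans (le_trans ?_ hn.le))
  · intro x hx
    exact ⟨mem_univ _, fun h => hx (mem_iUnion.2 ⟨n, h⟩)⟩
  · exact ENNReal.inv_le_inv.2 (by simp)

/-- No second countability or separability is needed here: the restriction of `g` to a compact set has
separable range, and `ρ` is concentrated on a `σ`-compact set. -/
theorem aestronglyMeasurable_of_continuous {Y : Type*} [TopologicalSpace Y]
    [TopologicalSpace.PseudoMetrizableSpace Y] {g : S → Y} (hg : Continuous g)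
    (ρ : Measure S) [IsFiniteMeasure ρ] [ρ.InnerRegular] : AEStronglyMeasurable g ρ := by
  obtain ⟨K, hK, hae⟩ := exists_ae_mem_iUnion_isCompact ρ
  rw [← Measure.restrict_eq_self_of_ae_mem hae, aestronglyMeasurable_iUnion_iff]
  exact fun n => hg.continuousOn.aestronglyMeasurable_of_isCompact (hK n) (hK n).measurableSet

/-- A bounded function that is strongly measurable for every finite Radon measure. -/
structure RadonBounded (g : S → X) : Prop where
  bdd : ∃ C, ∀ s, ‖g s‖ ≤ C
  meas : ∀ (ρ : Measure S) [IsFiniteMeasure ρ] [ρ.InnerRegular], AEStronglyMeasurable g ρ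

namespace RadonBounded

theorem of_continuous {g : S → X} (hg : Continuous g) {C : ℝ} (h : ∀ s, ‖g s‖ ≤ C) :
    RadonBounded g :=
  ⟨⟨C, h⟩, fun ρ _ _ => aestronglyMeasurable_of_continuous hg ρ⟩

theorem of_measurable {g : S → ℂ} (hg : Measurable g) {C : ℝ} (h : ∀ s, ‖g s‖ ≤ C) :
    RadonBounded g :=
  ⟨⟨C, h⟩, fun _ _ _ => hg.aestronglyMeasurable⟩

theorem indicator_one {E : Set S} (hE : MeasurableSet E) :
    RadonBounded (E.indicator (fun _ => (1 : ℂ))) :=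
  of_measurable (measurable_const.indicator hE) (C := 1) fun s => by
    by_cases h : s ∈ E <;> simp [h]

variable {g h : S → X}

theorem integrable (hg : RadonBounded g) (ρ : Measure S) [IsFiniteMeasure ρ] [ρ.InnerRegular] :
    Integrable g ρ := by
  obtain ⟨C, hC⟩ := hg.bdd
  exact Integrable.of_bound (hg.meas ρ) C (Eventually.of_forall hC)

theorem add (hg : RadonBounded g) (hh : RadonBounded h) : RadonBounded (fun s => g s + h s) := by
  obtain ⟨C, hC⟩ := hg.bdd
  obtain ⟨D, hD⟩ := hh.bdd
  exact ⟨⟨C + D, fun s => (norm_add_le _ _).trans (add_le_add (hC s) (hD s))⟩,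
    fun ρ _ _ => (hg.meas ρ).add (hh.meas ρ)⟩

theorem smul {w : S → ℂ} (hw : RadonBounded w) (hg : RadonBounded g) :
    RadonBounded (fun s => w s • g s) := by
  obtain ⟨C, hC⟩ := hw.bdd
  obtain ⟨D, hD⟩ := hg.bdd
  refine ⟨⟨C * D, fun s => ?_⟩, fun ρ _ _ => (hw.meas ρ).smul (hg.meas ρ)⟩
  rw [norm_smul]
  exact mul_le_mul (hC s) (hD s) (norm_nonneg _) ((norm_nonneg _).trans (hC s))

theorem clm_comp {Y : Type*} [NormedAddCommGroup Y] [NormedSpace ℂ Y] (L : X →L[ℂ] Y)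
    (hg : RadonBounded g) : RadonBounded (fun s => L (g s)) := by
  obtain ⟨C, hC⟩ := hg.bdd
  exact ⟨⟨‖L‖ * C, fun s => (L.le_opNorm _).trans (by gcongr; exact hC s)⟩,
    fun ρ _ _ => L.continuous.comp_aestronglyMeasurable (hg.meas ρ)⟩

theorem comp (hg : RadonBounded g) (φ : C(S, S)) : RadonBounded (fun s => g (φ s)) := by
  obtain ⟨C, hC⟩ := hg.bdd
  refine ⟨⟨C, fun s => hC _⟩, fun ρ _ _ => ?_⟩
  have := Measure.InnerRegular.map_of_continuous (μ := ρ) φ.continuous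
  exact (hg.meas (ρ.map φ)).comp_measurable φ.continuous.measurable

theorem const_smul (c : ℂ) (hg : RadonBounded g) : RadonBounded (fun s => c • g s) :=
  hg.clm_comp (c • ContinuousLinearMap.id ℂ X)

theorem sub (hg : RadonBounded g) (hh : RadonBounded h) : RadonBounded (fun s => g s - h s) := by
  simpa [sub_eq_add_neg] using hg.add (hh.const_smul (-1))

end RadonBounded

namespace RadonMeasure

/-- The integral `∫ g dα` of a vector-valued function against a bounded complex Radon measure. -/
noncomputable def pair (α : RadonMeasure S) (g : S → X) : X :=
  VectorMeasure.integral (α : ComplexMeasure S) g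
    (ContinuousLinearMap.lsmul ℝ ℂ : ℂ →L[ℝ] X →L[ℝ] X).flip

theorem integrable_abs_dens {ρ : Measure S} [IsFiniteMeasure ρ] [ρ.InnerRegular] {f : S → ℂ}
    (hf : Integrable f ρ) {g : S → X} :
    Integrable g (dens ρ f).abs ↔ Integrable (fun s => ‖f s‖ • g s) ρ := by
  rw [abs_dens hf, integrable_withDensity_iff_integrable_smul₀' hf.aestronglyMeasurable.enorm
    (by simp)]
  simp

theorem integrable_smul_iff {α : Type*} [MeasurableSpace α] {ρ : Measure α} {f : α → ℂ}
    (hf : AEStronglyMeasurable f ρ) {g : α → X} :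
    Integrable (fun s => ‖f s‖ • g s) ρ ↔ Integrable (fun s => f s • g s) ρ := by
  have h1 : ∀ s, f s • g s = (f s * (‖f s‖⁻¹ : ℝ)) • (‖f s‖ • g s) := fun s => by
    rcases eq_or_ne (f s) 0 with h | h
    · simp [h]
    · have h' : ((‖f s‖ : ℝ) : ℂ) ≠ 0 := by simpa using h
      rw [← Complex.coe_smul, smul_smul]
      congr 1
      push_cast
      field_simp
  have h2 : ∀ s, ‖f s‖ • g s = ((‖f s‖ : ℂ) * (f s)⁻¹) • (f s • g s) := fun s => by
    rcases eq_or_ne (f s) 0 with h | h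
    · simp [h]
    · rw [← Complex.coe_smul, smul_smul]
      congr 1
      field_simp
  have hm : ∀ z : ℂ, ‖z * (‖z‖⁻¹ : ℝ)‖ ≤ 1 := fun z => by
    rw [norm_mul, Complex.norm_real, norm_inv, norm_norm]
    exact mul_inv_le_one
  have hm' : ∀ z : ℂ, ‖(‖z‖ : ℂ) * z⁻¹‖ ≤ 1 := fun z => by
    rw [norm_mul, Complex.norm_real, norm_inv, norm_norm]
    exact mul_inv_le_one
  constructor
  · intro h
    simp_rw [h1]
    refine Integrable.bdd_smul h 1 ?_ (Eventually.of_forall fun s => hm _)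
    exact hf.mul (Complex.continuous_ofReal.comp_aestronglyMeasurable hf.norm.inv₀)
  · intro h
    simp_rw [h2]
    refine Integrable.bdd_smul h 1 ?_ (Eventually.of_forall fun s => hm' _)
    exact (Complex.continuous_ofReal.comp_aestronglyMeasurable hf.norm).mul hf.inv₀

theorem integrable_dens_smul {ρ : Measure S} [IsFiniteMeasure ρ] [ρ.InnerRegular] {f : S → ℂ}
    (hf : Integrable f ρ) {g : S → X} (hg : Integrable g (dens ρ f).abs) :
    Integrable (fun s => f s • g s) ρ :=
  (integrable_smul_iff hf.aestronglyMeasurable).1 ((integrable_abs_dens hf).1 hg)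

theorem integral_norm_abs_dens {ρ : Measure S} [IsFiniteMeasure ρ] [ρ.InnerRegular] {f : S → ℂ}
    (hf : Integrable f ρ) (g : S → X) :
    ∫ s, ‖g s‖ ∂(dens ρ f).abs = ∫ s, ‖f s • g s‖ ∂ρ := by
  rw [abs_dens hf, integral_withDensity_eq_integral_toReal_smul₀ hf.aestronglyMeasurable.enorm
    (by simp)]
  simp [norm_smul]

/-- On a measure with a density, the integral against a vector measure is a Bochner integral. -/
theorem pair_dens [CompleteSpace X] {ρ : Measure S} [IsFiniteMeasure ρ] [ρ.InnerRegular]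
    {f : S → ℂ} (hf : Integrable f ρ) {g : S → X} (hg : Integrable g (dens ρ f).abs) :
    pair (dens ρ f) g = ∫ s, f s • g s ∂ρ := by
  revert g
  refine Integrable.induction _ ?_ ?_ ?_ ?_
  · intro c E hE _
    have h1 : pair (dens ρ f) (E.indicator fun _ => c) = (∫ s in E, f s ∂ρ) • c := by
      rw [← dens_apply hf hE]
      exact setToFun_indicator_const _ hE (measure_ne_top (dens ρ f).abs E) c
    rw [h1, ← integral_smul_const, ← integral_indicator hE]
    congr 1
    ext s
    by_cases h : s ∈ E <;> simp [h]
  · intro g h _ hg hh h1 h2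
    have h3 : pair (dens ρ f) (g + h) = pair (dens ρ f) g + pair (dens ρ f) h :=
      VectorMeasure.integral_add hg hh
    rw [h3, h1, h2, ← integral_add (integrable_dens_smul hf hg) (integrable_dens_smul hf hh)]
    simp
  · refine isClosed_eq VectorMeasure.continuous_integral ?_
    rw [Metric.continuous_iff]
    intro u ε hε
    refine ⟨ε, hε, fun v huv => lt_of_le_of_lt ?_ huv⟩
    rw [dist_eq_norm, dist_eq_norm, ← integral_sub
      (integrable_dens_smul hf (L1.integrable_coeFn v))
      (integrable_dens_smul hf (L1.integrable_coeFn u)), L1.norm_eq_integral_norm]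
    refine (norm_integral_le_integral_norm _).trans (le_of_eq ?_)
    have h1 : ∫ s, ‖(v - u) s‖ ∂(dens ρ f).abs = ∫ s, ‖v s - u s‖ ∂(dens ρ f).abs := by
      refine integral_congr_ae ?_
      filter_upwards [Lp.coeFn_sub v u] with s hs
      rw [hs]; rfl
    rw [h1, integral_norm_abs_dens hf]
    simp only [smul_sub]
  · intro g h hgh hg h1
    have h2 : pair (dens ρ f) h = pair (dens ρ f) g :=
      VectorMeasure.integral_congr_ae hgh.symm
    rw [h2, h1]
    rw [abs_dens hf] at hgh
    refine integral_congr_ae ?_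
    have := (ae_withDensity_iff' hf.aestronglyMeasurable.enorm).1 hgh
    filter_upwards [this] with s hs
    rcases eq_or_ne (f s) 0 with h0 | h0
    · simp [h0]
    · rw [hs (by simpa using h0)]

theorem pair_dens' [CompleteSpace X] {ρ : Measure S} [IsFiniteMeasure ρ] [ρ.InnerRegular]
    {f : S → ℂ} (hf : Integrable f ρ) {g : S → X} (hg : RadonBounded g) :
    pair (dens ρ f) g = ∫ s, f s • g s ∂ρ :=
  pair_dens hf (hg.integrable _)

theorem integrable_smul_of_radonBounded {ρ : Measure S} [IsFiniteMeasure ρ] [ρ.InnerRegular]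
    {f : S → ℂ} (hf : Integrable f ρ) {g : S → X} (hg : RadonBounded g) :
    Integrable (fun s => f s • g s) ρ :=
  integrable_dens_smul hf (hg.integrable _)

/-- The density `dα/d|α|`. -/
noncomputable def density (α : RadonMeasure S) : S → ℂ :=
  (exists_eq_dens α α.abs Measure.AbsolutelyContinuous.rfl).choose

theorem measurable_density (α : RadonMeasure S) : Measurable α.density :=
  (exists_eq_dens α α.abs Measure.AbsolutelyContinuous.rfl).choose_spec.1

theorem integrable_density (α : RadonMeasure S) : Integrable α.density α.abs :=
  (exists_eq_dens α α.abs Measure.AbsolutelyContinuous.rfl).choose_spec.2.1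

theorem dens_density (α : RadonMeasure S) : dens α.abs α.density = α :=
  (exists_eq_dens α α.abs Measure.AbsolutelyContinuous.rfl).choose_spec.2.2.symm

theorem norm_pair_le_integral [CompleteSpace X] (α : RadonMeasure S) {g : S → X}
    (hg : Integrable g α.abs) : ‖pair α g‖ ≤ ∫ s, ‖g s‖ ∂α.abs := by
  have h1 := integrable_density α
  conv_lhs => rw [← dens_density α]
  conv_rhs => rw [← dens_density α]
  rw [pair_dens h1 (by rwa [dens_density]), integral_norm_abs_dens h1]
  exact norm_integral_le_integral_norm _

theorem norm_pair_le [CompleteSpace X] (α : RadonMeasure S) {g : S → X} (hg : RadonBounded g)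
    {C : ℝ} (hC : ∀ s, ‖g s‖ ≤ C) : ‖pair α g‖ ≤ C * ‖α‖ := by
  refine (norm_pair_le_integral α (hg.integrable _)).trans ?_
  refine (integral_mono (hg.integrable _).norm (integrable_const C) hC).trans ?_
  rw [integral_const, smul_eq_mul, mul_comm]
  rfl

theorem pair_add_left [CompleteSpace X] (α β : RadonMeasure S) {g : S → X} (hg : RadonBounded g) :
    pair (α + β) g = pair α g + pair β g := by
  obtain ⟨ρ, _, _, f, h, hf, hh, rfl, rfl⟩ := exists_eq_dens₂ α β
  rw [← dens_add hf hh, pair_dens' (hf.add hh) hg, pair_dens' hf hg, pair_dens' hh hg,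
    ← integral_add (integrable_smul_of_radonBounded hf hg)
      (integrable_smul_of_radonBounded hh hg)]
  simp [add_smul]

theorem pair_smul_left [CompleteSpace X] (c : ℂ) (α : RadonMeasure S) {g : S → X}
    (hg : RadonBounded g) : pair (c • α) g = c • pair α g := by
  obtain ⟨ρ, _, _, f, -, hf, -, rfl, -⟩ := exists_eq_dens₂ α 0
  rw [← dens_smul, pair_dens' (hf.smul c) hg, pair_dens' hf hg, ← integral_smul]
  simp [smul_smul]

/-- Integration of a fixed bounded function, as a bounded linear map on `M(S)`. -/
noncomputable def pairL [CompleteSpace X] {g : S → X} (hg : RadonBounded g) :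
    RadonMeasure S →L[ℂ] X :=
  LinearMap.mkContinuousOfExistsBound
    { toFun := fun α => pair α g
      map_add' := fun α β => pair_add_left α β hg
      map_smul' := fun c α => pair_smul_left c α hg }
    (by
      obtain ⟨C, hC⟩ := hg.bdd
      exact ⟨C, fun α => norm_pair_le α hg hC⟩)

@[simp]
theorem pairL_apply [CompleteSpace X] {g : S → X} (hg : RadonBounded g) (α : RadonMeasure S) :
    pairL hg α = pair α g := rfl

/-- Bounded linear maps commute with integrals against complex Radon measures. -/
theorem clm_pair {Y : Type*} [NormedAddCommGroup Y] [NormedSpace ℂ Y] [CompleteSpace X]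
    [CompleteSpace Y] (L : X →L[ℂ] Y) (α : RadonMeasure S) {g : S → X} (hg : RadonBounded g) :
    L (pair α g) = pair α (fun s => L (g s)) := by
  have h1 := integrable_density α
  rw [← dens_density α, pair_dens' h1 hg, pair_dens' h1 (hg.clm_comp L),
    ← L.integral_comp_comm (integrable_smul_of_radonBounded h1 hg)]
  simp

theorem pair_add_right [CompleteSpace X] (α : RadonMeasure S) {g h : S → X} (hg : RadonBounded g)
    (hh : RadonBounded h) : pair α (fun s => g s + h s) = pair α g + pair α h :=
  VectorMeasure.integral_add (hg.integrable α.abs) (hh.integrable α.abs)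

theorem pair_const_smul_right [CompleteSpace X] (α : RadonMeasure S) (c : ℂ) {g : S → X}
    (hg : RadonBounded g) : pair α (fun s => c • g s) = c • pair α g :=
  (clm_pair (c • ContinuousLinearMap.id ℂ X) α hg).symm

theorem pair_sub_right [CompleteSpace X] (α : RadonMeasure S) {g h : S → X} (hg : RadonBounded g)
    (hh : RadonBounded h) : pair α (fun s => g s - h s) = pair α g - pair α h :=
  VectorMeasure.integral_sub (hg.integrable α.abs) (hh.integrable α.abs)

theorem pair_ofMeasure [CompleteSpace X] (ρ : Measure S) [IsFiniteMeasure ρ] [ρ.InnerRegular]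
    {g : S → X} (hg : RadonBounded g) : pair (ofMeasure ρ) g = ∫ s, g s ∂ρ := by
  rw [ofMeasure_eq_dens_one, pair_dens' (integrable_const _) hg]
  simp

theorem pair_indicator (α : RadonMeasure S) {E : Set S} (hE : MeasurableSet E) :
    pair α (E.indicator fun _ => (1 : ℂ)) = (α : ComplexMeasure S) E := by
  have h : pair α (E.indicator fun _ => (1 : ℂ)) = (α : ComplexMeasure S) E • (1 : ℂ) :=
    setToFun_indicator_const _ hE (measure_ne_top α.abs E) 1
  rw [h, smul_eq_mul, mul_one]

theorem ext_pair {α β : RadonMeasure S} (h : ∀ g : S → ℂ, RadonBounded g → pair α g = pair β g) :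
    α = β :=
  ext_apply fun E hE => by
    rw [← pair_indicator α hE, ← pair_indicator β hE, h _ (RadonBounded.indicator_one hE)]

/-- A bounded Radon measure is determined by its integrals of continuous functions with compact
support. -/
theorem ext_of_hasCompactSupport [LocallyCompactSpace S] {α β : RadonMeasure S}
    (h : ∀ g : S → ℂ, Continuous g → HasCompactSupport g → pair α g = pair β g) : α = β := by
  rw [← sub_eq_zero]
  set γ := α - β with hγ
  have h0 : ∀ g : S → ℂ, Continuous g → HasCompactSupport g → pair γ g = 0 := by
    intro g hg hgc
    obtain ⟨C, hC⟩ := hgc.exists_bound_of_continuous hg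
    have hb := RadonBounded.of_continuous hg hC
    rw [← pairL_apply hb, hγ, map_sub, pairL_apply, pairL_apply, h g hg hgc, sub_self]
  have hK : ∀ K : Set S, IsCompact K → (γ : ComplexMeasure S) K = 0 := by
    intro K hK
    rw [← norm_le_zero_iff]
    refine le_of_forall_pos_le_add fun ε hε => ?_
    rw [zero_add]
    obtain ⟨U, hKU, hU, hlt⟩ := hK.exists_isOpen_lt_add (μ := γ.abs)
      (ε := ENNReal.ofReal ε) (by simpa using hε)
    obtain ⟨f, hf1, hf0, hfc, hf⟩ := exists_continuous_one_zero_of_isCompact hK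
      hU.isClosed_compl (disjoint_compl_right_iff_subset.2 hKU)
    set g : S → ℂ := fun s => (f s : ℂ)
    have hg : Continuous g := Complex.continuous_ofReal.comp f.continuous
    have hgc : HasCompactSupport g := hfc.comp_left (g := fun x : ℝ => (x : ℂ)) (by simp)
    have hgb : RadonBounded g := RadonBounded.of_continuous hg (C := 1) fun s => by
      simp only [g, Complex.norm_real, Real.norm_eq_abs]
      exact abs_le.2 ⟨by linarith [(hf s).1], (hf s).2⟩
    have hKb := RadonBounded.indicator_one hK.measurableSet
    rw [← pair_indicator γ hK.measurableSet,
      show pair γ (K.indicator fun _ => (1 : ℂ)) =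
        pair γ (fun s => K.indicator (fun _ => (1 : ℂ)) s - g s) by
        rw [pair_sub_right γ hKb hgb, h0 g hg hgc, sub_zero]]
    refine (norm_pair_le_integral γ ((hKb.sub hgb).integrable _)).trans ?_
    have hle : ∀ s, ‖K.indicator (fun _ => (1 : ℂ)) s - g s‖ ≤
        (U \ K).indicator (fun _ => (1 : ℝ)) s := by
      intro s
      by_cases hs : s ∈ K
      · simp [hs, g, hf1 hs]
      · by_cases hs' : s ∈ U
        · simp only [hs, not_false_eq_true, indicator_of_notMem, zero_sub, norm_neg, g,
            Complex.norm_real, Real.norm_eq_abs]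
          rw [indicator_of_mem (show s ∈ U \ K from ⟨hs', hs⟩)]
          exact abs_le.2 ⟨by linarith [(hf s).1], (hf s).2⟩
        · simp [hs, hs', g, hf0 (show s ∈ Uᶜ from hs')]
    have hmeas : MeasurableSet (U \ K) := hU.measurableSet.diff hK.measurableSet
    refine (integral_mono ((hKb.sub hgb).integrable _).norm
      ((integrable_const (1 : ℝ)).indicator hmeas) hle).trans ?_
    rw [integral_indicator hmeas]
    simp only [integral_const, smul_eq_mul, mul_one]
    rw [measureReal_restrict_apply MeasurableSet.univ, univ_inter, measureReal_def]
    refine ENNReal.toReal_le_of_le_ofReal hε.le ?_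
    rw [measure_sdiff hKU hK.measurableSet.nullMeasurableSet (measure_ne_top _ _)]
    exact tsub_le_iff_left.2 hlt.le
  refine ext_apply fun E hE => ?_
  change (γ : ComplexMeasure S) E = 0
  rw [← norm_le_zero_iff]
  refine le_of_forall_pos_le_add fun ε hε => ?_
  rw [zero_add]
  obtain ⟨K, hKE, hKc, hlt⟩ := hE.exists_isCompact_sdiff_lt (μ := γ.abs) (measure_ne_top _ E)
    (ε := ENNReal.ofReal ε) (by simpa using hε)
  have h1 : (γ : ComplexMeasure S) E = (γ : ComplexMeasure S) K + (γ : ComplexMeasure S) (E \ K) := by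
    rw [← VectorMeasure.of_union disjoint_sdiff_right hKc.measurableSet
      (hE.diff hKc.measurableSet), union_sdiff_cancel hKE]
  rw [h1, hK K hKc, zero_add]
  refine (norm_apply_le_abs γ _).trans ?_
  exact ENNReal.toReal_le_of_le_ofReal hε.le hlt.le

end RadonMeasure

end Pairing

/-! ### Images and multiples of complex Radon measures -/

section Operations

variable {S : Type*} [TopologicalSpace S] [T2Space S] [MeasurableSpace S] [BorelSpace S]
variable {X : Type*} [NormedAddCommGroup X] [NormedSpace ℂ X]

namespace RadonMeasure

theorem abs_push_aux (φ : C(S, S)) (α : RadonMeasure S) :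
    (VectorMeasure.map (α : ComplexMeasure S) φ).variation ≤ α.abs.map φ :=
  VectorMeasure.variation_map_le

/-- The image of a bounded complex Radon measure under a continuous map. -/
noncomputable def push (φ : C(S, S)) : RadonMeasure S →L[ℂ] RadonMeasure S :=
  LinearMap.mkContinuous
    { toFun := fun α => ⟨VectorMeasure.map (α : ComplexMeasure S) φ,
        isFiniteMeasure_of_le _ (abs_push_aux φ α), innerRegular_of_le (abs_push_aux φ α)⟩
      map_add' := fun α β => ext_apply fun E hE => by
        change VectorMeasure.map (α + β : ComplexMeasure S) φ E =
          VectorMeasure.map (α : ComplexMeasure S) φ E + VectorMeasure.map (β : ComplexMeasure S) φ E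
        rw [VectorMeasure.map_apply _ φ.continuous.measurable hE,
          VectorMeasure.map_apply _ φ.continuous.measurable hE,
          VectorMeasure.map_apply _ φ.continuous.measurable hE]
        rfl
      map_smul' := fun c α => ext_apply fun E hE => by
        change VectorMeasure.map (c • α : ComplexMeasure S) φ E =
          c • VectorMeasure.map (α : ComplexMeasure S) φ E
        rw [VectorMeasure.map_apply _ φ.continuous.measurable hE,
          VectorMeasure.map_apply _ φ.continuous.measurable hE]
        rfl }
    1 fun α => by
      rw [one_mul]
      refine (ENNReal.toReal_mono (measure_ne_top _ _) (abs_push_aux φ α univ)).trans ?_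
      rw [Measure.map_apply φ.continuous.measurable MeasurableSet.univ]
      exact le_rfl

theorem abs_push_le (φ : C(S, S)) (α : RadonMeasure S) : (push φ α).abs ≤ α.abs.map φ :=
  abs_push_aux φ α

theorem push_apply (φ : C(S, S)) (α : RadonMeasure S) {E : Set S} (hE : MeasurableSet E) :
    (push φ α : ComplexMeasure S) E = (α : ComplexMeasure S) (φ ⁻¹' E) :=
  VectorMeasure.map_apply _ φ.continuous.measurable hE

theorem norm_push_le (φ : C(S, S)) (α : RadonMeasure S) : ‖push φ α‖ ≤ ‖α‖ := by
  have := (push φ).le_of_opNorm_le (LinearMap.mkContinuous_norm_le _ zero_le_one _) α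
  rwa [one_mul] at this

theorem pair_push (φ : C(S, S)) (α : RadonMeasure S) {g : S → X} (hg : RadonBounded g) :
    pair (push φ α) g = pair α (fun s => g (φ s)) :=
  have : IsFiniteMeasure ((α : ComplexMeasure S).variation.map φ) := isFiniteMeasure_map α.abs φ
  have : ((α : ComplexMeasure S).variation.map φ).InnerRegular := innerRegular_map α.abs φ
  VectorMeasure.integral_map φ.continuous.measurable (hg.meas _)
    ((hg.comp φ).integrable α.abs)

theorem push_ofMeasure (φ : C(S, S)) (ρ : Measure S) [IsFiniteMeasure ρ] [ρ.InnerRegular] :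
    push φ (ofMeasure ρ) = ofMeasure (ρ.map φ) := by
  refine ext_apply fun E hE => ?_
  rw [push_apply φ _ hE, ofMeasure_apply _ hE, ofMeasure_apply _ (φ.continuous.measurable hE),
    measureReal_def, measureReal_def, Measure.map_apply φ.continuous.measurable hE]

/-- The product `w α` of a bounded Radon measure with a bounded function. -/
noncomputable def mulFun (w : S → ℂ) (α : RadonMeasure S) : RadonMeasure S :=
  dens α.abs (fun s => w s * α.density s)

theorem integrable_mul_of_radonBounded {ρ : Measure S} [IsFiniteMeasure ρ] [ρ.InnerRegular]
    {f w : S → ℂ} (hf : Integrable f ρ) (hw : RadonBounded w) :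
    Integrable (fun s => w s * f s) ρ := by
  simpa [mul_comm] using integrable_smul_of_radonBounded hf hw

theorem pair_mulFun [CompleteSpace X] {w : S → ℂ} (hw : RadonBounded w) (α : RadonMeasure S)
    {g : S → X} (hg : RadonBounded g) : pair (mulFun w α) g = pair α (fun s => w s • g s) := by
  have h1 := integrable_density α
  rw [mulFun, pair_dens' (integrable_mul_of_radonBounded h1 hw) hg]
  conv_rhs => rw [← dens_density α]
  rw [pair_dens' h1 (hw.smul hg)]
  simp only [smul_smul, mul_comm]

theorem norm_mulFun_le_integral {w : S → ℂ} (hw : RadonBounded w) (α : RadonMeasure S) :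
    ‖mulFun w α‖ ≤ ∫ s, ‖w s‖ ∂α.abs := by
  have h1 := integrable_density α
  rw [mulFun, norm_dens (integrable_mul_of_radonBounded h1 hw)]
  conv_rhs => rw [← dens_density α]
  rw [integral_norm_abs_dens h1]
  simp [mul_comm]

theorem norm_mulFun_le {w : S → ℂ} (hw : RadonBounded w) (α : RadonMeasure S) {C : ℝ}
    (hC : ∀ s, ‖w s‖ ≤ C) : ‖mulFun w α‖ ≤ C * ‖α‖ := by
  refine (norm_mulFun_le_integral hw α).trans ?_
  refine (integral_mono (hw.integrable _).norm (integrable_const C) hC).trans ?_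
  rw [integral_const, smul_eq_mul, mul_comm]
  rfl

theorem mulFun_sub_left {w v : S → ℂ} (hw : RadonBounded w) (hv : RadonBounded v)
    (α : RadonMeasure S) : mulFun (fun s => w s - v s) α = mulFun w α - mulFun v α := by
  have h1 := integrable_density α
  rw [mulFun, mulFun, mulFun, ← dens_sub (integrable_mul_of_radonBounded h1 hw)
    (integrable_mul_of_radonBounded h1 hv)]
  congr 1
  ext s
  simp [sub_mul]

theorem abs_mulFun_ac {w : S → ℂ} (hw : RadonBounded w) (α : RadonMeasure S) :
    (mulFun w α).abs ≪ α.abs := by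
  rw [mulFun, abs_dens (integrable_mul_of_radonBounded (integrable_density α) hw)]
  exact withDensity_absolutelyContinuous _ _

/-- Multiplication by a bounded function, as a bounded linear map on `M(S)`. -/
noncomputable def mulL {w : S → ℂ} (hw : RadonBounded w) : RadonMeasure S →L[ℂ] RadonMeasure S :=
  LinearMap.mkContinuousOfExistsBound
    { toFun := mulFun w
      map_add' := fun α β => ext_pair fun g hg => by
        rw [pair_mulFun hw _ hg, pair_add_left _ _ (hw.smul hg), pair_add_left _ _ hg,
          pair_mulFun hw _ hg, pair_mulFun hw _ hg]
      map_smul' := fun c α => ext_pair fun g hg => by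
        rw [RingHom.id_apply, pair_mulFun hw _ hg, pair_smul_left _ _ (hw.smul hg),
          pair_smul_left _ _ hg, pair_mulFun hw _ hg] }
    (by
      obtain ⟨C, hC⟩ := hw.bdd
      exact ⟨C, fun α => norm_mulFun_le hw α hC⟩)

@[simp]
theorem mulL_apply {w : S → ℂ} (hw : RadonBounded w) (α : RadonMeasure S) :
    mulL hw α = mulFun w α := rfl

/-- The norm of a bounded Radon measure is attained on Borel functions of modulus at most `1`. -/
theorem exists_norm_eq_pair (α : RadonMeasure S) : ∃ f : S → ℂ, Measurable f ∧
    (∀ s, ‖f s‖ ≤ 1) ∧ (‖α‖ : ℂ) = pair α f := by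
  have h1 := integrable_density α
  have hm := measurable_density α
  set u := α.density with hu
  have hb : ∀ s, ‖(starRingEnd ℂ) (u s) * (‖u s‖⁻¹ : ℝ)‖ ≤ 1 := fun s => by
    rw [norm_mul, Complex.norm_real, norm_inv, norm_norm, RCLike.norm_conj]
    exact mul_inv_le_one
  have hfm : Measurable fun s => (starRingEnd ℂ) (u s) * (‖u s‖⁻¹ : ℝ) :=
    (Complex.continuous_conj.measurable.comp hm).mul
      (Complex.measurable_ofReal.comp hm.norm.inv)
  refine ⟨_, hfm, hb, ?_⟩
  have hR := RadonBounded.of_measurable hfm hb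
  calc (‖α‖ : ℂ) = ((∫ s, ‖u s‖ ∂α.abs : ℝ) : ℂ) := by
        rw [← norm_dens h1, dens_density]
    _ = ∫ s, ((‖u s‖ : ℝ) : ℂ) ∂α.abs := integral_complex_ofReal.symm
    _ = ∫ s, u s • ((starRingEnd ℂ) (u s) * (‖u s‖⁻¹ : ℝ)) ∂α.abs := by
        congr 1
        ext s
        rw [smul_eq_mul, ← mul_assoc, Complex.mul_conj, Complex.normSq_eq_norm_sq]
        rcases eq_or_ne (u s) 0 with h | h
        · simp [h]
        · have : ((‖u s‖ : ℝ) : ℂ) ≠ 0 := by simpa using h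
          push_cast
          field_simp
    _ = pair (dens α.abs u) _ := (pair_dens' h1 hR).symm
    _ = _ := by rw [dens_density]

end RadonMeasure

/-- The integral `x ↦ ∫ k(x, y) dρ(y)` of a bounded jointly continuous function is continuous. -/
theorem continuous_integral_of_bounded {T : Type*} [TopologicalSpace T] (ρ : Measure S)
    [IsFiniteMeasure ρ] [ρ.InnerRegular] {E : Type*} [NormedAddCommGroup E] [NormedSpace ℝ E]
    {k : T → S → E} (hk : Continuous (Function.uncurry k)) {C : ℝ} (hC : ∀ x y, ‖k x y‖ ≤ C) :
    Continuous fun x => ∫ y, k x y ∂ρ := by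
  rw [continuous_iff_continuousAt]
  intro x₀
  have hint : ∀ x, Integrable (k x) ρ := fun x => Integrable.of_bound
    (aestronglyMeasurable_of_continuous (hk.comp (Continuous.prodMk_right x)) ρ) C
    (Eventually.of_forall (hC x))
  have hC' : ∀ x y, ‖k x y‖ ≤ |C| := fun x y => (hC x y).trans (le_abs_self C)
  rw [Metric.continuousAt_iff']
  intro ε hε
  set M := ρ.real univ
  have hM : 0 ≤ M := measureReal_nonneg
  set η := ε / (3 * (M + 1)) with hη
  have hη0 : 0 < η := by positivity
  obtain ⟨Q, -, hQ, hlt⟩ := MeasurableSet.univ.exists_isCompact_sdiff_lt (μ := ρ)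
    (measure_ne_top _ _) (ε := ENNReal.ofReal (ε / (6 * (|C| + 1))))
    (by simpa using by positivity)
  have hev : ∀ᶠ x in 𝓝 x₀, ∀ y ∈ Q, ‖k x y - k x₀ y‖ < η := by
    refine hQ.eventually_forall_of_forall_eventually fun y _ => ?_
    have hcont : Continuous fun z : T × S => ‖k z.1 z.2 - k x₀ z.2‖ :=
      (hk.sub (hk.comp (continuous_const.prodMk continuous_snd))).norm
    refine (hcont.tendsto (x₀, y)).eventually (gt_mem_nhds ?_)
    simpa using hη0
  filter_upwards [hev] with x hx
  rw [dist_eq_norm, ← integral_sub (hint x) (hint x₀)]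
  have hQm : MeasurableSet (univ \ Q) := MeasurableSet.univ.diff hQ.measurableSet
  have hbound : ∀ y, ‖k x y - k x₀ y‖ ≤ η + (univ \ Q).indicator (fun _ => 2 * |C|) y := by
    intro y
    by_cases hy : y ∈ Q
    · simpa [hy] using (hx y hy).le
    · have := (norm_sub_le _ _).trans (add_le_add (hC' x y) (hC' x₀ y))
      rw [indicator_of_mem (show y ∈ univ \ Q from ⟨mem_univ _, hy⟩)]
      linarith
  have hi : Integrable ((univ \ Q).indicator fun _ : S => 2 * |C|) ρ :=
    (integrable_const _).indicator hQm
  refine lt_of_le_of_lt ((norm_integral_le_integral_norm _).trans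
    (integral_mono ((hint x).sub (hint x₀)).norm ((integrable_const η).add hi) hbound)) ?_
  have h1 : ∫ y, (η + (univ \ Q).indicator (fun _ => 2 * |C|) y) ∂ρ =
      M * η + ρ.real (univ \ Q) * (2 * |C|) := by
    rw [integral_add (integrable_const η) hi, integral_indicator hQm, integral_const,
      integral_const, measureReal_restrict_apply_univ, smul_eq_mul, smul_eq_mul]
  have h2 : ρ.real (univ \ Q) ≤ ε / (6 * (|C| + 1)) :=
    ENNReal.toReal_le_of_le_ofReal (by positivity) hlt.le
  have h3 : ρ.real (univ \ Q) * (2 * |C|) ≤ ε / 3 := by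
    calc _ ≤ ε / (6 * (|C| + 1)) * (2 * |C|) := by gcongr
      _ ≤ ε / (6 * (|C| + 1)) * (2 * (|C| + 1)) := by gcongr; linarith
      _ = ε / 3 := by field_simp; ring
  have h4 : M * η ≤ ε / 3 := by
    calc M * η ≤ (M + 1) * η := by gcongr; linarith
      _ = ε / 3 := by rw [hη]; field_simp
  simp only [Pi.add_apply]
  rw [h1]
  linarith

end Operations

/-! ### Setwise continuous families of measures -/

section Families

/-- Uniform approximation of bounded measurable functions by simple ones, as an induction
principle. -/
theorem bounded_measurable_induction {Y : Type*} [MeasurableSpace Y] {P : (Y → ℂ) → Prop}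
    (hind : ∀ (c : ℂ) (E : Set Y), MeasurableSet E → P (E.indicator fun _ => c))
    (hadd : ∀ (f g : Y → ℂ), Measurable f → Measurable g → (∃ C, ∀ x, ‖f x‖ ≤ C) →
      (∃ C, ∀ x, ‖g x‖ ≤ C) → P f → P g → P (f + g))
    (hlim : ∀ f : Y → ℂ, Measurable f → (∃ C, ∀ x, ‖f x‖ ≤ C) → (∀ ε > 0, ∃ g : Y → ℂ,
      Measurable g ∧ (∃ C, ∀ x, ‖g x‖ ≤ C) ∧ P g ∧ ∀ x, ‖f x - g x‖ ≤ ε) → P f)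
    {f : Y → ℂ} (hf : Measurable f) (hb : ∃ C, ∀ x, ‖f x‖ ≤ C) : P f := by
  have hsb : ∀ g : SimpleFunc Y ℂ, ∃ C, ∀ x, ‖g x‖ ≤ C := fun g => g.exists_forall_norm_le
  have hs : ∀ g : SimpleFunc Y ℂ, P g := by
    intro g
    induction g using SimpleFunc.induction with
    | @const c E hE =>
      rw [show ((SimpleFunc.piecewise E hE (SimpleFunc.const Y c) (SimpleFunc.const Y 0) :
        SimpleFunc Y ℂ) : Y → ℂ) = E.indicator fun _ => c by
          ext x; by_cases h : x ∈ E <;> simp [h]]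
      exact hind c E hE
    | @add f g _ hf hg =>
      exact hadd f g f.measurable g.measurable (hsb f) (hsb g) hf hg
  refine hlim f hf hb fun ε hε => ?_
  obtain ⟨C, hC⟩ := hb
  obtain ⟨t, htfin, ht⟩ := Metric.totallyBounded_iff.1
    (isCompact_closedBall (0 : ℂ) C).totallyBounded ε hε
  rcases htfin.toFinset.eq_empty_or_nonempty with h0 | hne
  · have ht0 : t = ∅ := by simpa using h0
    refine ⟨fun _ => 0, measurable_const, ⟨0, by simp⟩, ?_, fun x => ?_⟩
    · simpa using hind 0 ∅ MeasurableSet.empty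
    · have := ht (show f x ∈ Metric.closedBall (0 : ℂ) C by simpa using hC x)
      simp [ht0] at this
  · have htne : t.Nonempty := by simpa using hne
    obtain ⟨e, he⟩ := htfin.countable.exists_eq_range htne
    have hN : ∃ N, ∀ y ∈ t, ∃ k ≤ N, e k = y := by
      have : ∀ y ∈ t, ∃ k, e k = y := fun y hy => by rw [he] at hy; exact hy
      choose! k hk using this
      refine ⟨htfin.toFinset.sup k, fun y hy => ⟨k y, ?_, hk y hy⟩⟩
      exact Finset.le_sup (f := k) (by simpa using hy)
    obtain ⟨N, hN⟩ := hN
    let g : SimpleFunc Y ℂ := (SimpleFunc.nearestPt e N).comp f hf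
    refine ⟨g, g.measurable, hsb g, hs g, fun x => ?_⟩
    have hx := ht (show f x ∈ Metric.closedBall (0 : ℂ) C by simpa using hC x)
    simp only [mem_iUnion, Metric.mem_ball, exists_prop] at hx
    obtain ⟨y, hy, hxy⟩ := hx
    obtain ⟨k, hk, rfl⟩ := hN y hy
    have h1 := SimpleFunc.edist_nearestPt_le e (f x) hk
    rw [edist_dist, edist_dist, ENNReal.ofReal_le_ofReal_iff dist_nonneg] at h1
    rw [← dist_eq_norm, dist_comm]
    refine h1.trans ?_
    rw [dist_comm]
    exact hxy.le

variable {S : Type*} [TopologicalSpace S] [T2Space S] [MeasurableSpace S] [BorelSpace S]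
variable {T : Type*} [TopologicalSpace T]

/-- The measures `ρ x`, `x ∈ K`, are uniformly absolutely continuous with respect to `lam`. -/
def UnifAC (lam : Measure S) (ρ : T → Measure S) (K : Set T) : Prop :=
  ∀ ε : ℝ, 0 < ε → ∃ δ : ℝ, 0 < δ ∧ ∀ E, MeasurableSet E → lam.real E < δ →
    ∀ x ∈ K, (ρ x).real E < ε

/-- Dini's theorem: a setwise continuous family of finite measures is uniformly countably additive
over a compact set of parameters. -/
theorem tendstoUniformlyOn_measureReal {ρ : T → Measure S} [∀ x, IsFiniteMeasure (ρ x)]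
    (hρ : ∀ E, MeasurableSet E → Continuous fun x => (ρ x).real E) {K : Set T} (hK : IsCompact K)
    {E : ℕ → Set S} (hE : ∀ n, MeasurableSet (E n)) (hanti : Antitone E) (hempty : ⋂ n, E n = ∅) :
    TendstoUniformlyOn (fun n x => (ρ x).real (E n)) (fun _ => 0) atTop K := by
  refine Antitone.tendstoUniformlyOn_of_forall_tendsto hK
    (fun n => (hρ _ (hE n)).continuousOn) (fun x _ m n hmn => measureReal_mono (hanti hmn))
    continuousOn_const fun x _ => ?_
  have h := tendsto_measure_iInter_atTop (μ := ρ x) (fun n => (hE n).nullMeasurableSet) hanti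
    ⟨0, measure_ne_top _ _⟩
  rw [hempty, measure_empty] at h
  exact (ENNReal.tendsto_toReal ENNReal.zero_ne_top).comp h

/-- Over a compact set `K` of parameters, a setwise continuous family is uniformly small on the sets on
which finitely many of its members are small enough. Otherwise there are `x n ∈ K` and `E n` with
`ρ (x n) (E n) ≥ ε`, while `ρ (x m) (E n) ≤ 2⁻ⁿ` for `m < n`; by Borel–Cantelli `limsup E` is null for
all `ρ (x m)`, and the sets `⋃ k ≥ n, E k` without `limsup E` decrease to `∅`, which contradicts
uniform countable additivity. -/
theorem exists_finset_control {ρ : T → Measure S} [∀ x, IsFiniteMeasure (ρ x)]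
    (hρ : ∀ E, MeasurableSet E → Continuous fun x => (ρ x).real E) {K : Set T} (hK : IsCompact K)
    {ε : ℝ} (hε : 0 < ε) : ∃ (F : Finset T) (δ : ℝ), 0 < δ ∧ ∀ E, MeasurableSet E →
      (∀ i ∈ F, (ρ i).real E < δ) → ∀ x ∈ K, (ρ x).real E < ε := by
  classical
  by_contra hcon
  push Not at hcon
  obtain ⟨f, hP, hr⟩ := exists_seq_of_forall_finset_exists
    (fun a : T × Set S × ℕ => a.1 ∈ K ∧ MeasurableSet a.2.1 ∧ ε ≤ (ρ a.1).real a.2.1)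
    (fun a b => a.2.2 < b.2.2 ∧ (ρ a.1).real b.2.1 < (1 / 2) ^ b.2.2) (fun s _ => by
      obtain ⟨E, hE, hF, x, hx, hxε⟩ := hcon (s.image Prod.fst)
        ((1 / 2) ^ (s.sup (fun a => a.2.2) + 1)) (by positivity)
      refine ⟨(x, E, s.sup (fun a => a.2.2) + 1), ⟨hx, hE, hxε⟩, fun a ha => ⟨?_, ?_⟩⟩
      · exact Nat.lt_succ_of_le (Finset.le_sup (f := fun a : T × Set S × ℕ => a.2.2) ha)
      · exact hF _ (Finset.mem_image_of_mem _ ha))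
  set x : ℕ → T := fun n => (f n).1
  set E : ℕ → Set S := fun n => (f n).2.1
  have hmono : StrictMono fun n => (f n).2.2 := fun m n h => (hr m n h).1
  have hlt : ∀ m n, m < n → (ρ (x m)).real (E n) ≤ (1 / 2) ^ n := fun m n h =>
    (hr m n h).2.le.trans (pow_le_pow_of_le_one (by norm_num) (by norm_num) (hmono.id_le n))
  set L : Set S := limsup E atTop with hL
  have hLm : MeasurableSet L := MeasurableSet.measurableSet_limsup fun n => (hP n).2.1
  have hL0 : ∀ m, ρ (x m) L = 0 := by
    intro m
    refine measure_limsup_atTop_eq_zero ?_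
    have hsum : Summable fun n => (ρ (x m)).real (E n) := by
      refine Summable.of_norm_bounded_eventually_nat summable_geometric_two ?_
      filter_upwards [eventually_gt_atTop m] with n hn
      rw [Real.norm_of_nonneg measureReal_nonneg]
      exact hlt m n hn
    have := hsum.tsum_ofReal_ne_top
    rwa [tsum_congr fun n => ofReal_measureReal] at this
  set G : ℕ → Set S := fun n => (⋃ k ≥ n, E k) \ L with hG
  have hGm : ∀ n, MeasurableSet (G n) := fun n =>
    (MeasurableSet.biUnion (to_countable _) fun k _ => (hP k).2.1).diff hLm
  have hGanti : Antitone G := fun m n hmn =>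
    sdiff_subset_sdiff_left (biUnion_subset_biUnion_left fun k hk => le_trans hmn hk)
  have hGempty : ⋂ n, G n = ∅ := by
    rw [eq_empty_iff_forall_notMem]
    intro y hy
    rw [mem_iInter] at hy
    refine (hy 0).2 ?_
    rw [hL, limsup_eq_iInf_iSup_of_nat]
    simp only [iInf_eq_iInter, iSup_eq_iUnion, mem_iInter]
    exact fun n => (hy n).1
  have hunif := tendstoUniformlyOn_measureReal hρ hK hGm hGanti hGempty
  rw [Metric.tendstoUniformlyOn_iff] at hunif
  obtain ⟨n, hn⟩ := (hunif ε hε).exists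
  have h1 := hn (x n) (hP n).1
  rw [Real.dist_eq, zero_sub, abs_neg, abs_of_nonneg measureReal_nonneg] at h1
  refine absurd ((hP n).2.2.trans ?_) (not_le.2 h1)
  have h2 : (ρ (x n)).real (E n) ≤ (ρ (x n)).real (G n ∪ L) := by
    refine measureReal_mono fun y hy => ?_
    by_cases hyL : y ∈ L
    · exact Or.inr hyL
    · exact Or.inl ⟨mem_biUnion (show n ≥ n from le_rfl) hy, hyL⟩
  refine h2.trans ((measureReal_union_le _ _).trans ?_)
  rw [measureReal_def (ρ (x n)) L, hL0, ENNReal.toReal_zero, add_zero]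

/-- A setwise continuous family of finite Radon measures is, over a compact set of parameters,
uniformly absolutely continuous with respect to a single finite Radon measure. -/
theorem exists_unifAC {ρ : T → Measure S} [∀ x, IsFiniteMeasure (ρ x)]
    [∀ x, (ρ x).InnerRegular]
    (hρ : ∀ E, MeasurableSet E → Continuous fun x => (ρ x).real E) {K : Set T} (hK : IsCompact K) :
    ∃ lam : Measure S, IsFiniteMeasure lam ∧ lam.InnerRegular ∧ UnifAC lam ρ K := by
  choose F δ hδ H using fun n : ℕ =>
    exists_finset_control hρ hK (ε := 1 / ((n : ℝ) + 1)) Nat.one_div_pos_of_nat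
  -- The control measure is a convergent weighted sum of the finitely many measures needed for each
  -- `ε = 1 / (n + 1)`.
  obtain ⟨lam, c, h1, h2, hc, hle⟩ := exists_radon_dominating fun n => ∑ i ∈ F n, ρ i
  refine ⟨lam, h1, h2, fun ε hε => ?_⟩
  obtain ⟨n, hn⟩ := exists_nat_one_div_lt hε
  refine ⟨c n * δ n, mul_pos (by exact_mod_cast hc n) (hδ n), fun E hE hlt x hx => ?_⟩
  refine (H n E hE (fun i hi => ?_) x hx).trans hn
  have h3 : ρ i E ≤ (∑ j ∈ F n, ρ j) E := by
    rw [Measure.finsetSum_apply]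
    exact Finset.single_le_sum (f := fun j => ρ j E) (fun _ _ => zero_le) hi
  have h4 : (c n : ℝ) * (ρ i).real E ≤ lam.real E := by
    have := ENNReal.toReal_mono (measure_ne_top lam E)
      ((mul_le_mul_right h3 (c n : ℝ≥0∞)).trans (hle n E hE))
    rwa [ENNReal.toReal_mul] at this
  exact lt_of_mul_lt_mul_left (h4.trans_lt hlt) (by positivity)

theorem UnifAC.absolutelyContinuous {lam : Measure S} [IsFiniteMeasure lam] {ρ : T → Measure S}
    [∀ x, IsFiniteMeasure (ρ x)] {K : Set T} (h : UnifAC lam ρ K) {x : T} (hx : x ∈ K) :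
    ρ x ≪ lam := by
  refine Measure.AbsolutelyContinuous.mk fun E hE h0 => ?_
  have h1 : (ρ x).real E ≤ 0 := le_of_forall_pos_lt_add fun ε hε => by
    obtain ⟨δ, hδ, H⟩ := h ε hε
    rw [zero_add]
    exact H E hE (by rw [measureReal_def, h0]; simpa using hδ) x hx
  exact (measureReal_eq_zero_iff).1 (le_antisymm h1 measureReal_nonneg)

/-- Integrals of bounded Borel functions against a setwise continuous family of measures are
continuous. -/
theorem continuous_integral_of_setwise {ρ : T → Measure S} [∀ x, IsFiniteMeasure (ρ x)] {C : ℝ}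
    (hC : ∀ x, (ρ x).real univ ≤ C)
    (hρ : ∀ E, MeasurableSet E → Continuous fun x => (ρ x).real E) {f : S → ℂ}
    (hf : Measurable f) (hb : ∃ D, ∀ s, ‖f s‖ ≤ D) : Continuous fun x => ∫ s, f s ∂ρ x := by
  have hint : ∀ (g : S → ℂ), Measurable g → (∃ D, ∀ s, ‖g s‖ ≤ D) → ∀ x, Integrable g (ρ x) :=
    fun g hg ⟨D, hD⟩ x => Integrable.of_bound hg.aestronglyMeasurable D (Eventually.of_forall hD)
  refine bounded_measurable_induction (P := fun g => Continuous fun x => ∫ s, g s ∂ρ x)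
    ?_ ?_ ?_ hf hb
  · intro c E hE
    have : ∀ x, ∫ s, E.indicator (fun _ => c) s ∂ρ x = (ρ x).real E • c := fun x => by
      rw [integral_indicator hE, integral_const, measureReal_restrict_apply_univ]
    simp_rw [this]
    exact (hρ E hE).smul continuous_const
  · intro g h hg hh hgb hhb h1 h2
    have : ∀ x, ∫ s, (g + h) s ∂ρ x = ∫ s, g s ∂ρ x + ∫ s, h s ∂ρ x := fun x =>
      integral_add (hint g hg hgb x) (hint h hh hhb x)
    simp_rw [this]
    exact h1.add h2
  · intro g hg hgb h
    refine continuous_of_uniform_approx_of_continuous fun u hu => ?_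
    obtain ⟨ε, hε, hεu⟩ := Metric.mem_uniformity_dist.1 hu
    have hC0 : 0 < |C| + 1 := by positivity
    obtain ⟨g', hg', hgb', hP, hle⟩ := h (ε / (2 * (|C| + 1))) (by positivity)
    refine ⟨_, hP, fun x => hεu ?_⟩
    rw [dist_eq_norm, ← integral_sub (hint g hg hgb x) (hint g' hg' hgb' x)]
    refine lt_of_le_of_lt (norm_integral_le_of_norm_le_const (Eventually.of_forall hle)) ?_
    calc ε / (2 * (|C| + 1)) * (ρ x).real univ ≤ ε / (2 * (|C| + 1)) * (|C| + 1) := by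
          gcongr
          exact (hC x).trans ((le_abs_self C).trans (by linarith))
      _ = ε / 2 := by field_simp
      _ < ε := by linarith

/-- A family of measures that is uniformly absolutely continuous and continuous when tested against
continuous functions is setwise continuous. -/
theorem UnifAC.continuousOn_measureReal [LocallyCompactSpace S] {lam : Measure S}
    [IsFiniteMeasure lam] [lam.InnerRegular] {ρ : T → Measure S} [∀ x, IsFiniteMeasure (ρ x)]
    {K : Set T} (h : UnifAC lam ρ K)
    (hcont : ∀ f : S → ℝ, Continuous f → (∀ s, f s ∈ Icc (0 : ℝ) 1) →
      ContinuousOn (fun x => ∫ s, f s ∂ρ x) K)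
    {E : Set S} (hE : MeasurableSet E) : ContinuousOn (fun x => (ρ x).real E) K := by
  refine continuousOn_of_uniform_approx_of_continuousOn fun u hu => ?_
  obtain ⟨ε, hε, hεu⟩ := Metric.mem_uniformity_dist.1 hu
  obtain ⟨δ, hδ, H⟩ := h ε hε
  -- Sandwich `E` between a compact and an open set that differ by a set of small `lam`-measure; the
  -- indicator of `E` is then approximated, uniformly over `K`, by an Urysohn function `f`.
  obtain ⟨F, hFE, hF, hlt⟩ := hE.exists_isCompact_sdiff_lt (μ := lam) (measure_ne_top _ E)
    (ε := ENNReal.ofReal (δ / 2)) (by simpa using hδ)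
  obtain ⟨U, hEU, hU, -, hlt'⟩ := hE.exists_isOpen_sdiff_lt (μ := lam) (measure_ne_top _ E)
    (ε := ENNReal.ofReal (δ / 2)) (by simpa using hδ)
  obtain ⟨f, hf1, hf0, -, hf⟩ := exists_continuous_one_zero_of_isCompact hF
    hU.isClosed_compl (disjoint_compl_right_iff_subset.2 (hFE.trans hEU))
  have hUF : MeasurableSet (U \ F) := hU.measurableSet.diff hF.measurableSet
  have hlam : lam.real (U \ F) < δ := by
    have h1 : U \ F ⊆ (E \ F) ∪ (U \ E) := fun s hs => by
      by_cases hsE : s ∈ E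
      · exact Or.inl ⟨hsE, hs.2⟩
      · exact Or.inr ⟨hs.1, hsE⟩
    have h2 : lam.real (E \ F) < δ / 2 := by
      rw [measureReal_def]
      exact (ENNReal.lt_ofReal_iff_toReal_lt (measure_ne_top _ _)).1 hlt
    have h3 : lam.real (U \ E) < δ / 2 := by
      rw [measureReal_def]
      exact (ENNReal.lt_ofReal_iff_toReal_lt (measure_ne_top _ _)).1 hlt'
    have := (measureReal_mono (μ := lam) h1).trans (measureReal_union_le _ _)
    linarith
  refine ⟨_, hcont f f.continuous hf, fun x hx => hεu ?_⟩
  have hfi : Integrable f (ρ x) := Integrable.of_bound f.continuous.aestronglyMeasurable 1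
    (Eventually.of_forall fun s => abs_le.2 ⟨by linarith [(hf s).1], (hf s).2⟩)
  have hEi : Integrable (E.indicator fun _ => (1 : ℝ)) (ρ x) := (integrable_const _).indicator hE
  have h1 : (ρ x).real E = ∫ s, E.indicator (fun _ => (1 : ℝ)) s ∂ρ x := by
    rw [integral_indicator hE, integral_const, measureReal_restrict_apply_univ, smul_eq_mul,
      mul_one]
  rw [dist_eq_norm, h1, ← integral_sub hEi hfi]
  refine lt_of_le_of_lt (norm_integral_le_integral_norm _) ?_
  have hle : ∀ s, ‖E.indicator (fun _ => (1 : ℝ)) s - f s‖ ≤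
      (U \ F).indicator (fun _ => (1 : ℝ)) s := by
    intro s
    have hfs := hf s
    by_cases hsF : s ∈ F
    · simp [hFE hsF, hsF, hf1 hsF]
    · by_cases hsU : s ∈ U
      · rw [indicator_of_mem (show s ∈ U \ F from ⟨hsU, hsF⟩)]
        by_cases hsE : s ∈ E
        · rw [indicator_of_mem hsE, Real.norm_eq_abs]
          exact abs_le.2 ⟨by linarith [hfs.2], by linarith [hfs.1]⟩
        · rw [indicator_of_notMem hsE, Real.norm_eq_abs]
          exact abs_le.2 ⟨by linarith [hfs.2], by linarith [hfs.1]⟩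
      · have hsE : s ∉ E := fun h => hsU (hEU h)
        simp [hsE, hsU, hf0 (show s ∈ Uᶜ from hsU)]
  refine lt_of_le_of_lt (integral_mono (hEi.sub hfi).norm
    ((integrable_const (1 : ℝ)).indicator hUF) hle) ?_
  rw [integral_indicator hUF, integral_const, measureReal_restrict_apply_univ, smul_eq_mul,
    mul_one]
  exact H _ hUF hlam x hx

end Families

/-! ### Weak sequential compactness of bounded functions -/

section WeakSequences

/-- Bounded sequences in a Hilbert space have weakly convergent subsequences. The weak sequential
compactness of balls is applied in the closed span of the sequence, which is separable. -/
theorem exists_subseq_tendsto_inner {H : Type*} [NormedAddCommGroup H] [InnerProductSpace ℂ H]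
    [CompleteSpace H] (v : ℕ → H) {C : ℝ} (hv : ∀ n, ‖v n‖ ≤ C) :
    ∃ φ : ℕ → ℕ, StrictMono φ ∧ ∀ w, ∃ l, Tendsto (fun n => inner ℂ (v (φ n)) w) atTop (𝓝 l) := by
  set V : Submodule ℂ H := (Submodule.span ℂ (range v)).topologicalClosure with hV
  have hsep : TopologicalSpace.SeparableSpace V := by
    refine TopologicalSpace.IsSeparable.separableSpace ?_
    rw [hV, Submodule.topologicalClosure_coe]
    exact ((countable_range v).isSeparable.span (R := ℂ)).closure
  have hVc : IsClosed (V : Set H) := Submodule.isClosed_topologicalClosure _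
  have : CompleteSpace V := hVc.completeSpace_coe
  have hmem : ∀ n, v n ∈ V := fun n =>
    Submodule.le_topologicalClosure _ (Submodule.subset_span (mem_range_self n))
  let v' : ℕ → V := fun n => ⟨v n, hmem n⟩
  let x : ℕ → WeakDual ℂ V := fun n => StrongDual.toWeakDual (innerSL ℂ (v' n))
  obtain ⟨a, -, φ, hφ, ha⟩ := WeakDual.isSeqCompact_closedBall ℂ V 0 C (x := x) (fun n => by
    simp only [mem_preimage, mem_closedBall_zero_iff]
    change ‖innerSL ℂ (v' n)‖ ≤ C
    rw [innerSL_apply_norm]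
    exact hv n)
  refine ⟨φ, hφ, fun w => ⟨a (V.orthogonalProjectionOnto w), ?_⟩⟩
  have h1 := ((WeakDual.eval_continuous (V.orthogonalProjectionOnto w)).tendsto a).comp ha
  refine h1.congr fun n => ?_
  change inner ℂ (v' (φ n)) (V.orthogonalProjectionOnto w) = inner ℂ (v (φ n)) w
  rw [Submodule.inner_orthogonalProjectionOnto_eq_of_mem_left]

/-- A sequence of functions bounded by `1` has a subsequence whose integrals against every
integrable function converge. -/
theorem exists_subseq_tendsto_integral {Y : Type*} [MeasurableSpace Y] (lam : Measure Y)
    [IsFiniteMeasure lam] (f : ℕ → Y → ℂ) (hf : ∀ n, Measurable (f n)) (hb : ∀ n y, ‖f n y‖ ≤ 1) :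
    ∃ φ : ℕ → ℕ, StrictMono φ ∧ ∀ h : Y → ℂ, Integrable h lam →
      ∃ l, Tendsto (fun n => ∫ y, f (φ n) y * h y ∂lam) atTop (𝓝 l) := by
  have hm : ∀ n, MemLp (fun y => (starRingEnd ℂ) (f n y)) 2 lam := fun n =>
    MemLp.of_bound (Complex.continuous_conj.measurable.comp (hf n)).aestronglyMeasurable 1
      (Eventually.of_forall fun y => by rw [RCLike.norm_conj]; exact hb n y)
  obtain ⟨φ, hφ, H⟩ := exists_subseq_tendsto_inner (fun n => (hm n).toLp _)
    (C := (eLpNorm (fun _ : Y => (1 : ℝ)) 2 lam).toReal) (fun n => by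
      rw [Lp.norm_toLp]
      refine ENNReal.toReal_mono (memLp_const (1 : ℝ)).eLpNorm_ne_top ?_
      refine eLpNorm_mono fun y => ?_
      rw [RCLike.norm_conj, norm_one]
      exact hb n y)
  have hint : ∀ n {h : Y → ℂ}, Integrable h lam → Integrable (fun y => f n y * h y) lam :=
    fun n h hh => hh.bdd_mul (c := 1) (hf n).aestronglyMeasurable (Eventually.of_forall (hb n))
  refine ⟨φ, hφ, fun h hh => Integrable.induction (μ := lam)
    (fun h => ∃ l, Tendsto (fun n => ∫ y, f (φ n) y * h y ∂lam) atTop (𝓝 l)) ?_ ?_ ?_ ?_ hh⟩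
  · intro c E hE _
    have hE2 : MemLp (E.indicator fun _ => c) 2 lam := (memLp_const c).indicator hE
    obtain ⟨l, hl⟩ := H (hE2.toLp _)
    refine ⟨l, hl.congr fun n => ?_⟩
    rw [L2.inner_def]
    refine integral_congr_ae ?_
    filter_upwards [(hm (φ n)).coeFn_toLp, hE2.coeFn_toLp] with y h1 h2
    rw [h1, h2]
    simp [mul_comm]
  · rintro g h - hg hh ⟨l, hl⟩ ⟨l', hl'⟩
    refine ⟨l + l', (hl.add hl').congr fun n => ?_⟩
    rw [← integral_add (hint _ hg) (hint _ hh)]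
    simp [mul_add]
  · refine isClosed_of_closure_subset fun g hg => ?_
    refine cauchySeq_tendsto_of_complete ?_
    rw [Metric.cauchySeq_iff']
    intro ε hε
    obtain ⟨g', ⟨l, hl⟩, hgg'⟩ := Metric.mem_closure_iff.1 hg (ε / 3) (by positivity)
    obtain ⟨N, hN⟩ := Metric.cauchySeq_iff'.1 hl.cauchySeq (ε / 3) (by positivity)
    have hd : ∀ n, dist (∫ y, f n y * g y ∂lam) (∫ y, f n y * g' y ∂lam) ≤ dist g g' := by
      intro n
      rw [dist_eq_norm, ← integral_sub (hint n (L1.integrable_coeFn g))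
        (hint n (L1.integrable_coeFn g')), dist_eq_norm, L1.norm_eq_integral_norm]
      refine (norm_integral_le_integral_norm _).trans ?_
      refine integral_mono_ae ?_ (L1.integrable_coeFn _).norm ?_
      · exact ((hint n (L1.integrable_coeFn g)).sub (hint n (L1.integrable_coeFn g'))).norm
      · filter_upwards [Lp.coeFn_sub g g'] with y hy
        rw [hy, Pi.sub_apply, ← mul_sub, norm_mul]
        exact mul_le_of_le_one_left (norm_nonneg _) (hb n y)
    refine ⟨N, fun n hn => ?_⟩
    have h1 := hd (φ n)
    have h2 := hd (φ N)
    have h3 := hN n hn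
    have h4 := dist_triangle4 (∫ y, f (φ n) y * g y ∂lam) (∫ y, f (φ n) y * g' y ∂lam)
      (∫ y, f (φ N) y * g' y ∂lam) (∫ y, f (φ N) y * g y ∂lam)
    rw [dist_comm (∫ y, f (φ N) y * g' y ∂lam)] at h4
    linarith
  · rintro g h hgh hg ⟨l, hl⟩
    refine ⟨l, hl.congr fun n => integral_congr_ae ?_⟩
    filter_upwards [hgh] with y hy
    rw [hy]

end WeakSequences

/-! ### Measures with setwise continuous translates -/

section LeftTranslation

open RadonMeasure

variable {S : Type*} [TopologicalSpace S] [T2Space S] [MeasurableSpace S] [BorelSpace S]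
  [Monoid S] [ContinuousMul S]

/-- The translates `δ_x * ν` depend setwise continuously on `x`. -/
def LeftSetwise (ν : Measure S) : Prop :=
  ∀ E, MeasurableSet E → Continuous fun x : S => (ν.map (ContinuousMap.mulLeft x)).real E

theorem map_mulLeft_apply (ν : Measure S) (x : S) {E : Set S} (hE : MeasurableSet E) :
    ν.map (ContinuousMap.mulLeft x) E = ν ((fun y => x * y) ⁻¹' E) :=
  Measure.map_apply (ContinuousMap.mulLeft x).continuous.measurable hE

theorem integral_map_mulLeft (ν : Measure S) (x : S) {X : Type*} [NormedAddCommGroup X]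
    [NormedSpace ℝ X] {f : S → X}
    (hf : AEStronglyMeasurable f (ν.map (ContinuousMap.mulLeft x))) :
    ∫ s, f s ∂ν.map (ContinuousMap.mulLeft x) = ∫ y, f (x * y) ∂ν :=
  integral_map (ContinuousMap.mulLeft x).continuous.measurable.aemeasurable hf

theorem map_mulLeft_univ (ν : Measure S) (x : S) :
    (ν.map (ContinuousMap.mulLeft x)).real univ = ν.real univ := by
  rw [measureReal_def, map_mulLeft_apply ν x MeasurableSet.univ]
  rfl

namespace LeftSetwise

variable {ν : Measure S} [IsFiniteMeasure ν] [ν.InnerRegular]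

/-- Setwise continuity of the translates passes to all measures `σ ≪ ν`: locally, the translates of
`ν`, and hence those of `σ`, are uniformly absolutely continuous with respect to one measure, while
the translates of any measure are continuous against continuous functions. -/
theorem of_ac [LocallyCompactSpace S] (h : LeftSetwise ν) {σ : Measure S} [IsFiniteMeasure σ]
    (hσ : σ ≪ ν) : LeftSetwise σ := by
  have hσR : σ.InnerRegular := innerRegular_of_absolutelyContinuous hσ
  intro E hE
  rw [continuous_iff_continuousAt]
  intro x₀
  obtain ⟨K, hK, hKx⟩ := exists_compact_mem_nhds x₀
  obtain ⟨lam, _, _, hlam⟩ := exists_unifAC h hK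
  have hU : UnifAC lam (fun x : S => σ.map (ContinuousMap.mulLeft x)) K := by
    intro ε hε
    obtain ⟨δ, hδ, H⟩ := exists_delta_of_absolutelyContinuous hσ
      (ε := ENNReal.ofReal ε) (by simpa using hε)
    obtain ⟨δ', hδ', hδδ'⟩ : ∃ δ' : ℝ, 0 < δ' ∧ ENNReal.ofReal δ' ≤ δ := by
      obtain ⟨r, hr0, hr⟩ := ENNReal.lt_iff_exists_nnreal_btwn.1 hδ
      exact ⟨r, by exact_mod_cast hr0, by simpa using hr.le⟩
    obtain ⟨η, hη, Hη⟩ := hlam δ' hδ'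
    refine ⟨η, hη, fun F hF hlt x hx => ?_⟩
    have h1 := Hη F hF hlt x hx
    rw [measureReal_def, map_mulLeft_apply _ _ hF] at h1 ⊢
    have h2 := H _ ((ContinuousMap.mulLeft x).continuous.measurable hF)
      (((ENNReal.lt_ofReal_iff_toReal_lt (measure_ne_top _ _)).2 h1).trans_le hδδ')
    exact (ENNReal.lt_ofReal_iff_toReal_lt (measure_ne_top _ _)).1 h2
  refine (hU.continuousOn_measureReal (fun f hf hf01 => ?_) hE).continuousAt hKx
  have hb : ∀ s, ‖f s‖ ≤ 1 := fun s => abs_le.2 ⟨by linarith [(hf01 s).1], (hf01 s).2⟩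
  refine (Continuous.congr (continuous_integral_of_bounded σ (k := fun x y : S => f (x * y))
    (hf.comp continuous_mul) fun x y => hb _) fun x => ?_).continuousOn
  exact (integral_map_mulLeft σ x hf.aestronglyMeasurable).symm

theorem continuous_integral (h : LeftSetwise ν) {f : S → ℂ} (hf : Measurable f)
    (hb : ∃ D, ∀ s, ‖f s‖ ≤ D) : Continuous fun x => ∫ y, f (x * y) ∂ν := by
  refine (continuous_integral_of_setwise (ρ := fun x : S => ν.map (ContinuousMap.mulLeft x))
    (fun x => (map_mulLeft_univ ν x).le) h hf hb).congr fun x => ?_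
  exact integral_map_mulLeft ν x hf.aestronglyMeasurable

/-- Almost all translates of `ν` are absolutely continuous with respect to one measure. -/
theorem exists_ae_ac (h : LeftSetwise ν) (e : Measure S) [IsFiniteMeasure e] [e.InnerRegular] :
    ∃ lam : Measure S, IsFiniteMeasure lam ∧ lam.InnerRegular ∧
      ∀ᵐ x ∂e, ν.map (ContinuousMap.mulLeft x) ≪ lam := by
  obtain ⟨K, hK, hae⟩ := exists_ae_mem_iUnion_isCompact e
  choose lam h1 h2 hlam using fun n => exists_unifAC h (hK n)
  obtain ⟨ρ, h3, h4, hρ⟩ := exists_radon_dominating_ac lam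
  refine ⟨ρ, h3, h4, ?_⟩
  filter_upwards [hae] with x hx
  obtain ⟨n, hn⟩ := mem_iUnion.1 hx
  exact ((hlam n).absolutelyContinuous hn).trans (hρ n)

theorem measurable_map (h : LeftSetwise ν) :
    Measurable fun x : S => ν.map (ContinuousMap.mulLeft x) := by
  refine Measure.measurable_of_measurable_coe _ fun E hE => ?_
  have : (fun x : S => ν.map (ContinuousMap.mulLeft x) E) =
      fun x : S => ENNReal.ofReal ((ν.map (ContinuousMap.mulLeft x)).real E) := by
    ext x
    rw [ofReal_measureReal]
  rw [this]
  exact ENNReal.measurable_ofReal.comp (h E hE).measurable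

end LeftSetwise

/-- The convolution `e * ν` of two positive measures, when `x ↦ δ_x * ν` is measurable. -/
noncomputable def mconv (e ν : Measure S) : Measure S :=
  e.bind fun x => ν.map (ContinuousMap.mulLeft x)

section mconv

variable {e ν : Measure S} [IsFiniteMeasure e] [e.InnerRegular] [IsFiniteMeasure ν]
  [ν.InnerRegular]

theorem mconv_apply (h : LeftSetwise ν) {E : Set S} (hE : MeasurableSet E) :
    mconv e ν E = ∫⁻ x, ν.map (ContinuousMap.mulLeft x) E ∂e :=
  Measure.bind_apply hE h.measurable_map.aemeasurable

theorem isFiniteMeasure_mconv (h : LeftSetwise ν) : IsFiniteMeasure (mconv e ν) := by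
  refine ⟨?_⟩
  rw [mconv_apply h MeasurableSet.univ]
  have : ∀ x : S, ν.map (ContinuousMap.mulLeft x) univ = ν univ := fun x =>
    map_mulLeft_apply ν x MeasurableSet.univ
  simp_rw [this, lintegral_const]
  exact ENNReal.mul_lt_top (measure_lt_top _ _) (measure_lt_top _ _)

theorem mconv_ac (h : LeftSetwise ν) {lam : Measure S}
    (hlam : ∀ᵐ x ∂e, ν.map (ContinuousMap.mulLeft x) ≪ lam) : mconv e ν ≪ lam := by
  refine Measure.AbsolutelyContinuous.mk fun E hE h0 => ?_
  rw [mconv_apply h hE]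
  refine (lintegral_eq_zero_iff ((Measure.measurable_coe hE).comp h.measurable_map)).2 ?_
  filter_upwards [hlam] with x hx
  exact hx h0

theorem innerRegular_mconv (h : LeftSetwise ν) : (mconv e ν).InnerRegular := by
  obtain ⟨lam, _, _, hlam⟩ := h.exists_ae_ac e
  have := isFiniteMeasure_mconv (e := e) h
  exact innerRegular_of_absolutelyContinuous (mconv_ac h hlam)

theorem mconv_real_apply (h : LeftSetwise ν) {E : Set S} (hE : MeasurableSet E) :
    (mconv e ν).real E = ∫ x, (ν.map (ContinuousMap.mulLeft x)).real E ∂e := by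
  rw [measureReal_def, mconv_apply h hE, integral_eq_lintegral_of_nonneg_ae
    (Eventually.of_forall fun x => measureReal_nonneg)
    (aestronglyMeasurable_of_continuous (h E hE) e)]
  exact congrArg ENNReal.toReal
    (lintegral_congr fun x => (ofReal_measureReal (measure_ne_top _ _)).symm)

theorem norm_integral_translate_le {f : S → ℂ} {D : ℝ} (hD : ∀ s, ‖f s‖ ≤ D) (x : S) :
    ‖∫ y, f (x * y) ∂ν‖ ≤ D * ν.real univ :=
  norm_integral_le_of_norm_le_const (Eventually.of_forall fun _ => hD _)

theorem radonBounded_integral_translate (h : LeftSetwise ν) {f : S → ℂ} (hf : Measurable f)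
    (hb : ∃ D, ∀ s, ‖f s‖ ≤ D) : RadonBounded fun x => ∫ y, f (x * y) ∂ν := by
  obtain ⟨D, hD⟩ := hb
  exact RadonBounded.of_continuous (h.continuous_integral hf ⟨D, hD⟩)
    (norm_integral_translate_le hD)

theorem integral_mconv (h : LeftSetwise ν) {f : S → ℂ} (hf : Measurable f)
    (hb : ∃ D, ∀ s, ‖f s‖ ≤ D) :
    ∫ s, f s ∂mconv e ν = ∫ x, ∫ y, f (x * y) ∂ν ∂e := by
  have hfin := isFiniteMeasure_mconv (e := e) h
  have hR := innerRegular_mconv (e := e) h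
  have hI : ∀ {g : S → ℂ}, Measurable g → (∃ D, ∀ s, ‖g s‖ ≤ D) →
      Integrable (fun x => ∫ y, g (x * y) ∂ν) e := fun hg hgb =>
    (radonBounded_integral_translate h hg hgb).integrable e
  have hI' : ∀ {g : S → ℂ}, Measurable g → (∃ D, ∀ s, ‖g s‖ ≤ D) →
      ∀ x, Integrable (fun y => g (x * y)) ν := fun hg ⟨D, hD⟩ x =>
    Integrable.of_bound (hg.comp (continuous_const_mul x).measurable).aestronglyMeasurable D
      (Eventually.of_forall fun _ => hD _)
  refine bounded_measurable_induction
    (P := fun f => ∫ s, f s ∂mconv e ν = ∫ x, ∫ y, f (x * y) ∂ν ∂e) ?_ ?_ ?_ hf hb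
  · intro c E hE
    have h1 : ∀ x, ∫ y, E.indicator (fun _ => c) (x * y) ∂ν =
        (ν.map (ContinuousMap.mulLeft x)).real E • c := fun x => by
      rw [← integral_map_mulLeft ν x (measurable_const.indicator hE).aestronglyMeasurable,
        integral_indicator hE, integral_const, measureReal_restrict_apply_univ]
    simp_rw [h1]
    rw [integral_indicator hE, integral_const, measureReal_restrict_apply_univ,
      mconv_real_apply h hE, integral_smul_const]
  · intro f g hf hg hfb hgb h1 h2
    have h3 : ∫ s, (f + g) s ∂mconv e ν = ∫ s, f s ∂mconv e ν + ∫ s, g s ∂mconv e ν :=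
      integral_add ((RadonBounded.of_measurable hf hfb.choose_spec).integrable _)
        ((RadonBounded.of_measurable hg hgb.choose_spec).integrable _)
    have h4 : ∀ x, ∫ y, (f + g) (x * y) ∂ν = ∫ y, f (x * y) ∂ν + ∫ y, g (x * y) ∂ν := fun x =>
      integral_add (hI' hf hfb x) (hI' hg hgb x)
    rw [h3, h1, h2]
    simp_rw [h4]
    rw [integral_add (hI hf hfb) (hI hg hgb)]
  · intro f hf hfb H
    rw [← sub_eq_zero, ← norm_le_zero_iff]
    refine le_of_forall_pos_le_add fun ε hε => ?_
    rw [zero_add]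
    set M := (mconv e ν).real univ + ν.real univ * e.real univ with hM
    have hM0 : 0 ≤ M := by positivity
    obtain ⟨g, hg, hgb, hP, hle⟩ := H (ε / (M + 1)) (by positivity)
    have h1 : ‖∫ s, f s ∂mconv e ν - ∫ s, g s ∂mconv e ν‖ ≤
        ε / (M + 1) * (mconv e ν).real univ := by
      rw [← integral_sub ((RadonBounded.of_measurable hf hfb.choose_spec).integrable _)
        ((RadonBounded.of_measurable hg hgb.choose_spec).integrable _)]
      exact norm_integral_le_of_norm_le_const (Eventually.of_forall hle)
    have h2 : ‖∫ x, ∫ y, g (x * y) ∂ν ∂e - ∫ x, ∫ y, f (x * y) ∂ν ∂e‖ ≤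
        ε / (M + 1) * ν.real univ * e.real univ := by
      rw [← integral_sub (hI hg hgb) (hI hf hfb)]
      refine norm_integral_le_of_norm_le_const (Eventually.of_forall fun x => ?_)
      rw [← integral_sub (hI' hg hgb x) (hI' hf hfb x)]
      refine norm_integral_le_of_norm_le_const (Eventually.of_forall fun y => ?_)
      rw [norm_sub_rev]
      exact hle _
    calc _ = ‖(∫ s, f s ∂mconv e ν - ∫ s, g s ∂mconv e ν) +
          (∫ x, ∫ y, g (x * y) ∂ν ∂e - ∫ x, ∫ y, f (x * y) ∂ν ∂e)‖ := by rw [hP]; ring_nf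
      _ ≤ ε / (M + 1) * M := by
          refine (norm_add_le _ _).trans ((add_le_add h1 h2).trans (le_of_eq ?_))
          rw [hM]; ring
      _ ≤ ε := by
          rw [div_mul_eq_mul_div, div_le_iff₀ (by positivity)]
          nlinarith

end mconv

end LeftTranslation

/-! ### Norm continuity of the translates of a convolution -/

section DunfordPettis

open RadonMeasure

variable {S : Type*} [TopologicalSpace S] [T2Space S] [MeasurableSpace S] [BorelSpace S]

theorem norm_integral_le_add_measureReal (ρ : Measure S) [IsFiniteMeasure ρ] [ρ.InnerRegular]
    {ψ : S → ℂ} (hψ : Continuous ψ) {C η : ℝ} (hη : 0 ≤ η) (hC : ∀ s, ‖ψ s‖ ≤ C) :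
    ‖∫ s, ψ s ∂ρ‖ ≤ η * ρ.real univ + C * ρ.real {s | η ≤ ‖ψ s‖} := by
  have hB : MeasurableSet {s | η ≤ ‖ψ s‖} := (isClosed_le continuous_const hψ.norm).measurableSet
  have hi := (RadonBounded.of_continuous hψ hC).integrable ρ
  have hCi : Integrable ({s | η ≤ ‖ψ s‖}.indicator fun _ => C) ρ :=
    (integrable_const _).indicator hB
  refine (norm_integral_le_integral_norm _).trans
    ((integral_mono hi.norm ((integrable_const η).add hCi) fun s => ?_).trans (le_of_eq ?_))
  · simp only [Pi.add_apply]
    by_cases h : η ≤ ‖ψ s‖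
    · rw [indicator_of_mem (show s ∈ {s | η ≤ ‖ψ s‖} from h)]
      linarith [hC s]
    · rw [indicator_of_notMem (show s ∉ {s | η ≤ ‖ψ s‖} from h)]
      linarith
  · simp only [Pi.add_apply]
    rw [integral_add (integrable_const η) hCi, integral_indicator hB, integral_const,
      integral_const, measureReal_restrict_apply_univ, smul_eq_mul, smul_eq_mul, mul_comm,
      mul_comm C]

/-- An almost everywhere convergent sequence is Cauchy in measure. -/
theorem exists_pair_lt_measureReal {lam : Measure S} [IsFiniteMeasure lam] {ψ : ℕ → S → ℂ}
    (hψ : ∀ n, AEStronglyMeasurable (ψ n) lam)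
    (hlim : ∀ᵐ x ∂lam, ∃ l, Tendsto (fun n => ψ n x) atTop (𝓝 l)) {η δ : ℝ} (hη : 0 < η)
    (hδ : 0 < δ) : ∃ m n, m < n ∧ lam.real {x | η ≤ ‖ψ n x - ψ m x‖} < δ := by
  have hlim' : ∀ᵐ x ∂lam, Tendsto (fun n => ψ n x) atTop (𝓝 (limUnder atTop fun n => ψ n x)) := by
    filter_upwards [hlim] with x hx using tendsto_nhds_limUnder hx
  have h1 := tendstoInMeasure_of_tendsto_ae hψ hlim'
  rw [tendstoInMeasure_iff_norm] at h1
  have h2 := (h1 (η / 2) (by positivity)).eventually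
    (gt_mem_nhds (show (0 : ℝ≥0∞) < ENNReal.ofReal (δ / 2) by simpa using hδ))
  obtain ⟨N, hN⟩ := eventually_atTop.1 h2
  refine ⟨N, N + 1, Nat.lt_succ_self N, ?_⟩
  have hN1 := hN N le_rfl
  have hN2 := hN (N + 1) (Nat.le_succ N)
  set g := fun x => limUnder atTop fun n => ψ n x with hg
  have hsub : {x | η ≤ ‖ψ (N + 1) x - ψ N x‖} ⊆
      {x | η / 2 ≤ ‖ψ (N + 1) x - g x‖} ∪ {x | η / 2 ≤ ‖ψ N x - g x‖} := by
    intro x hx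
    by_contra hcon
    simp only [mem_union, mem_ofPred_eq, not_or, not_le] at hcon hx
    have h3 := norm_sub_le_norm_sub_add_norm_sub (ψ (N + 1) x) (g x) (ψ N x)
    rw [norm_sub_rev (g x)] at h3
    linarith [hcon.1, hcon.2]
  rw [measureReal_def]
  refine (ENNReal.lt_ofReal_iff_toReal_lt (measure_ne_top _ _)).1 ?_
  refine (measure_mono hsub).trans_lt ((measure_union_le _ _).trans_lt ?_)
  refine (ENNReal.add_lt_add hN2 hN1).trans_eq ?_
  rw [← ENNReal.ofReal_add (by positivity) (by positivity), add_halves]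

variable [Monoid S] [ContinuousMul S]

/-- The convolution `μ * ν` of two positive finite Radon measures, as an element of `M(S)`. -/
noncomputable def rconv (μ ν : Measure S) [IsFiniteMeasure μ] [μ.InnerRegular]
    [IsFiniteMeasure ν] [ν.InnerRegular] (h : LeftSetwise ν) : RadonMeasure S :=
  haveI := isFiniteMeasure_mconv (e := μ) h
  haveI := innerRegular_mconv (e := μ) h
  ofMeasure (mconv μ ν)

variable {μ ν : Measure S} [IsFiniteMeasure μ] [μ.InnerRegular] [IsFiniteMeasure ν]
  [ν.InnerRegular]

theorem pair_rconv (h : LeftSetwise ν) {f : S → ℂ} (hf : Measurable f)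
    (hb : ∃ D, ∀ s, ‖f s‖ ≤ D) : pair (rconv μ ν h) f = ∫ x, ∫ y, f (x * y) ∂ν ∂μ := by
  have := isFiniteMeasure_mconv (e := μ) h
  have := innerRegular_mconv (e := μ) h
  rw [← integral_mconv h hf hb]
  exact pair_ofMeasure _ (RadonBounded.of_measurable hf hb.choose_spec)

theorem pair_push_rconv (h : LeftSetwise ν) (s : S) {f : S → ℂ} (hf : Measurable f)
    (hb : ∃ D, ∀ s, ‖f s‖ ≤ D) :
    pair (push (ContinuousMap.mulLeft s) (rconv μ ν h)) f =
      ∫ x, (∫ y, f (x * y) ∂ν) ∂μ.map (ContinuousMap.mulLeft s) := by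
  rw [pair_push _ _ (RadonBounded.of_measurable hf hb.choose_spec),
    integral_map_mulLeft _ _ ((radonBounded_integral_translate h hf hb).meas _),
    pair_rconv h (f := fun y => f (ContinuousMap.mulLeft s y))
    (hf.comp (ContinuousMap.mulLeft s).continuous.measurable) (hb.imp fun D hD y => hD _)]
  simp [mul_assoc]

theorem dist_push_le_of_pair (κ : RadonMeasure S) (s t : S) :
    ∃ f : S → ℂ, Measurable f ∧ (∀ x, ‖f x‖ ≤ 1) ∧
      dist (push (ContinuousMap.mulLeft s) κ) (push (ContinuousMap.mulLeft t) κ) =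
        ‖pair (push (ContinuousMap.mulLeft s) κ) f - pair (push (ContinuousMap.mulLeft t) κ) f‖ := by
  obtain ⟨f, hf, hb, h⟩ := exists_norm_eq_pair
    (push (ContinuousMap.mulLeft s) κ - push (ContinuousMap.mulLeft t) κ)
  refine ⟨f, hf, hb, ?_⟩
  have hR := RadonBounded.of_measurable hf hb
  rw [dist_eq_norm, ← pairL_apply hR, ← pairL_apply hR, ← map_sub, pairL_apply, ← h,
    Complex.norm_real, norm_norm]

/-- The Dunford–Pettis argument: if the translates of `μ` and of `ν` depend setwise continuously on
the translation, then those of `μ * ν` depend on it continuously in norm. -/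
theorem continuous_push_rconv [LocallyCompactSpace S] (hμ : LeftSetwise μ) (hν : LeftSetwise ν) :
    Continuous fun s : S => push (ContinuousMap.mulLeft s) (rconv μ ν hν) := by
  set φ : (S → ℂ) → S → ℂ := fun f x => ∫ y, f (x * y) ∂ν with hφ
  set J : S → (S → ℂ) → ℂ := fun s f => ∫ x, φ f x ∂μ.map (ContinuousMap.mulLeft s) with hJ
  have hφc : ∀ f : S → ℂ, Measurable f → (∀ x, ‖f x‖ ≤ 1) → Continuous (φ f) := fun f hf hb =>
    hν.continuous_integral hf ⟨1, hb⟩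
  have hφb : ∀ f : S → ℂ, (∀ x, ‖f x‖ ≤ 1) → ∀ x, ‖φ f x‖ ≤ ν.real univ := fun f hb x => by
    simpa using norm_integral_translate_le (ν := ν) hb x
  rw [continuous_iff_continuousAt]
  intro s₀
  by_contra hcon
  rw [Metric.continuousAt_iff'] at hcon
  push Not at hcon
  obtain ⟨ε, hε, hfreq⟩ := hcon
  obtain ⟨K, hK, hKs⟩ := exists_compact_mem_nhds s₀
  have hs₀ : s₀ ∈ K := mem_of_mem_nhds hKs
  -- If norm continuity fails at `s₀`, there are points `s n` and Borel functions `f n` bounded by `1`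
  -- such that `f n` separates `s n * μ * ν` from `s₀ * μ * ν` by `ε`, whereas `f m` does not separate
  -- them by more than `ε / 2` for `m < n`.
  obtain ⟨a, hP, hr⟩ := exists_seq_of_forall_finset_exists
    (fun a : S × (S → ℂ) => a.1 ∈ K ∧ Measurable a.2 ∧ (∀ x, ‖a.2 x‖ ≤ 1) ∧
      ε ≤ ‖J a.1 a.2 - J s₀ a.2‖)
    (fun a b => ‖J b.1 a.2 - J s₀ a.2‖ < ε / 2) (fun F hF => by
      have hev : ∀ᶠ s in 𝓝 s₀, ∀ b ∈ F, ‖J s b.2 - J s₀ b.2‖ < ε / 2 := by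
        rw [eventually_all_finset]
        intro b hb
        obtain ⟨-, hm, hb1, -⟩ := hF b hb
        have hc : Continuous fun s => ‖J s b.2 - J s₀ b.2‖ := by
          refine ((Continuous.congr (hμ.continuous_integral (hφc _ hm hb1).measurable
            ⟨_, hφb _ hb1⟩) fun s => ?_).sub continuous_const).norm
          exact (integral_map_mulLeft μ s
            (hφc _ hm hb1).measurable.aestronglyMeasurable).symm
        refine (hc.tendsto s₀).eventually (gt_mem_nhds ?_)
        simpa using hε
      obtain ⟨s, hs1, hs2, hs3⟩ := (hfreq.and_eventually (hev.and hKs)).exists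
      obtain ⟨f, hf, hb, hd⟩ := dist_push_le_of_pair (rconv μ ν hν) s s₀
      rw [hd, pair_push_rconv hν _ hf ⟨1, hb⟩, pair_push_rconv hν _ hf ⟨1, hb⟩] at hs1
      exact ⟨(s, f), ⟨hs3, hf, hb, hs1⟩, hs2⟩)
  -- Along a subsequence, the functions `f n` converge weakly, so that `ψ n x = ∫ f n d(δ_x * ν)`
  -- converges for almost every `x`.
  obtain ⟨lam, _, _, hlam⟩ := exists_unifAC hμ hK
  obtain ⟨lam', _, _, hlam'⟩ := hν.exists_ae_ac lam
  obtain ⟨k, hk, hconv⟩ := exists_subseq_tendsto_integral lam' (fun n => (a n).2)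
    (fun n => (hP n).2.1) (fun n => (hP n).2.2.1)
  set ψ : ℕ → S → ℂ := fun n => φ (a (k n)).2 with hψ
  have hψc : ∀ n, Continuous (ψ n) := fun n => hφc _ (hP _).2.1 (hP _).2.2.1
  have hψb : ∀ n x, ‖ψ n x‖ ≤ ν.real univ := fun n => hφb _ (hP _).2.2.1
  have hψlim : ∀ᵐ x ∂lam, ∃ l, Tendsto (fun n => ψ n x) atTop (𝓝 l) := by
    filter_upwards [hlam'] with x hx
    obtain ⟨l, hl⟩ := hconv
      (fun s => (((ν.map (ContinuousMap.mulLeft x)).rnDeriv lam' s).toReal : ℂ))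
      Measure.integrable_toReal_rnDeriv.ofReal
    refine ⟨l, hl.congr fun n => ?_⟩
    rw [hψ, hφ]
    simp only
    rw [← integral_map_mulLeft ν x (hP (k n)).2.1.aestronglyMeasurable,
      ← integral_rnDeriv_smul hx]
    refine integral_congr_ae (Eventually.of_forall fun s => ?_)
    simp [mul_comm]
  set M := μ.real univ
  set D := ν.real univ
  have hM : 0 ≤ M := measureReal_nonneg
  have hD : 0 ≤ D := measureReal_nonneg
  -- Two of the `ψ n` are close off a set which is small for all `δ_s * μ`, `s ∈ K`, hence they have
  -- close integrals against `δ_s * μ`, uniformly in `s ∈ K`.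
  obtain ⟨δ, hδ, Hδ⟩ := hlam (ε / (16 * (D + 1))) (by positivity)
  set η := ε / (8 * (M + 1)) with hη
  have hη0 : 0 < η := by positivity
  obtain ⟨m, n, hmn, hlt⟩ := exists_pair_lt_measureReal
    (fun n => aestronglyMeasurable_of_continuous (hψc n) lam) hψlim hη0 hδ
  have hcd : Continuous fun x => ψ n x - ψ m x := (hψc n).sub (hψc m)
  have hbd : ∀ x, ‖ψ n x - ψ m x‖ ≤ 2 * D := fun x =>
    (norm_sub_le _ _).trans (by linarith [hψb n x, hψb m x])
  have hsmall : ∀ s ∈ K, ‖J s (a (k n)).2 - J s (a (k m)).2‖ < ε / 4 := by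
    intro s hs
    have h1 := norm_integral_le_add_measureReal (μ.map (ContinuousMap.mulLeft s)) hcd hη0.le hbd
    rw [map_mulLeft_univ, integral_sub
      ((RadonBounded.of_continuous (hψc n) (hψb n)).integrable _)
      ((RadonBounded.of_continuous (hψc m) (hψb m)).integrable _)] at h1
    have h2 := Hδ _ (isClosed_le continuous_const hcd.norm).measurableSet hlt s hs
    have h3 : η * M ≤ ε / 8 := by
      calc η * M ≤ η * (M + 1) := by gcongr; linarith
        _ = ε / 8 := by rw [hη]; field_simp
    have h4 : 2 * D * (ε / (16 * (D + 1))) < ε / 8 := by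
      calc 2 * D * (ε / (16 * (D + 1))) < 2 * (D + 1) * (ε / (16 * (D + 1))) := by
            gcongr; linarith
        _ = ε / 8 := by field_simp; norm_num
    have h5 : 2 * D * (μ.map (ContinuousMap.mulLeft s)).real {x | η ≤ ‖ψ n x - ψ m x‖} ≤
        2 * D * (ε / (16 * (D + 1))) := by
      gcongr
    refine lt_of_le_of_lt h1 ?_
    linarith
  have h1 := (hP (k n)).2.2.2
  have h2 := hr (k m) (k n) (hk hmn)
  have h3 := hsmall _ (hP (k n)).1
  have h4 := hsmall _ hs₀
  have h5 : J (a (k n)).1 (a (k n)).2 - J s₀ (a (k n)).2 =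
      (J (a (k n)).1 (a (k n)).2 - J (a (k n)).1 (a (k m)).2) -
      (J s₀ (a (k n)).2 - J s₀ (a (k m)).2) +
      (J (a (k n)).1 (a (k m)).2 - J s₀ (a (k m)).2) := by ring
  rw [h5] at h1
  have h6 := (norm_add_le _ _).trans (add_le_add_left (norm_sub_le
    (J (a (k n)).1 (a (k n)).2 - J (a (k n)).1 (a (k m)).2)
    (J s₀ (a (k n)).2 - J s₀ (a (k m)).2)) ‖J (a (k n)).1 (a (k m)).2 - J s₀ (a (k m)).2‖)
  linarith

end DunfordPettis

/-! ### Functionals and closed subspaces of the space of bounded Radon measures -/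

section HahnBanach

/-- Hahn–Banach theorem: a point outside a closed subspace is separated from it by a functional that
vanishes on the subspace. -/
theorem exists_clm_ne_zero_of_notMem {E : Type*} [NormedAddCommGroup E] [NormedSpace ℂ E]
    (V : Submodule ℂ E) (hV : IsClosed (V : Set E)) {x : E} (hx : x ∉ V) :
    ∃ F : E →L[ℂ] ℂ, (∀ v ∈ V, F v = 0) ∧ F x ≠ 0 := by
  have : IsClosed (V : Set E) := hV
  have hq : V.mkQL x ≠ 0 := by
    simpa using hx
  obtain ⟨g, -, hg⟩ := exists_dual_vector ℂ (V.mkQL x) (norm_ne_zero_iff.2 hq)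
  refine ⟨g.comp V.mkQL, fun v hv => ?_, ?_⟩
  · have : V.mkQL v = 0 := by simpa using hv
    rw [ContinuousLinearMap.comp_apply, this, map_zero]
  · rw [ContinuousLinearMap.comp_apply, hg]
    simpa using hx

open RadonMeasure

variable {S : Type*} [TopologicalSpace S] [T2Space S] [MeasurableSpace S] [BorelSpace S]

theorem dens_indicator (ρ : Measure S) [IsFiniteMeasure ρ] [ρ.InnerRegular] {E : Set S}
    (hE : MeasurableSet E) (c : ℂ) : dens ρ (E.indicator fun _ => c) = c • ofMeasure (ρ.restrict E)
      := by
  refine ext_apply fun F hF => ?_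
  rw [dens_apply ((integrable_const c).indicator hE) hF, setIntegral_indicator hE]
  change _ = c • (ofMeasure (ρ.restrict E) : ComplexMeasure S) F
  rw [ofMeasure_apply _ hF, measureReal_restrict_apply hF]
  simp [mul_comm]

/-- A closed subspace of `M(S)` that contains all restrictions of `ρ` contains every measure
which is absolutely continuous with respect to `ρ`. -/
theorem mem_of_forall_restrict_mem {V : Submodule ℂ (RadonMeasure S)}
    (hV : IsClosed (V : Set (RadonMeasure S))) (ρ : Measure S) [IsFiniteMeasure ρ]
    [ρ.InnerRegular] (h : ∀ E, MeasurableSet E → ofMeasure (ρ.restrict E) ∈ V)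
    {α : RadonMeasure S} (hα : α.abs ≪ ρ) : α ∈ V := by
  obtain ⟨f, -, hf, rfl⟩ := exists_eq_dens α ρ hα
  clear hα
  refine Integrable.induction (μ := ρ) (fun f => dens ρ f ∈ V) ?_ ?_ ?_ ?_ hf
  · intro c E hE _
    rw [dens_indicator ρ hE]
    exact V.smul_mem _ (h E hE)
  · intro f g _ hf hg h1 h2
    rw [dens_add hf hg]
    exact V.add_mem h1 h2
  · exact hV.preimage (densL ρ).continuous
  · intro f g hfg _ h1
    rwa [← dens_congr hfg]

/-- A functional on `M(S)` is given, on the measures that are absolutely continuous with respect to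
`ρ`, by a bounded Borel function: this is the duality of `L¹(ρ)` and `L^∞(ρ)`, deduced from the Riesz
representation in `L²(ρ)`. -/
theorem exists_measurable_pair_eq (F : RadonMeasure S →L[ℂ] ℂ) (ρ : Measure S)
    [IsFiniteMeasure ρ] [ρ.InnerRegular] :
    ∃ f : S → ℂ, Measurable f ∧ (∃ D, ∀ s, ‖f s‖ ≤ D) ∧
      ∀ α : RadonMeasure S, α.abs ≪ ρ → F α = pair α f := by
  have hint : ∀ g : Lp ℂ 2 ρ, Integrable g ρ := fun g => (Lp.memLp g).integrable (by norm_num)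
  let B : Lp ℂ 2 ρ →L[ℂ] RadonMeasure S := LinearMap.mkContinuousOfExistsBound
    { toFun := fun g => dens ρ g
      map_add' := fun f g => by
        rw [← dens_add (hint f) (hint g)]
        exact dens_congr (Lp.coeFn_add f g)
      map_smul' := fun c f => by
        rw [RingHom.id_apply, ← dens_smul]
        exact dens_congr (Lp.coeFn_smul c f) }
    (by
      refine ⟨(ρ univ ^ (1 / (1 : ℝ≥0∞).toReal - 1 / (2 : ℝ≥0∞).toReal)).toReal, fun g => ?_⟩
      have h1 := eLpNorm_le_eLpNorm_mul_rpow_measure_univ (p := 1) (q := 2) (by norm_num)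
        (Lp.memLp g).aestronglyMeasurable
      change ‖dens ρ g‖ ≤ _
      rw [norm_dens (hint g), integral_norm_eq_lintegral_enorm (hint g).aestronglyMeasurable,
        ← eLpNorm_one_eq_lintegral_enorm, Lp.norm_def, mul_comm, ← ENNReal.toReal_mul]
      refine ENNReal.toReal_mono (ENNReal.mul_ne_top (Lp.eLpNorm_ne_top g) ?_) h1
      exact ENNReal.rpow_ne_top_of_nonneg (by norm_num) (measure_ne_top _ _))
  set v := (InnerProductSpace.toDual ℂ (Lp ℂ 2 ρ)).symm (F.comp B) with hv
  set f₀ : S → ℂ := fun s => (starRingEnd ℂ) (v s) with hf₀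
  have hf₀i : Integrable f₀ ρ :=
    (Complex.conjCLE : ℂ →L[ℝ] ℂ).integrable_comp (hint v)
  have hE : ∀ E, MeasurableSet E → F (ofMeasure (ρ.restrict E)) = ∫ s in E, f₀ s ∂ρ := by
    intro E hE
    have hm : MemLp (E.indicator fun _ => (1 : ℂ)) 2 ρ := (memLp_const _).indicator hE
    have h1 : (F.comp B) (hm.toLp _) = inner ℂ v (hm.toLp _) := by
      rw [hv, InnerProductSpace.toDual_symm_apply]
    have h2 : B (hm.toLp _) = ofMeasure (ρ.restrict E) := by
      change dens ρ (hm.toLp _) = _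
      rw [dens_congr hm.coeFn_toLp, dens_indicator ρ hE, one_smul]
    rw [ContinuousLinearMap.comp_apply, h2, L2.inner_def] at h1
    rw [h1, ← integral_indicator hE]
    refine integral_congr_ae ?_
    filter_upwards [hm.coeFn_toLp] with s hs
    rw [hs]
    by_cases h : s ∈ E <;> simp [h, hf₀]
  have hle : (dens ρ f₀).abs ≤ ‖F‖₊ • ρ := by
    refine VectorMeasure.variation_le_of_forall_enorm_le fun E hEm => ?_
    change ‖(dens ρ f₀ : ComplexMeasure S) E‖ₑ ≤ _
    rw [dens_apply hf₀i hEm, ← hE E hEm]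
    refine (F.le_opENorm _).trans (le_of_eq ?_)
    rw [Measure.smul_apply, ← ofReal_norm (ofMeasure (ρ.restrict E)), norm_ofMeasure,
      measureReal_restrict_apply_univ, ofReal_measureReal]
    rfl
  have hae : ∀ᵐ s ∂ρ, ‖f₀ s‖ ≤ ‖F‖ := by
    rw [abs_dens hf₀i] at hle
    have h1 : (fun s => ‖f₀ s‖ₑ) ≤ᵐ[ρ] fun _ => (‖F‖₊ : ℝ≥0∞) := by
      refine ae_le_of_forall_setLIntegral_le_of_sigmaFinite₀ hf₀i.aestronglyMeasurable.enorm
        fun E hEm _ => ?_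
      have := hle E
      rw [withDensity_apply _ hEm] at this
      rw [setLIntegral_const]
      exact this
    filter_upwards [h1] with s hs
    exact_mod_cast hs
  obtain ⟨f₁, hf₁, hf₁e⟩ := hf₀i.aestronglyMeasurable.aemeasurable
  have hset : MeasurableSet {s | ‖f₁ s‖ ≤ ‖F‖} := measurableSet_le hf₁.norm measurable_const
  set f := {s | ‖f₁ s‖ ≤ ‖F‖}.indicator f₁ with hf
  have hfm : Measurable f := hf₁.indicator hset
  have hfb : ∀ s, ‖f s‖ ≤ ‖F‖ := fun s => by
    by_cases h : s ∈ {s | ‖f₁ s‖ ≤ ‖F‖}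
    · rw [hf, indicator_of_mem h]; exact h
    · rw [hf, indicator_of_notMem h, norm_zero]; exact norm_nonneg _
  have hfe : f₀ =ᵐ[ρ] f := by
    filter_upwards [hf₁e, hae] with s h1 h2
    rw [hf, indicator_of_mem (show s ∈ {s | ‖f₁ s‖ ≤ ‖F‖} by rwa [mem_ofPred_eq, ← h1]), h1]
  have hR := RadonBounded.of_measurable hfm hfb
  refine ⟨f, hfm, ⟨_, hfb⟩, fun α hα => ?_⟩
  have hmem := mem_of_forall_restrict_mem (V := LinearMap.eqLocus F (pairL hR))
    (isClosed_eq F.continuous (pairL hR).continuous) ρ (fun E hEm => by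
      change F _ = pairL hR _
      rw [hE E hEm, pairL_apply, pair_ofMeasure _ hR]
      exact integral_congr_ae (ae_restrict_of_ae hfe)) hα
  exact hmem

end HahnBanach

/-! ### From setwise to norm continuity of translates -/

section NormContinuity

open RadonMeasure

variable {S : Type*} [TopologicalSpace S] [T2Space S] [MeasurableSpace S] [BorelSpace S]
  [Monoid S] [ContinuousMul S]

/-- The translates `ν * δ_x` depend setwise continuously on `x`. -/
def RightSetwise (ν : Measure S) : Prop :=
  ∀ E, MeasurableSet E → Continuous fun x : S => (ν.map (ContinuousMap.mulRight x)).real E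

variable (S) in
/-- The existence of probability measures with setwise continuous translates that are concentrated
near the identity. -/
def HasApproxUnit : Prop :=
  ∀ U ∈ 𝓝 (1 : S), ∃ ρ : Measure S, IsProbabilityMeasure ρ ∧ ρ.InnerRegular ∧
    LeftSetwise ρ ∧ RightSetwise ρ ∧ ∀ᵐ x ∂ρ, x ∈ U

variable (S) in
/-- The closed subspace of the `α ∈ M(S)` for which `x ↦ δ_x * α` is norm continuous. -/
def normContinuousSubmodule : Submodule ℂ (RadonMeasure S) where
  carrier := {α | Continuous fun x : S => push (ContinuousMap.mulLeft x) α}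
  zero_mem' := by simpa using continuous_const
  add_mem' := fun h1 h2 => (h1.add h2).congr fun _ => (map_add _ _ _).symm
  smul_mem' := fun c α h => (h.const_smul c).congr fun x =>
    ((push (ContinuousMap.mulLeft x)).map_smul c α).symm

theorem isClosed_normContinuousSubmodule :
    IsClosed (normContinuousSubmodule S : Set (RadonMeasure S)) := by
  refine isClosed_of_closure_subset fun α hα => ?_
  refine continuous_of_uniform_approx_of_continuous fun u hu => ?_
  obtain ⟨ε, hε, hεu⟩ := Metric.mem_uniformity_dist.1 hu
  obtain ⟨β, hβ, hd⟩ := Metric.mem_closure_iff.1 hα ε hε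
  refine ⟨_, hβ, fun x => hεu ?_⟩
  rw [dist_eq_norm, ← map_sub]
  exact (norm_push_le _ _).trans_lt (by rwa [← dist_eq_norm])

/-- For a positive measure, setwise continuity of the translates implies norm continuity: by
weak approximation `e_U * ν → ν`, the measure `ν` lies in the closed subspace generated by the
convolutions, whose translates are norm continuous. -/
theorem LeftSetwise.ofMeasure_mem [LocallyCompactSpace S] (hA : HasApproxUnit S) {ν : Measure S}
    [IsFiniteMeasure ν] [ν.InnerRegular] (h : LeftSetwise ν) :
    ofMeasure ν ∈ normContinuousSubmodule S := by
  by_contra hcon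
  obtain ⟨F, hF0, hF⟩ := exists_clm_ne_zero_of_notMem _ isClosed_normContinuousSubmodule hcon
  obtain ⟨K, hK, hK1⟩ := exists_compact_mem_nhds (1 : S)
  obtain ⟨lam, _, _, hlam⟩ := exists_unifAC h hK
  obtain ⟨f, hf, hb, hFf⟩ := exists_measurable_pair_eq F lam
  have hR := RadonBounded.of_measurable hf hb.choose_spec
  have h1 : ν.map (ContinuousMap.mulLeft (1 : S)) = ν := by
    have : (ContinuousMap.mulLeft (1 : S) : S → S) = id := by ext; simp
    rw [this, Measure.map_id]
  have hν : F (ofMeasure ν) = ∫ y, f (1 * y) ∂ν := by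
    rw [hFf _ (by
      rw [abs_ofMeasure]
      simpa only [h1] using hlam.absolutelyContinuous (mem_of_mem_nhds hK1)),
      pair_ofMeasure _ hR]
    simp
  have hc := h.continuous_integral hf hb
  have hpos : 0 < ‖F (ofMeasure ν)‖ / 2 := by positivity
  obtain ⟨ρ, _, _, hρl, -, hρ⟩ := hA
    (K ∩ {x | dist (∫ y, f (x * y) ∂ν) (∫ y, f (1 * y) ∂ν) < ‖F (ofMeasure ν)‖ / 2})
    (inter_mem hK1 (Metric.continuousAt_iff'.1 hc.continuousAt _ hpos))
  have h2 : F (rconv ρ ν h) = ∫ x, ∫ y, f (x * y) ∂ν ∂ρ := by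
    rw [hFf, pair_rconv h hf hb]
    have := isFiniteMeasure_mconv (e := ρ) h
    have := innerRegular_mconv (e := ρ) h
    rw [rconv, abs_ofMeasure]
    refine mconv_ac h ?_
    filter_upwards [hρ] with x hx
    exact hlam.absolutelyContinuous hx.1
  rw [hF0 _ (continuous_push_rconv hρl h)] at h2
  have h3 : ‖∫ x, ((∫ y, f (x * y) ∂ν) - ∫ y, f (1 * y) ∂ν) ∂ρ‖ ≤ ‖F (ofMeasure ν)‖ / 2 := by
    have := norm_integral_le_of_norm_le_const (μ := ρ)
      (f := fun x => (∫ y, f (x * y) ∂ν) - ∫ y, f (1 * y) ∂ν) (C := ‖F (ofMeasure ν)‖ / 2) (by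
        filter_upwards [hρ] with x hx
        rw [← dist_eq_norm]
        exact hx.2.le)
    simpa using this
  rw [integral_sub ((radonBounded_integral_translate h hf hb).integrable ρ) (integrable_const _),
    ← h2, integral_const, ← hν] at h3
  simp only [probReal_univ, one_smul, zero_sub, norm_neg] at h3
  linarith

theorem LeftSetwise.mem_normContinuousSubmodule [LocallyCompactSpace S] (hA : HasApproxUnit S)
    {ν : Measure S} [IsFiniteMeasure ν] [ν.InnerRegular] (h : LeftSetwise ν) {α : RadonMeasure S}
    (hα : α.abs ≪ ν) : α ∈ normContinuousSubmodule S :=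
  mem_of_forall_restrict_mem isClosed_normContinuousSubmodule ν
    (fun _ _ => (h.of_ac Measure.restrict_le_self.absolutelyContinuous).ofMeasure_mem hA) hα

end NormContinuity

/-! ### The opposite multiplication -/

section Opposite

/-- The opposite multiplication on a monoid, on the same underlying type. It exchanges left and
right translations, without changing the space of measures. -/
@[reducible] def oppMonoid (S : Type*) [M : Monoid S] : Monoid S where
  mul x y := M.mul y x
  mul_assoc x y z := (M.mul_assoc z y x).symm
  one := M.one
  one_mul x := M.mul_one x
  mul_one x := M.one_mul x
  npow n x := M.npow n x
  npow_zero x := M.npow_zero x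
  npow_succ n x := pow_succ' x n

theorem continuousMul_oppMonoid (S : Type*) [TopologicalSpace S] [M : Monoid S]
    [h : ContinuousMul S] : @ContinuousMul S _ (oppMonoid S).toMul :=
  @ContinuousMul.mk S _ (oppMonoid S).toMul
    (h.continuous_mul.comp (continuous_snd.prodMk continuous_fst))

end Opposite

open RadonMeasure

/-! ### The subspace `M_a(S)` of a foundation semigroup -/

section Ma

variable {S : Type*} [TopologicalSpace S] [T2Space S] [MeasurableSpace S] [BorelSpace S]
  [Monoid S] [ContinuousMul S]

theorem RightSetwise.of_ac [LocallyCompactSpace S] {ν : Measure S} [IsFiniteMeasure ν]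
    [ν.InnerRegular] (h : RightSetwise ν) {σ : Measure S} [IsFiniteMeasure σ] (hσ : σ ≪ ν) :
    RightSetwise σ :=
  @LeftSetwise.of_ac S _ _ _ _ (oppMonoid S) (continuousMul_oppMonoid S) ν _ _ _ h σ _ hσ

theorem HasApproxUnit.opp (h : HasApproxUnit S) :
    @HasApproxUnit S _ _ (oppMonoid S) (continuousMul_oppMonoid S) := fun U hU => by
  obtain ⟨ρ, h1, h2, h3, h4, h5⟩ := h U hU
  exact ⟨ρ, h1, h2, h4, h3, h5⟩

theorem continuous_real_of_forall_dual {T : Type*} [TopologicalSpace T] {ρ : T → Measure S}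
    [∀ x, IsFiniteMeasure (ρ x)] [∀ x, (ρ x).InnerRegular]
    (h : ∀ F : RadonMeasure S →L[ℂ] ℂ, Continuous fun x => F (ofMeasure (ρ x)))
    {E : Set S} (hE : MeasurableSet E) : Continuous fun x => (ρ x).real E := by
  have h1 := Complex.continuous_re.comp (h (pairL (RadonBounded.indicator_one hE)))
  refine h1.congr fun x => ?_
  simp only [Function.comp_apply, pairL_apply, pair_indicator _ hE, ofMeasure_apply _ hE,
    Complex.ofReal_re]

theorem leftSetwise_of_mem_Ma {α : RadonMeasure S} (h : α ∈ Ma S) : LeftSetwise α.abs :=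
  fun _ hE => continuous_real_of_forall_dual (fun F => (h F).1) hE

theorem rightSetwise_of_mem_Ma {α : RadonMeasure S} (h : α ∈ Ma S) : RightSetwise α.abs :=
  fun _ hE => continuous_real_of_forall_dual (fun F => (h F).2) hE

/-- In a foundation semigroup, the normalized restrictions of measures in `M_a(S)` to
neighbourhoods of the identity form an approximate unit. -/
theorem IsFoundation.hasApproxUnit [LocallyCompactSpace S] (hS : IsFoundation S) :
    HasApproxUnit S := by
  intro U hU
  have h1 : (1 : S) ∈ closure (⋃ μ ∈ Ma S, μ.abs.support) := by rw [hS]; trivial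
  obtain ⟨s, hsU, hs⟩ := mem_closure_iff_nhds.1 h1 (interior U) (interior_mem_nhds.2 hU)
  simp only [mem_iUnion] at hs
  obtain ⟨μ, hμ, hs⟩ := hs
  have hpos : 0 < μ.abs (interior U) :=
    (Measure.mem_support_iff_forall _).1 hs _ (isOpen_interior.mem_nhds hsU)
  have hac : (μ.abs (interior U))⁻¹ • μ.abs.restrict (interior U) ≪ μ.abs :=
    Measure.AbsolutelyContinuous.smul_left Measure.restrict_le_self.absolutelyContinuous _
  have hprob : IsProbabilityMeasure ((μ.abs (interior U))⁻¹ • μ.abs.restrict (interior U)) := by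
    refine ⟨?_⟩
    rw [Measure.smul_apply, Measure.restrict_apply_univ, smul_eq_mul,
      ENNReal.inv_mul_cancel hpos.ne' (measure_ne_top _ _)]
  refine ⟨_, hprob, innerRegular_of_absolutelyContinuous hac,
    (leftSetwise_of_mem_Ma hμ).of_ac hac, (rightSetwise_of_mem_Ma hμ).of_ac hac, ?_⟩
  refine Measure.ae_smul_measure ?_ _
  filter_upwards [ae_restrict_mem isOpen_interior.measurableSet] with x hx using interior_subset hx

theorem LeftSetwise.continuous_push [LocallyCompactSpace S] (hA : HasApproxUnit S)
    {α : RadonMeasure S} (h : LeftSetwise α.abs) :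
    Continuous fun x : S => push (ContinuousMap.mulLeft x) α :=
  h.mem_normContinuousSubmodule hA Measure.AbsolutelyContinuous.rfl

theorem RightSetwise.continuous_push [LocallyCompactSpace S] (hA : HasApproxUnit S)
    {α : RadonMeasure S} (h : RightSetwise α.abs) :
    Continuous fun x : S => push (ContinuousMap.mulRight x) α :=
  @LeftSetwise.continuous_push S _ _ _ _ (oppMonoid S) (continuousMul_oppMonoid S) _ hA.opp α h

/-- For a foundation semigroup, weak continuity of the translates of `|α|`, setwise continuity and norm
continuity are equivalent. -/
theorem mem_Ma_iff [LocallyCompactSpace S] (hA : HasApproxUnit S) {α : RadonMeasure S} :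
    α ∈ Ma S ↔ LeftSetwise α.abs ∧ RightSetwise α.abs := by
  refine ⟨fun h => ⟨leftSetwise_of_mem_Ma h, rightSetwise_of_mem_Ma h⟩, fun ⟨h1, h2⟩ F => ⟨?_, ?_⟩⟩
  · refine (F.continuous.comp (LeftSetwise.continuous_push hA (α := ofMeasure α.abs) ?_)).congr
      fun x => ?_
    · rwa [abs_ofMeasure]
    · rw [Function.comp_apply, push_ofMeasure]; rfl
  · refine (F.continuous.comp (RightSetwise.continuous_push hA (α := ofMeasure α.abs) ?_)).congr
      fun x => ?_
    · rwa [abs_ofMeasure]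
    · rw [Function.comp_apply, push_ofMeasure]; rfl

theorem RadonMeasure.abs_add_le (α β : RadonMeasure S) : (α + β).abs ≤ α.abs + β.abs :=
  VectorMeasure.variation_add_le (μ := (α : ComplexMeasure S)) (ν := (β : ComplexMeasure S))

theorem RadonMeasure.abs_smul_ac (c : ℂ) (α : RadonMeasure S) : (c • α).abs ≪ α.abs := by
  have : (c • α).abs = ‖c‖₊ • α.abs :=
    VectorMeasure.variation_smul (μ := (α : ComplexMeasure S)) (c := c)
  rw [this]
  exact Measure.AbsolutelyContinuous.smul_left Measure.AbsolutelyContinuous.rfl _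

theorem RadonMeasure.abs_zero : (0 : RadonMeasure S).abs = 0 := VectorMeasure.variation_zero

theorem RadonMeasure.abs_real_sub_le (α β : RadonMeasure S) (E : Set S) :
    |α.abs.real E - β.abs.real E| ≤ ‖α - β‖ := by
  have key : ∀ α β : RadonMeasure S, α.abs.real E - β.abs.real E ≤ ‖α - β‖ := fun α β => by
    have h1 : α.abs ≤ (α - β).abs + β.abs := by simpa using abs_add_le (α - β) β
    have h2 : α.abs.real E ≤ ((α - β).abs + β.abs).real E :=
      ENNReal.toReal_mono (measure_ne_top _ _) (h1 E)
    rw [measureReal_add_apply] at h2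
    linarith [abs_apply_le_norm (α - β) E]
  refine abs_sub_le_iff.2 ⟨key α β, ?_⟩
  rw [norm_sub_rev]
  exact key β α

theorem LeftSetwise.add {μ ν : Measure S} [IsFiniteMeasure μ] [IsFiniteMeasure ν]
    (hμ : LeftSetwise μ) (hν : LeftSetwise ν) : LeftSetwise (μ + ν) := fun E hE => by
  refine ((hμ E hE).add (hν E hE)).congr fun x => ?_
  rw [Measure.map_add _ _ (ContinuousMap.mulLeft x).continuous.measurable, measureReal_add_apply]
  rfl

theorem isClosed_setOf_leftSetwise : IsClosed {α : RadonMeasure S | LeftSetwise α.abs} := by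
  refine isClosed_of_closure_subset fun α hα E hE => ?_
  refine continuous_of_uniform_approx_of_continuous fun u hu => ?_
  obtain ⟨ε, hε, hεu⟩ := Metric.mem_uniformity_dist.1 hu
  obtain ⟨β, hβ, hd⟩ := Metric.mem_closure_iff.1 hα ε hε
  refine ⟨_, hβ E hE, fun x => hεu ?_⟩
  rw [Real.dist_eq, measureReal_def, measureReal_def, map_mulLeft_apply _ _ hE,
    map_mulLeft_apply _ _ hE]
  exact (abs_real_sub_le α β _).trans_lt (by rwa [← dist_eq_norm])

variable (S) in
/-- The closed subspace of the `α ∈ M(S)` for which `x ↦ δ_x * |α|` is setwise continuous. -/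
noncomputable def leftSetwiseSubmodule [LocallyCompactSpace S] : Submodule ℂ (RadonMeasure S) where
  carrier := {α | LeftSetwise α.abs}
  zero_mem' := fun E hE => by
    rw [RadonMeasure.abs_zero]
    simpa using continuous_const
  add_mem' := fun {α β} h1 h2 =>
    (LeftSetwise.add h1 h2).of_ac (abs_add_le α β).absolutelyContinuous
  smul_mem' := fun c α h => LeftSetwise.of_ac h (abs_smul_ac c α)

variable (S) in
/-- `M_a(S)` as a subspace of `M(S)`, for a foundation semigroup `S`. -/
noncomputable def maSubmodule [LocallyCompactSpace S] : Submodule ℂ (RadonMeasure S) :=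
  leftSetwiseSubmodule S ⊓
    @leftSetwiseSubmodule S _ _ _ _ (oppMonoid S) (continuousMul_oppMonoid S) _

theorem mem_maSubmodule [LocallyCompactSpace S] {α : RadonMeasure S} :
    α ∈ maSubmodule S ↔ LeftSetwise α.abs ∧ RightSetwise α.abs := Iff.rfl

theorem isClosed_maSubmodule [LocallyCompactSpace S] :
    IsClosed (maSubmodule S : Set (RadonMeasure S)) :=
  isClosed_setOf_leftSetwise.inter
    (@isClosed_setOf_leftSetwise S _ _ _ _ (oppMonoid S) (continuousMul_oppMonoid S))

/-- The definition of `M_a(S)` is symmetric under reversing the multiplication. -/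
theorem maSubmodule_opp [LocallyCompactSpace S] :
    @maSubmodule S _ _ _ _ (oppMonoid S) (continuousMul_oppMonoid S) _ = maSubmodule S :=
  inf_comm _ _

theorem mem_Ma_iff_mem_maSubmodule [LocallyCompactSpace S] (hA : HasApproxUnit S)
    {α : RadonMeasure S} : α ∈ Ma S ↔ α ∈ maSubmodule S := mem_Ma_iff hA

end Ma

/-! ### Fubini's theorem -/

section Fubini

variable {S : Type*} [TopologicalSpace S] [T2Space S] [MeasurableSpace S] [BorelSpace S]
variable {X : Type*} [NormedAddCommGroup X] [NormedSpace ℂ X]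

/-- A continuous function of two variables is measurable for the product `σ`-algebra, up to a null
set of a product of Radon measures. -/
theorem aestronglyMeasurable_prod_of_continuous [LocallyCompactSpace S] {k : S × S → X}
    (hk : Continuous k) (ρ σ : Measure S) [IsFiniteMeasure ρ] [ρ.InnerRegular]
    [IsFiniteMeasure σ] [σ.InnerRegular] : AEStronglyMeasurable k (ρ.prod σ) := by
  obtain ⟨K, hK, hKρ⟩ := exists_ae_mem_iUnion_isCompact ρ
  obtain ⟨L, hL, hLσ⟩ := exists_ae_mem_iUnion_isCompact σ
  have hae : ∀ᵐ z ∂ρ.prod σ, z ∈ ⋃ i : ℕ × ℕ, K i.1 ×ˢ L i.2 := by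
    filter_upwards [Measure.quasiMeasurePreserving_fst.ae hKρ,
      Measure.quasiMeasurePreserving_snd.ae hLσ] with z h1 h2
    obtain ⟨m, hm⟩ := mem_iUnion.1 h1
    obtain ⟨n, hn⟩ := mem_iUnion.1 h2
    exact mem_iUnion.2 ⟨(m, n), hm, hn⟩
  rw [← Measure.restrict_eq_self_of_ae_mem hae, aestronglyMeasurable_iUnion_iff]
  rintro ⟨m, n⟩
  obtain ⟨χ, hχ, -, hχc, -⟩ := exists_continuous_one_zero_of_isCompact ((hK m).prod (hL n))
    isClosed_empty (disjoint_empty _)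
  have h1 : StronglyMeasurable fun z => χ z • k z :=
    HasCompactSupport.stronglyMeasurable_of_prod (χ.continuous.smul hk) hχc.smul_right
  refine h1.aestronglyMeasurable.congr ?_
  filter_upwards [ae_restrict_mem ((hK m).measurableSet.prod (hL n).measurableSet)] with z hz
  simp [hχ hz]

variable [CompleteSpace X]

theorem continuous_pair_of_bounded {T : Type*} [TopologicalSpace T] (β : RadonMeasure S)
    {k : T → S → X} (hk : Continuous (Function.uncurry k)) {C : ℝ} (hC : ∀ x y, ‖k x y‖ ≤ C) :
    Continuous fun x => pair β (k x) := by
  have hR : ∀ x, RadonBounded (k x) := fun x =>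
    RadonBounded.of_continuous (hk.comp (Continuous.prodMk_right x)) (hC x)
  rw [continuous_iff_continuousAt]
  intro x₀
  have h1 : Continuous fun x => ∫ y, ‖k x y - k x₀ y‖ ∂β.abs :=
    continuous_integral_of_bounded β.abs (C := C + C)
      (hk.sub (hk.comp (continuous_const.prodMk continuous_snd))).norm fun x y => by
        rw [norm_norm]
        exact (norm_sub_le _ _).trans (add_le_add (hC _ _) (hC _ _))
  have h2 := h1.tendsto x₀
  simp only [sub_self, norm_zero, integral_zero] at h2
  rw [ContinuousAt, tendsto_iff_norm_sub_tendsto_zero]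
  refine squeeze_zero (fun _ => norm_nonneg _) (fun x => ?_) h2
  rw [← pair_sub_right β (hR x) (hR x₀)]
  exact norm_pair_le_integral β (((hR x).sub (hR x₀)).integrable _)

/-- Fubini's theorem for bounded complex Radon measures and bounded continuous functions. -/
theorem pair_pair_swap [LocallyCompactSpace S] (α β : RadonMeasure S) {k : S → S → X}
    (hk : Continuous (Function.uncurry k)) {C : ℝ} (hC : ∀ x y, ‖k x y‖ ≤ C) :
    pair α (fun x => pair β (fun y => k x y)) = pair β (fun y => pair α (fun x => k x y)) := by
  have key : ∀ (α β : RadonMeasure S) {k : S → S → X}, Continuous (Function.uncurry k) →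
      (∀ x y, ‖k x y‖ ≤ C) → pair α (fun x => pair β (fun y => k x y)) =
        ∫ x, ∫ y, (α.density x * β.density y) • k x y ∂β.abs ∂α.abs := fun α β k hk hC => by
    have hR : ∀ x, RadonBounded (k x) := fun x =>
      RadonBounded.of_continuous (hk.comp (Continuous.prodMk_right x)) (hC x)
    conv_lhs => rw [← dens_density α]
    rw [pair_dens' (integrable_density α) (RadonBounded.of_continuous
      (continuous_pair_of_bounded β hk hC) (fun x => norm_pair_le β (hR x) (hC x)))]
    refine integral_congr_ae (Eventually.of_forall fun x => ?_)
    simp only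
    conv_lhs => rw [← dens_density β]
    rw [pair_dens' (integrable_density β) (hR x), ← integral_smul]
    simp only [smul_smul]
  rw [key α β hk hC, key β α (k := fun y x => k x y) (hk.comp continuous_swap) fun y x => hC x y,
    integral_integral_swap]
  · simp only [mul_comm]
  · refine Integrable.smul_bdd ?_ C ?_ (Eventually.of_forall fun z => hC z.1 z.2)
    · exact (integrable_density α).mul_prod (integrable_density β)
    · exact aestronglyMeasurable_prod_of_continuous hk _ _

end Fubini

/-! ### Weighted translation and convolution -/

section Translation

variable {S : Type*} [TopologicalSpace S] [T2Space S] [MeasurableSpace S] [BorelSpace S]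
  [Monoid S] [ContinuousMul S]
variable {X : Type*} [NormedAddCommGroup X] [NormedSpace ℂ X] [CompleteSpace X]

/-- The function `c(x, y) = ω(xy) / (ω(x) ω(y))`, which takes values in `(0, 1]`. -/
noncomputable def weightQuot (ω : WeightFunction S) (x y : S) : ℂ :=
  ((ω (x * y) * (ω x)⁻¹ * (ω y)⁻¹ : ℝ) : ℂ)

variable (ω : WeightFunction S)

theorem norm_weightQuot_le (x y : S) : ‖weightQuot ω x y‖ ≤ 1 := by
  have hx := ω.pos' x
  have hy := ω.pos' y
  have hxy := ω.pos' (x * y)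
  rw [weightQuot, Complex.norm_real, Real.norm_of_nonneg (by positivity)]
  rw [mul_assoc, ← mul_inv, ← div_eq_mul_inv, div_le_one (by positivity)]
  exact ω.map_mul_le' x y

theorem continuous_weightQuot : Continuous (Function.uncurry (weightQuot ω)) := by
  refine Complex.continuous_ofReal.comp (((ω.continuous'.comp continuous_mul).mul
    ((ω.continuous'.comp continuous_fst).inv₀ fun z => (ω.pos' _).ne')).mul
    ((ω.continuous'.comp continuous_snd).inv₀ fun z => (ω.pos' _).ne'))

theorem radonBounded_weightQuot (x : S) : RadonBounded (weightQuot ω x) :=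
  RadonBounded.of_continuous ((continuous_weightQuot ω).comp (Continuous.prodMk_right x))
    (norm_weightQuot_le ω x)

/-- The cocycle identity for `c(x, y)`. -/
theorem weightQuot_mul (x y z : S) : weightQuot ω y z * weightQuot ω x (y * z) =
    weightQuot ω x y * weightQuot ω (x * y) z := by
  have h := fun s => (ω.pos' s).ne'
  rw [weightQuot, weightQuot, weightQuot, weightQuot, ← Complex.ofReal_mul, ← Complex.ofReal_mul,
    mul_assoc x y z]
  congr 1
  have := h (x * y)
  have := h (y * z)
  have := h x
  have := h y
  have := h z
  field_simp

/-- The operator `β ↦ ω(x)⁻¹ ω (δ_x * (ω⁻¹ β))` on `M(S)`: translation by `x` in `M(S, ω)`, carried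
over to `M(S)` and divided by `ω(x)`. -/
noncomputable def wtrans (x : S) : RadonMeasure S →L[ℂ] RadonMeasure S :=
  (push (ContinuousMap.mulLeft x)).comp (mulL (radonBounded_weightQuot ω x))

theorem wtrans_apply (x : S) (β : RadonMeasure S) :
    wtrans ω x β = push (ContinuousMap.mulLeft x) (mulFun (weightQuot ω x) β) := rfl

theorem norm_wtrans_le (x : S) (β : RadonMeasure S) : ‖wtrans ω x β‖ ≤ ‖β‖ := by
  refine (norm_push_le _ _).trans ?_
  simpa using norm_mulFun_le (radonBounded_weightQuot ω x) β (norm_weightQuot_le ω x)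

theorem pair_wtrans (x : S) (β : RadonMeasure S) {g : S → X} (hg : RadonBounded g) :
    pair (wtrans ω x β) g = pair β (fun y => weightQuot ω x y • g (x * y)) := by
  rw [wtrans_apply, pair_push _ _ hg,
    pair_mulFun (radonBounded_weightQuot ω x) _ (hg.comp (ContinuousMap.mulLeft x))]
  rfl

theorem wtrans_wtrans (x y : S) (β : RadonMeasure S) :
    wtrans ω x (wtrans ω y β) = weightQuot ω x y • wtrans ω (x * y) β := by
  refine ext_pair fun g hg => ?_
  have h1 : RadonBounded fun z => weightQuot ω (x * y) z • g (x * y * z) :=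
    (radonBounded_weightQuot ω (x * y)).smul (hg.comp (ContinuousMap.mulLeft (x * y)))
  have h2 : RadonBounded fun z => weightQuot ω x z • g (x * z) :=
    (radonBounded_weightQuot ω x).smul (hg.comp (ContinuousMap.mulLeft x))
  rw [pair_wtrans ω x _ hg, pair_wtrans ω y _ h2, pair_smul_left _ _ hg,
    pair_wtrans ω (x * y) _ hg, ← pair_const_smul_right _ _ h1]
  simp only [smul_smul, weightQuot_mul, mul_assoc x y]

theorem wtrans_one (β : RadonMeasure S) : (ω 1 : ℂ) • wtrans ω 1 β = β := by
  refine ext_pair fun g hg => ?_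
  have h1 : RadonBounded fun z => weightQuot ω 1 z • g (1 * z) :=
    (radonBounded_weightQuot ω 1).smul (hg.comp (ContinuousMap.mulLeft 1))
  rw [pair_smul_left _ _ hg, pair_wtrans ω 1 _ hg, ← pair_const_smul_right _ _ h1]
  congr 1
  ext z
  have h1 := (ω.pos' 1).ne'
  have h2 := (ω.pos' z).ne'
  rw [one_mul, weightQuot, smul_smul, ← Complex.ofReal_mul, one_mul]
  rw [show ω 1 * (ω z * (ω 1)⁻¹ * (ω z)⁻¹) = 1 by field_simp]
  simp

/-- `M_a(S)` is stable under translation and solid, hence stable under `wtrans`. -/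
theorem wtrans_mem [LocallyCompactSpace S] (x : S) {β : RadonMeasure S}
    (hβ : β ∈ maSubmodule S) : wtrans ω x β ∈ maSubmodule S := by
  have hle : (wtrans ω x β).abs ≪ β.abs.map (ContinuousMap.mulLeft x) :=
    (abs_push_le _ _).absolutelyContinuous.trans
      ((abs_mulFun_ac (radonBounded_weightQuot ω x) β).map
        (ContinuousMap.mulLeft x).continuous.measurable)
  have hL : LeftSetwise (β.abs.map (ContinuousMap.mulLeft x)) := fun E hE => by
    refine ((hβ.1 E hE).comp (continuous_mul_const x)).congr fun s => ?_
    rw [Measure.map_map (ContinuousMap.mulLeft s).continuous.measurable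
      (ContinuousMap.mulLeft x).continuous.measurable]
    have : (ContinuousMap.mulLeft s : S → S) ∘ ContinuousMap.mulLeft x =
        ContinuousMap.mulLeft (s * x) := by ext y; simp [mul_assoc]
    rw [this]
    rfl
  have hR : RightSetwise (β.abs.map (ContinuousMap.mulLeft x)) := fun E hE => by
    refine ((mem_maSubmodule.1 hβ).2 _
      ((ContinuousMap.mulLeft x).continuous.measurable hE)).congr fun s => ?_
    rw [measureReal_def, measureReal_def,
      Measure.map_apply (ContinuousMap.mulRight s).continuous.measurable
        ((ContinuousMap.mulLeft x).continuous.measurable hE),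
      Measure.map_apply (ContinuousMap.mulRight s).continuous.measurable hE,
      Measure.map_apply (ContinuousMap.mulLeft x).continuous.measurable
        ((ContinuousMap.mulRight s).continuous.measurable hE)]
    congr 2
    ext y
    simp [mul_assoc]
  exact ⟨hL.of_ac hle, hR.of_ac hle⟩

/-- The translates of a measure in `M_a(S)` are norm continuous, and `c(x, ·)` depends continuously on
`x` in `L¹(|β|)`. -/
theorem continuous_wtrans [LocallyCompactSpace S] (hA : HasApproxUnit S) {β : RadonMeasure S}
    (hβ : β ∈ maSubmodule S) : Continuous fun x => wtrans ω x β := by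
  have hq := radonBounded_weightQuot ω
  rw [continuous_iff_continuousAt]
  intro x₀
  have h1 : Continuous fun x => ∫ y, ‖weightQuot ω x y - weightQuot ω x₀ y‖ ∂β.abs :=
    continuous_integral_of_bounded β.abs (C := 1 + 1)
      ((continuous_weightQuot ω).sub ((continuous_weightQuot ω).comp
        (continuous_const.prodMk continuous_snd))).norm fun x y => by
        rw [norm_norm]
        exact (norm_sub_le _ _).trans
          (add_le_add (norm_weightQuot_le _ _ _) (norm_weightQuot_le _ _ _))
  have h2 : Continuous fun x =>
      push (ContinuousMap.mulLeft x) (mulFun (weightQuot ω x₀) β) :=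
    LeftSetwise.continuous_push hA (LeftSetwise.of_ac hβ.1 (abs_mulFun_ac (hq x₀) β))
  have h3 := (h1.tendsto x₀).add ((tendsto_iff_norm_sub_tendsto_zero.1 (h2.tendsto x₀)))
  simp only [sub_self, norm_zero, integral_zero, add_zero] at h3
  rw [ContinuousAt, tendsto_iff_norm_sub_tendsto_zero]
  refine squeeze_zero (fun _ => norm_nonneg _) (fun x => ?_) h3
  have h4 : wtrans ω x β - wtrans ω x₀ β =
      push (ContinuousMap.mulLeft x) (mulFun (fun y => weightQuot ω x y - weightQuot ω x₀ y) β) +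
        (push (ContinuousMap.mulLeft x) (mulFun (weightQuot ω x₀) β) -
          push (ContinuousMap.mulLeft x₀) (mulFun (weightQuot ω x₀) β)) := by
    rw [mulFun_sub_left (hq x) (hq x₀), map_sub, wtrans_apply, wtrans_apply]
    abel
  rw [h4]
  refine (norm_add_le _ _).trans (add_le_add ((norm_push_le _ _).trans ?_) le_rfl)
  exact norm_mulFun_le_integral ((hq x).sub (hq x₀)) β

theorem radonBounded_wtrans [LocallyCompactSpace S] (hA : HasApproxUnit S) {β : RadonMeasure S}
    (hβ : β ∈ maSubmodule S) : RadonBounded fun x => wtrans ω x β :=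
  RadonBounded.of_continuous (continuous_wtrans ω hA hβ) fun x => norm_wtrans_le ω x β

/-- Convolution in `M_a(S, ω)`, carried over to `M_a(S)` by `μ ↦ ωμ`. -/
noncomputable def conv (α β : RadonMeasure S) : RadonMeasure S := pair α fun x => wtrans ω x β

section Conv

variable [LocallyCompactSpace S] (hA : HasApproxUnit S)
include hA

theorem norm_conv_le (α : RadonMeasure S) {β : RadonMeasure S} (hβ : β ∈ maSubmodule S) :
    ‖conv ω α β‖ ≤ ‖α‖ * ‖β‖ := by
  rw [mul_comm]
  exact norm_pair_le α (radonBounded_wtrans ω hA hβ) fun x => norm_wtrans_le ω x β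

theorem pair_conv (α : RadonMeasure S) {β : RadonMeasure S} (hβ : β ∈ maSubmodule S) {g : S → X}
    (hg : RadonBounded g) :
    pair (conv ω α β) g = pair α fun x => pair β fun y => weightQuot ω x y • g (x * y) := by
  rw [← pairL_apply hg, conv, clm_pair _ _ (radonBounded_wtrans ω hA hβ)]
  simp only [pairL_apply, pair_wtrans ω _ _ hg]

/-- The integral of the `M_a(S)`-valued function `x ↦ wtrans ω x β` stays in the closed subspace
`M_a(S)`. -/
theorem conv_mem (α : RadonMeasure S) {β : RadonMeasure S} (hβ : β ∈ maSubmodule S) :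
    conv ω α β ∈ maSubmodule S := by
  by_contra hcon
  obtain ⟨F, hF, hF0⟩ := exists_clm_ne_zero_of_notMem _ isClosed_maSubmodule hcon
  refine hF0 ?_
  rw [conv, clm_pair _ _ (radonBounded_wtrans ω hA hβ)]
  simp only [hF _ (wtrans_mem ω _ hβ)]
  exact VectorMeasure.integral_zero ..

theorem conv_add_left (α α' : RadonMeasure S) {β : RadonMeasure S} (hβ : β ∈ maSubmodule S) :
    conv ω (α + α') β = conv ω α β + conv ω α' β :=
  pair_add_left _ _ (radonBounded_wtrans ω hA hβ)

theorem conv_smul_left (c : ℂ) (α : RadonMeasure S) {β : RadonMeasure S}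
    (hβ : β ∈ maSubmodule S) : conv ω (c • α) β = c • conv ω α β :=
  pair_smul_left _ _ (radonBounded_wtrans ω hA hβ)

theorem conv_add_right (α : RadonMeasure S) {β β' : RadonMeasure S} (hβ : β ∈ maSubmodule S)
    (hβ' : β' ∈ maSubmodule S) : conv ω α (β + β') = conv ω α β + conv ω α β' := by
  rw [conv, conv, conv,
    ← pair_add_right α (radonBounded_wtrans ω hA hβ) (radonBounded_wtrans ω hA hβ')]
  simp only [map_add]

theorem conv_smul_right (c : ℂ) (α : RadonMeasure S) {β : RadonMeasure S}
    (hβ : β ∈ maSubmodule S) : conv ω α (c • β) = c • conv ω α β := by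
  rw [conv, conv, ← pair_const_smul_right α c (radonBounded_wtrans ω hA hβ)]
  simp only [map_smul]

theorem wtrans_conv (s : S) (α : RadonMeasure S) {β : RadonMeasure S} (hβ : β ∈ maSubmodule S) :
    wtrans ω s (conv ω α β) = conv ω (wtrans ω s α) β := by
  rw [conv, conv, clm_pair _ _ (radonBounded_wtrans ω hA hβ),
    pair_wtrans ω s α (radonBounded_wtrans ω hA hβ)]
  simp only [wtrans_wtrans]

theorem conv_assoc (α : RadonMeasure S) {β γ : RadonMeasure S} (hβ : β ∈ maSubmodule S)
    (hγ : γ ∈ maSubmodule S) : conv ω (conv ω α β) γ = conv ω α (conv ω β γ) := by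
  have h := radonBounded_wtrans ω hA hγ
  have h1 : conv ω (conv ω α β) γ = pairL h (conv ω α β) := rfl
  rw [h1, conv, clm_pair _ _ (radonBounded_wtrans ω hA hβ), conv]
  simp only [wtrans_conv ω hA _ _ hγ]
  rfl

end Conv

end Translation

/-! ### Cohen's factorization theorem -/

section Cohen

variable {A X : Type*} [NormedAddCommGroup A] [NormedSpace ℂ A] [NormedAddCommGroup X]
  [NormedSpace ℂ X]

/-- If `‖T‖ ≤ C` and `c (1 + C) ≤ 1 / 2`, then `E = c T + (1 - c)` is invertible, with an inverse of
norm at most `2`. -/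
theorem exists_inverse_convex_comb [CompleteSpace X] {T : X →L[ℂ] X} {C c : ℝ} (hT : ‖T‖ ≤ C)
    (hc : 0 < c) (hcC : c * (1 + C) ≤ 1 / 2) : ∃ E : (X →L[ℂ] X)ˣ,
      (E : X →L[ℂ] X) = (c : ℂ) • T + (1 - c : ℂ) • 1 ∧ ‖((E⁻¹ : (X →L[ℂ] X)ˣ) : X →L[ℂ] X)‖ ≤ 2 := by
  have hn : ‖(c : ℂ) • (1 - T)‖ ≤ 1 / 2 := by
    rw [norm_smul, Complex.norm_real, Real.norm_of_nonneg hc.le]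
    refine (mul_le_mul_of_nonneg_left ((norm_sub_le _ _).trans
      (add_le_add ContinuousLinearMap.norm_id_le hT)) hc.le).trans hcC
  have hn' : ‖(c : ℂ) • (1 - T)‖ < 1 := by linarith
  have hE : ((Units.oneSub _ hn' : (X →L[ℂ] X)ˣ) : X →L[ℂ] X) =
      (c : ℂ) • T + (1 - c : ℂ) • 1 := by
    rw [Units.val_oneSub, smul_sub, sub_smul, one_smul]
    abel
  refine ⟨Units.oneSub _ hn', hE, ContinuousLinearMap.opNorm_le_bound _ zero_le_two fun w => ?_⟩
  set z := ((Units.oneSub _ hn')⁻¹ : (X →L[ℂ] X)ˣ).val w with hz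
  have h1 : z - ((c : ℂ) • (1 - T)) z = w := by
    have : (Units.oneSub _ hn' : (X →L[ℂ] X)ˣ).val z = w := by
      rw [hz, ← mul_apply_eq_comp, Units.mul_inv]
      rfl
    rwa [Units.val_oneSub] at this
  have h2 := ((c : ℂ) • (1 - T)).le_of_opNorm_le hn z
  have h3 : ‖z‖ ≤ ‖w‖ + ‖((c : ℂ) • (1 - T)) z‖ := by
    rw [← h1]
    simpa using norm_add_le (z - ((c : ℂ) • (1 - T)) z) (((c : ℂ) • (1 - T)) z)
  linarith

/-- The inductive step of Cohen's factorization theorem: passing from `P = M a + t` to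
`P' = M (a + c t e) + (1 - c) t` with `e` close to a left unit for `a` and `x`, the operator stays
invertible and `P⁻¹ x` changes by less than `ε`. -/
theorem cohen_step [CompleteSpace X] (M : A →L[ℂ] X →L[ℂ] X) {D C c : ℝ}
    (hC : ∀ e, ‖e‖ ≤ D → ‖M e‖ ≤ C)
    (H : ∀ (a : A) (x : X) (δ : ℝ), 0 < δ →
      ∃ e, ‖e‖ ≤ D ∧ ‖M e * M a - M a‖ < δ ∧ ‖M e x - x‖ < δ)
    (hc : 0 < c) (hcC : c * (1 + C) ≤ 1 / 2) (hc1 : c ≤ 1 / 2) (x : X) {t : ℂ} {a : A}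
    (hP : IsUnit (M a + t • 1)) {ε : ℝ} (hε : 0 < ε) :
    ∃ e, ‖e‖ ≤ D ∧ IsUnit (M (a + (c * t) • e) + ((1 - c) * t) • 1) ∧
      ‖Ring.inverse (M (a + (c * t) • e) + ((1 - c) * t) • 1) x -
        Ring.inverse (M a + t • 1) x‖ < ε := by
  obtain ⟨P, hP⟩ := hP
  rw [← hP]
  set R := Ring.inverse (P : X →L[ℂ] X) with hR
  have hx1 : 0 < ‖x‖ + 1 := by positivity
  have hopen : ∀ᶠ Q in 𝓝 (P : X →L[ℂ] X), IsUnit Q := Units.nhds P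
  have hcont : ∀ᶠ Q in 𝓝 (P : X →L[ℂ] X),
      dist (Ring.inverse Q) R < min 1 (ε / (2 * (‖x‖ + 1))) :=
    Metric.continuousAt_iff'.1 (NormedRing.inverse_continuousAt P) _ (by positivity)
  obtain ⟨η, hη, hη'⟩ := Metric.eventually_nhds_iff.1 (hopen.and hcont)
  have hR1 : 0 < ‖R‖ + 1 := by positivity
  obtain ⟨e, he, h1, h2⟩ := H a x (min η (ε / (2 * (‖R‖ + 1)))) (by positivity)
  obtain ⟨E, hE, hE2⟩ := exists_inverse_convex_comb (hC e he) hc hcC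
  set F := ((E⁻¹ : (X →L[ℂ] X)ˣ) : X →L[ℂ] X) with hF
  have hPn : M (a + (c * t) • e) + ((1 - c) * t) • 1 =
      E * ((P : X →L[ℂ] X) - F * ((c : ℂ) • (M e * M a - M a))) := by
    rw [mul_sub, ← mul_assoc, hF, Units.mul_inv, one_mul, hE, hP, map_add, map_smul]
    ext z
    simp only [add_apply, sub_apply,
      mul_apply_eq_comp, smul_apply,
      one_apply_eq_self, map_add, map_smul]
    module
  have hcn : ‖(c : ℂ)‖ = c := by rw [Complex.norm_real, Real.norm_of_nonneg hc.le]
  set Q := (P : X →L[ℂ] X) - F * ((c : ℂ) • (M e * M a - M a)) with hQ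
  have hQP : dist Q P < η := by
    rw [dist_eq_norm, hQ, sub_sub_cancel_left, norm_neg]
    refine (norm_mul_le _ _).trans_lt ?_
    rw [norm_smul, hcn]
    have h3 := h1.trans_le (min_le_left _ _)
    have h4 := norm_nonneg (M e * M a - M a)
    calc ‖F‖ * (c * ‖M e * M a - M a‖) ≤ 2 * (1 / 2 * ‖M e * M a - M a‖) := by gcongr
      _ < η := by linarith
  obtain ⟨⟨Q', hQ'⟩, hQd⟩ := hη' hQP
  rw [lt_min_iff, dist_eq_norm] at hQd
  refine ⟨e, he, ?_, ?_⟩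
  · rw [hPn, ← hQ']
    exact (E * Q').isUnit
  · have hinv : Ring.inverse (M (a + (c * t) • e) + ((1 - c) * t) • 1) = Ring.inverse Q * F := by
      rw [hPn, ← hQ', ← Units.val_mul, Ring.inverse_unit, Ring.inverse_unit, mul_inv_rev,
        Units.val_mul]
    have hFx : F x - x = F ((c : ℂ) • (x - M e x)) := by
      have h3 : F ((E : X →L[ℂ] X) x) = x := by
        rw [← mul_apply_eq_comp, hF, Units.inv_mul]; rfl
      have h4 : (c : ℂ) • (x - M e x) = x - (E : X →L[ℂ] X) x := by
        rw [hE]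
        simp only [add_apply, smul_apply,
          one_apply_eq_self]
        module
      rw [h4, map_sub, h3]
    have hFn : ‖F x - x‖ < ε / (2 * (‖R‖ + 1)) := by
      rw [hFx]
      refine lt_of_le_of_lt (F.le_of_opNorm_le hE2 _) ?_
      rw [norm_smul, hcn, norm_sub_rev]
      have h3 := h2.trans_le (min_le_right _ _)
      have h4 := norm_nonneg (M e x - x)
      calc 2 * (c * ‖M e x - x‖) ≤ 2 * (1 / 2 * ‖M e x - x‖) := by gcongr
        _ < _ := by linarith
    have hsplit : (Ring.inverse Q * F) x - R x =
        Ring.inverse Q (F x - x) + (Ring.inverse Q - R) x := by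
      rw [map_sub, mul_apply_eq_comp, sub_apply]
      abel
    rw [hinv, hsplit]
    have hQn : ‖Ring.inverse Q‖ ≤ ‖R‖ + 1 := by
      have := norm_add_le (Ring.inverse Q - R) R
      rw [sub_add_cancel] at this
      linarith [hQd.1]
    calc _ ≤ ‖Ring.inverse Q‖ * ‖F x - x‖ + ‖Ring.inverse Q - R‖ * ‖x‖ :=
          (norm_add_le _ _).trans (add_le_add (ContinuousLinearMap.le_opNorm _ _)
            (ContinuousLinearMap.le_opNorm _ _))
      _ ≤ (‖R‖ + 1) * ‖F x - x‖ + ε / (2 * (‖x‖ + 1)) * (‖x‖ + 1) := by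
          gcongr
          · exact hQd.2.le
          · linarith
      _ < (‖R‖ + 1) * (ε / (2 * (‖R‖ + 1))) + ε / (2 * (‖x‖ + 1)) * (‖x‖ + 1) := by gcongr
      _ = ε := by field_simp; norm_num

/-- Cohen's factorization theorem: if the operators `M e`, with `e` in a ball of `A`, form an
approximate left unit both for `X` and for all the operators `M a`, then every `x ∈ X` factors as
`x = M a y`. -/
theorem cohen_factorization [CompleteSpace A] [CompleteSpace X] (M : A →L[ℂ] X →L[ℂ] X) {D : ℝ}
    (H : ∀ (a : A) (x : X) (δ : ℝ), 0 < δ →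
      ∃ e, ‖e‖ ≤ D ∧ ‖M e * M a - M a‖ < δ ∧ ‖M e x - x‖ < δ) (x : X) :
    ∃ a y, x = M a y := by
  have hD : 0 ≤ D := by
    obtain ⟨e, he, -⟩ := H 0 0 1 one_pos
    exact (norm_nonneg e).trans he
  set C := ‖M‖ * D
  have hC0 : 0 ≤ C := by positivity
  have hC : ∀ e, ‖e‖ ≤ D → ‖M e‖ ≤ C := fun e he =>
    (M.le_opNorm e).trans (mul_le_mul_of_nonneg_left he (norm_nonneg M))
  set c : ℝ := 1 / (2 * (1 + C)) with hc
  have hc0 : 0 < c := by positivity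
  have hcC : c * (1 + C) ≤ 1 / 2 := le_of_eq (by rw [hc]; field_simp)
  have hc1 : c ≤ 1 / 2 := le_trans (by nlinarith) hcC
  set q : ℂ := 1 - c with hq
  have hqn : ‖q‖ = 1 - c := by
    rw [hq, ← Complex.ofReal_one, ← Complex.ofReal_sub, Complex.norm_real,
      Real.norm_of_nonneg (by linarith)]
  have hq1 : ‖q‖ < 1 := by rw [hqn]; linarith
  choose e he hunit hlt using fun (n : ℕ) (a : {a // IsUnit (M a + q ^ n • 1)}) =>
    cohen_step M hC H hc0 hcC hc1 x a.2 (ε := (1 / 2) ^ n) (by positivity)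
  let u : (n : ℕ) → {a // IsUnit (M a + q ^ n • 1)} := fun n => Nat.rec
    ⟨0, by simp⟩ (fun n a => ⟨a.1 + (c * q ^ n) • e n a, by
      rw [pow_succ']; exact hunit n a⟩) n
  have hu : ∀ n, (u (n + 1)).1 = (u n).1 + (c * q ^ n) • e n (u n) := fun n => rfl
  set y : ℕ → X := fun n => Ring.inverse (M (u n).1 + q ^ n • 1) x with hy
  have hxy : ∀ n, M (u n).1 (y n) + q ^ n • y n = x := fun n => by
    have := Ring.mul_inverse_cancel _ (u n).2
    exact congrArg (fun T : X →L[ℂ] X => T x) this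
  have hyc : CauchySeq y := by
    refine cauchySeq_of_le_geometric (1 / 2) 1 (by norm_num) fun n => ?_
    rw [one_mul, dist_comm, dist_eq_norm, hy]
    have := (hlt n (u n)).le
    rw [← pow_succ'] at this
    exact this
  have huc : CauchySeq fun n => (u n).1 := by
    refine cauchySeq_of_le_geometric ‖q‖ (c * D) hq1 fun n => ?_
    rw [dist_comm, dist_eq_norm, hu, add_sub_cancel_left, norm_smul, norm_mul, norm_pow,
      Complex.norm_real, Real.norm_of_nonneg hc0.le, mul_right_comm]
    gcongr
    exact he n (u n)
  obtain ⟨y₀, hy₀⟩ := cauchySeq_tendsto_of_complete hyc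
  obtain ⟨a₀, ha₀⟩ := cauchySeq_tendsto_of_complete huc
  refine ⟨a₀, y₀, ?_⟩
  have hMc : Continuous fun p : A × X => M p.1 p.2 := M.continuous₂
  have h1 : Tendsto (fun n => M (u n).1 (y n)) atTop (𝓝 (M a₀ y₀)) :=
    (hMc.tendsto (a₀, y₀)).comp (ha₀.prodMk_nhds hy₀)
  have h2 : Tendsto (fun n => q ^ n • y n) atTop (𝓝 ((0 : ℂ) • y₀)) :=
    (tendsto_pow_atTop_nhds_zero_of_norm_lt_one hq1).smul hy₀
  have h3 := h1.add h2
  simp only [hxy, zero_smul, add_zero] at h3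
  exact tendsto_nhds_unique tendsto_const_nhds h3

end Cohen

/-! ### Approximate units -/

section ApproximateUnit

variable {S : Type*} [TopologicalSpace S] [T2Space S] [MeasurableSpace S] [BorelSpace S]
  [Monoid S] [ContinuousMul S] [LocallyCompactSpace S]
variable {X : Type*} [NormedAddCommGroup X] [NormedSpace ℂ X] [CompleteSpace X]
variable (ω : WeightFunction S)

/-- The filter on `M_a(S)` along which `ω(1)` times a probability measure concentrates at the
identity. The factor makes it an approximate unit for `conv ω`. -/
def unitFilter : Filter (maSubmodule S) :=
  (𝓝 (1 : S)).lift' fun U => {e | ∃ (ρ : Measure S) (_ : IsProbabilityMeasure ρ)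
    (_ : ρ.InnerRegular), (∀ᵐ x ∂ρ, x ∈ U) ∧ (e : RadonMeasure S) = (ω 1 : ℂ) • ofMeasure ρ}

theorem unitFilter_neBot (hA : HasApproxUnit S) : (unitFilter ω).NeBot := by
  rw [unitFilter, lift'_neBot_iff]
  · intro U hU
    obtain ⟨ρ, h1, h2, h3, h4, h5⟩ := hA U hU
    refine ⟨⟨(ω 1 : ℂ) • ofMeasure ρ, (maSubmodule S).smul_mem _ (mem_maSubmodule.2 ?_)⟩,
      ρ, h1, h2, h5, rfl⟩
    rw [abs_ofMeasure]
    exact ⟨h3, h4⟩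
  · rintro U W hUW e ⟨ρ, h1, h2, h3, h4⟩
    exact ⟨ρ, h1, h2, h3.mono fun x hx => hUW hx, h4⟩

theorem eventually_unitFilter_norm_le : ∀ᶠ e in unitFilter ω, ‖e‖ ≤ ω 1 := by
  refine mem_of_superset (mem_lift' univ_mem) ?_
  rintro e ⟨ρ, h1, h2, -, h4⟩
  rw [mem_ofPred_eq, ← Submodule.norm_coe, h4, norm_smul, norm_ofMeasure, probReal_univ, mul_one,
    Complex.norm_real, Real.norm_of_nonneg (ω.pos' 1).le]

theorem tendsto_pair_unitFilter {g : S → X} (hg : Continuous g) {C : ℝ} (hC : ∀ s, ‖g s‖ ≤ C) :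
    Tendsto (fun e : maSubmodule S => pair (e : RadonMeasure S) g) (unitFilter ω)
      (𝓝 ((ω 1 : ℂ) • g 1)) := by
  have hR := RadonBounded.of_continuous hg hC
  have hω := ω.pos' 1
  rw [Metric.tendsto_nhds]
  intro ε hε
  have hU : {x | dist (g x) (g 1) < ε / (2 * ω 1)} ∈ 𝓝 (1 : S) :=
    Metric.continuousAt_iff'.1 hg.continuousAt _ (by positivity)
  refine mem_of_superset (mem_lift' hU) ?_
  rintro e ⟨ρ, _, _, h3, h4⟩
  rw [mem_ofPred_eq, h4, pair_smul_left _ _ hR, pair_ofMeasure ρ hR, dist_eq_norm, ← smul_sub,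
    norm_smul, Complex.norm_real, Real.norm_of_nonneg hω.le]
  have h5 : ‖∫ s, (g s - g 1) ∂ρ‖ ≤ ε / (2 * ω 1) := by
    have := norm_integral_le_of_norm_le_const (μ := ρ) (f := fun s => g s - g 1)
      (C := ε / (2 * ω 1)) (h3.mono fun x hx => by rw [← dist_eq_norm]; exact le_of_lt hx)
    simpa using this
  rw [integral_sub (hR.integrable ρ) (integrable_const _), integral_const, probReal_univ,
    one_smul] at h5
  calc _ ≤ ω 1 * (ε / (2 * ω 1)) := by gcongr
    _ = ε / 2 := by field_simp
    _ < ε := by linarith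

theorem tendsto_conv_unitFilter (hA : HasApproxUnit S) {β : RadonMeasure S}
    (hβ : β ∈ maSubmodule S) :
    Tendsto (fun e : maSubmodule S => conv ω e β) (unitFilter ω) (𝓝 β) := by
  have := tendsto_pair_unitFilter ω (continuous_wtrans ω hA hβ) fun x => norm_wtrans_le ω x β
  rwa [wtrans_one] at this

end ApproximateUnit

/-! ### Integrated forms of weighted actions -/

section Integration

variable {S : Type*} [TopologicalSpace S] [T2Space S] [MeasurableSpace S] [BorelSpace S]
  [Monoid S] [ContinuousMul S] [LocallyCompactSpace S]
variable {X : Type*} [NormedAddCommGroup X] [NormedSpace ℂ X] [CompleteSpace X]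
variable {ω : WeightFunction S}

theorem WeightFunction.ofReal_ne_zero (ω : WeightFunction S) (s : S) : (ω s : ℂ) ≠ 0 :=
  Complex.ofReal_ne_zero.2 (ω.pos' s).ne'

/-- The action of `s` in a left weighted module, as a bounded operator. -/
noncomputable def IsLeftWeightedModule.actL {a : S →* Module.End ℂ X}
    (ha : IsLeftWeightedModule ω a) (s : S) : X →L[ℂ] X :=
  LinearMap.mkContinuousOfExistsBound (a s) (by
    obtain ⟨K, -, hK⟩ := ha.bound
    exact ⟨K * ω s, hK s⟩)

namespace IsLeftWeightedModule

variable {a : S →* Module.End ℂ X} (ha : IsLeftWeightedModule ω a)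
include ha

theorem continuous_inv_smul (x : X) : Continuous fun s => (ω s)⁻¹ • a s x :=
  (ω.continuous'.inv₀ fun s => (ω.pos' s).ne').smul (ha.continuous x)

theorem exists_norm_inv_smul_le : ∃ K > 0, ∀ x s, ‖(ω s)⁻¹ • a s x‖ ≤ K * ‖x‖ := by
  obtain ⟨K, hK0, hK⟩ := ha.bound
  refine ⟨K, hK0, fun x s => ?_⟩
  have hs := ω.pos' s
  rw [norm_smul, norm_inv, Real.norm_of_nonneg hs.le, inv_mul_le_iff₀ hs]
  exact (hK s x).trans (le_of_eq (by ring))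

theorem radonBounded (x : X) : RadonBounded fun s => (ω s)⁻¹ • a s x := by
  obtain ⟨K, -, hK⟩ := ha.exists_norm_inv_smul_le
  exact RadonBounded.of_continuous (ha.continuous_inv_smul x) (hK x)

/-- The operator `x ↦ ∫ s·x dμ(s)`, as a function of the bounded measure `ωμ`. -/
noncomputable def integrated : RadonMeasure S →L[ℂ] X →L[ℂ] X :=
  LinearMap.mkContinuousOfExistsBound₂
    (LinearMap.mk₂ ℂ (fun α x => pair α fun s => (ω s)⁻¹ • a s x)
      (fun α β x => pair_add_left α β (ha.radonBounded x))
      (fun c α x => pair_smul_left c α (ha.radonBounded x))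
      (fun α x y => by
        rw [← pair_add_right α (ha.radonBounded x) (ha.radonBounded y)]
        simp only [map_add, smul_add])
      (fun c α x => by
        rw [← pair_const_smul_right α c (ha.radonBounded x)]
        simp only [map_smul, smul_comm c]))
    (by
      obtain ⟨K, -, hK⟩ := ha.exists_norm_inv_smul_le
      refine ⟨K, fun α x => (norm_pair_le α (ha.radonBounded x) (hK x)).trans (le_of_eq ?_)⟩
      ring)

theorem integrated_apply (α : RadonMeasure S) (x : X) :
    ha.integrated α x = pair α fun s => (ω s)⁻¹ • a s x := rfl

theorem weightQuot_smul (s t : S) (x : X) :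
    weightQuot ω s t • (ω (s * t))⁻¹ • a (s * t) x = (ω s)⁻¹ • a s ((ω t)⁻¹ • a t x) := by
  have h1 := (ω.pos' s).ne'
  have h2 := (ω.pos' t).ne'
  have h3 := (ω.pos' (s * t)).ne'
  rw [map_mul, Module.End.mul_apply, ← Complex.coe_smul (ω t)⁻¹, map_smul, Complex.coe_smul,
    weightQuot, Complex.coe_smul, smul_smul, smul_smul]
  congr 1
  field_simp

/-- In the integrated form of `a`, the operator `a s` acts through translation of measures. -/
theorem act_integrated (s : S) (α : RadonMeasure S) (x : X) :
    a s (ha.integrated α x) = ha.integrated ((ω s : ℂ) • wtrans ω s α) x := by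
  have hs := (ω.pos' s).ne'
  have h1 : a s (ha.integrated α x) = ha.actL s (ha.integrated α x) := rfl
  have hR : RadonBounded fun t => weightQuot ω s t • (ω (s * t))⁻¹ • a (s * t) x :=
    (radonBounded_weightQuot ω s).smul ((ha.radonBounded x).comp (ContinuousMap.mulLeft s))
  rw [h1, integrated_apply, clm_pair _ _ (ha.radonBounded x), map_smul,
    smul_apply, integrated_apply, pair_wtrans ω _ _ (ha.radonBounded x),
    ← pair_const_smul_right _ _ hR]
  congr 1
  ext t
  rw [ha.weightQuot_smul, Complex.coe_smul, smul_smul, mul_inv_cancel₀ hs, one_smul]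
  rfl

theorem integrated_conv (hA : HasApproxUnit S) (α : RadonMeasure S) {β : RadonMeasure S}
    (hβ : β ∈ maSubmodule S) :
    ha.integrated (conv ω α β) = ha.integrated α * ha.integrated β := by
  ext x
  rw [mul_apply_eq_comp, integrated_apply, integrated_apply,
    pair_conv ω hA α hβ (ha.radonBounded x)]
  congr 1
  ext s
  have h1 : (ω s)⁻¹ • a s (ha.integrated β x) =
      (((ω s)⁻¹ : ℝ) : ℂ) • ha.actL s (ha.integrated β x) := by rw [Complex.coe_smul]; rfl
  rw [h1, ← smul_apply, integrated_apply, clm_pair _ _ (ha.radonBounded x)]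
  congr 1
  ext t
  rw [ha.weightQuot_smul, smul_apply, Complex.coe_smul]
  rfl

/-- The integrated form of a weighted module is neo-unital. -/
theorem exists_eq_integrated (hA : HasApproxUnit S) (x : X) :
    ∃ α ∈ maSubmodule S, ∃ y, x = ha.integrated α y := by
  have hc : CompleteSpace (maSubmodule S) :=
    (isClosed_maSubmodule (S := S)).completeSpace_coe
  have hN := unitFilter_neBot ω hA
  obtain ⟨α, y, h⟩ := cohen_factorization (ha.integrated.comp (maSubmodule S).subtypeL) (D := ω 1)
    (fun α x δ hδ => by
      obtain ⟨K, -, hK⟩ := ha.exists_norm_inv_smul_le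
      have h1 := tendsto_pair_unitFilter ω (ha.continuous_inv_smul x) (hK x)
      rw [map_one, Module.End.one_apply, ← Complex.coe_smul, smul_smul, ← Complex.ofReal_mul,
        mul_inv_cancel₀ (ω.pos' 1).ne', Complex.ofReal_one, one_smul] at h1
      have h2 := (ha.integrated.continuous.tendsto _).comp (tendsto_conv_unitFilter ω hA α.2)
      obtain ⟨e, he, he1, he2⟩ := ((eventually_unitFilter_norm_le ω).and
        ((h2.eventually (Metric.ball_mem_nhds _ hδ)).and
          (h1.eventually (Metric.ball_mem_nhds _ hδ)))).exists
      rw [dist_eq_norm, Function.comp_apply, ha.integrated_conv hA _ α.2] at he1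
      rw [dist_eq_norm] at he2
      exact ⟨e, he, he1, he2⟩) x
  exact ⟨α, α.2, y, h⟩

end IsLeftWeightedModule

end Integration

/-! ### Weighted actions from neo-unital representations -/

section Disintegration

variable {S : Type*} [TopologicalSpace S] [T2Space S] [MeasurableSpace S] [BorelSpace S]
  [Monoid S] [ContinuousMul S] [LocallyCompactSpace S]
variable {X : Type*} [NormedAddCommGroup X] [NormedSpace ℂ X] [CompleteSpace X]
variable (ω : WeightFunction S)

/-- Translation by `s` on `M_a(S, ω)`, carried over to `M_a(S)`. -/
noncomputable def maTrans (s : S) : maSubmodule S →L[ℂ] maSubmodule S :=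
  (((ω s : ℂ) • wtrans ω s).comp (maSubmodule S).subtypeL).codRestrict (maSubmodule S) fun α =>
    (maSubmodule S).smul_mem _ (wtrans_mem ω s α.2)

theorem coe_maTrans (s : S) (α : maSubmodule S) :
    (maTrans ω s α : RadonMeasure S) = (ω s : ℂ) • wtrans ω s α := rfl

theorem norm_maTrans_le (s : S) (α : maSubmodule S) : ‖maTrans ω s α‖ ≤ ω s * ‖α‖ := by
  rw [← Submodule.norm_coe, coe_maTrans, norm_smul, Complex.norm_real,
    Real.norm_of_nonneg (ω.pos' s).le]
  exact mul_le_mul_of_nonneg_left (norm_wtrans_le ω s α) (ω.pos' s).le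

theorem maTrans_maTrans (s t : S) (α : maSubmodule S) :
    maTrans ω s (maTrans ω t α) = maTrans ω (s * t) α := by
  refine Subtype.ext ?_
  have h1 := (ω.pos' s).ne'
  have h2 := (ω.pos' t).ne'
  rw [coe_maTrans, coe_maTrans, map_smul, wtrans_wtrans, smul_smul, smul_smul, coe_maTrans,
    weightQuot, ← Complex.ofReal_mul, ← Complex.ofReal_mul]
  congr 2
  field_simp

theorem maTrans_one (α : maSubmodule S) : maTrans ω 1 α = α := Subtype.ext (wtrans_one ω _)

theorem continuous_maTrans (hA : HasApproxUnit S) (α : maSubmodule S) :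
    Continuous fun s => maTrans ω s α :=
  Continuous.subtype_mk ((Complex.continuous_ofReal.comp ω.continuous').smul
    (continuous_wtrans ω hA α.2)) _

/-- In a neo-unital representation `M` of the convolution algebra `M_a(S, ω)`, the formula
`a s (M α y) = M (s·α) y` defines an action of `S`: it is well defined since `M (s·α) y` is the limit
of `M (s·e) (M α y)` along an approximate unit `e`. -/
theorem exists_action_maTrans (hA : HasApproxUnit S) (M : maSubmodule S →L[ℂ] X →L[ℂ] X)
    (hM : ∀ α β σ : maSubmodule S, (σ : RadonMeasure S) = conv ω α β → M σ = M α * M β)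
    (hneo : ∀ x, ∃ α y, x = M α y) :
    ∃ a : S →* Module.End ℂ X, (∀ s α y, a s (M α y) = M (maTrans ω s α) y) ∧
      ∃ K > 0, ∀ s x, ‖a s x‖ ≤ K * ω s * ‖x‖ := by
  have hN := unitFilter_neBot ω hA
  have hlim : ∀ s α y, Tendsto (fun e => M (maTrans ω s e) (M α y)) (unitFilter ω)
      (𝓝 (M (maTrans ω s α) y)) := fun s α y => by
    have h1 : Tendsto (fun e : maSubmodule S => (⟨conv ω e α, conv_mem ω hA _ α.2⟩ :
        maSubmodule S)) (unitFilter ω) (𝓝 α) :=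
      tendsto_subtype_rng.2 (tendsto_conv_unitFilter ω hA α.2)
    have h2 : Continuous fun β => M (maTrans ω s β) y :=
      (M.continuous.comp (maTrans ω s).continuous).clm_apply continuous_const
    refine ((h2.tendsto α).comp h1).congr fun e => ?_
    rw [Function.comp_apply, ← mul_apply_eq_comp, ← hM]
    rw [coe_maTrans, coe_maTrans, conv_smul_left ω hA _ _ α.2, wtrans_conv ω hA _ _ α.2]
  choose A Y hAY using hneo
  obtain ⟨act, hact⟩ : ∃ act : S → X → X, ∀ s x, act s x = M (maTrans ω s (A x)) (Y x) :=
    ⟨_, fun _ _ => rfl⟩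
  have hlim' : ∀ s x, Tendsto (fun e => M (maTrans ω s e) x) (unitFilter ω) (𝓝 (act s x)) :=
    fun s x => by
      have := hlim s (A x) (Y x)
      rwa [← hAY x, ← hact] at this
  have hactM : ∀ s α y, act s (M α y) = M (maTrans ω s α) y := fun s α y =>
    tendsto_nhds_unique (hlim' s (M α y)) (hlim s α y)
  let a : S →* Module.End ℂ X :=
    { toFun := fun s =>
        { toFun := act s
          map_add' := fun x y => tendsto_nhds_unique (hlim' s (x + y)) (by
            simpa only [map_add] using (hlim' s x).add (hlim' s y))
          map_smul' := fun c x => tendsto_nhds_unique (hlim' s (c • x)) (by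
            simpa only [map_smul, RingHom.id_apply] using (hlim' s x).const_smul c) }
      map_one' := LinearMap.ext fun x => by
        change act 1 x = x
        conv_rhs => rw [hAY x]
        rw [hact, maTrans_one]
      map_mul' := fun s t => LinearMap.ext fun x => by
        change act (s * t) x = act s (act t x)
        rw [hact t, hactM, maTrans_maTrans, hact] }
  have h1 := ω.pos' 1
  refine ⟨a, hactM, (‖M‖ + 1) * ω 1, by positivity, fun s x => ?_⟩
  have hs := ω.pos' s
  refine le_of_tendsto (hlim' s x).norm ?_
  filter_upwards [eventually_unitFilter_norm_le ω] with e he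
  calc ‖M (maTrans ω s e) x‖ ≤ ‖M‖ * ‖maTrans ω s e‖ * ‖x‖ := M.le_opNorm₂ _ _
    _ ≤ (‖M‖ + 1) * (ω s * ω 1) * ‖x‖ := by
        gcongr
        · linarith
        · exact (norm_maTrans_le ω s e).trans (by gcongr)
    _ = _ := by ring

/-- In terms of bounded measures: a representation of `M_a(S, ω)` maps a convolution to a Bochner
integral of translates. -/
theorem apply_apply_eq_pair (hA : HasApproxUnit S) (M : maSubmodule S →L[ℂ] X →L[ℂ] X)
    (hM : ∀ α β σ : maSubmodule S, (σ : RadonMeasure S) = conv ω α β → M σ = M α * M β)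
    (α β : maSubmodule S) (y : X) :
    M α (M β y) = pair (α : RadonMeasure S) fun s => (ω s)⁻¹ • M (maTrans ω s β) y := by
  have hc : CompleteSpace (maSubmodule S) :=
    (isClosed_maSubmodule (S := S)).completeSpace_coe
  set τ : S → maSubmodule S := fun s => ⟨wtrans ω s β, wtrans_mem ω s β.2⟩ with hτ
  have hτR : RadonBounded τ := RadonBounded.of_continuous
    (Continuous.subtype_mk (continuous_wtrans ω hA β.2) _) (fun s => norm_wtrans_le ω s β)
  have h1 : ((pair (α : RadonMeasure S) τ : maSubmodule S) : RadonMeasure S) = conv ω α β :=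
    clm_pair (maSubmodule S).subtypeL _ hτR
  have h2 := clm_pair ((ContinuousLinearMap.apply ℂ X y).comp M) (α : RadonMeasure S) hτR
  have h3 : M α (M β y) = M (pair (α : RadonMeasure S) τ) y := by
    rw [hM α β _ h1, mul_apply_eq_comp]
  rw [h3]
  refine h2.trans ?_
  congr 1
  ext s
  change M (τ s) y = (ω s)⁻¹ • M (maTrans ω s β) y
  have h4 : maTrans ω s β = (ω s : ℂ) • τ s := rfl
  rw [h4, map_smul, smul_apply, Complex.coe_smul, smul_smul, inv_mul_cancel₀ (ω.pos' s).ne',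
    one_smul]

/-- Every neo-unital representation of the convolution algebra `M_a(S, ω)` is the integrated form
of a weighted action of `S`. -/
theorem exists_action (hA : HasApproxUnit S) (V : Submodule ℂ (RadonMeasure S))
    (hV : V = maSubmodule S) (M : V →L[ℂ] X →L[ℂ] X)
    (hM : ∀ α β σ : V, (σ : RadonMeasure S) = conv ω α β → M σ = M α * M β)
    (hneo : ∀ x, ∃ α y, x = M α y) :
    ∃ a : S →* Module.End ℂ X, IsLeftWeightedModule ω a ∧
      ∀ (α : V) x, M α x = pair (α : RadonMeasure S) fun s => (ω s)⁻¹ • a s x := by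
  subst hV
  obtain ⟨a, haM, hb⟩ := exists_action_maTrans ω hA M hM hneo
  refine ⟨a, ⟨fun x => ?_, hb⟩, fun α x => ?_⟩
  · obtain ⟨α, y, rfl⟩ := hneo x
    simp only [haM]
    exact (M.continuous.comp (continuous_maTrans ω hA α)).clm_apply continuous_const
  · obtain ⟨β, y, rfl⟩ := hneo x
    simp only [haM]
    exact apply_apply_eq_pair ω hA M hM α β y

end Disintegration

/-! ### The convolution algebra `M_a(S, ω)` -/

section Convolution

variable {S : Type*} [TopologicalSpace S] [T2Space S] [MeasurableSpace S] [BorelSpace S]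
  [Monoid S] [ContinuousMul S] [LocallyCompactSpace S]
variable {X : Type*} [NormedAddCommGroup X] [NormedSpace ℂ X] [CompleteSpace X]
variable (ω : WeightFunction S)

/-- The double integral for `conv ω α β` may be taken in the order of the definition of convolution. -/
theorem pair_conv_swap (hA : HasApproxUnit S) (α : RadonMeasure S) {β : RadonMeasure S}
    (hβ : β ∈ maSubmodule S) {g : S → X} (hg : Continuous g) {C : ℝ} (hC : ∀ s, ‖g s‖ ≤ C) :
    pair (conv ω α β) g = pair β fun y => pair α fun x => weightQuot ω x y • g (x * y) := by
  rw [pair_conv ω hA α hβ (RadonBounded.of_continuous hg hC)]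
  refine pair_pair_swap α β (C := C) ((continuous_weightQuot ω).smul (hg.comp continuous_mul))
    fun x y => ?_
  rw [norm_smul]
  calc _ ≤ 1 * C := mul_le_mul (norm_weightQuot_le ω x y) (hC _) (norm_nonneg _) zero_le_one
    _ = C := one_mul C

theorem pair_real_smul_right (α : RadonMeasure S) (c : ℝ) (g : S → X) :
    pair α (fun s => c • g s) = c • pair α g :=
  VectorMeasure.integral_fun_smul _ _ c g

theorem weightQuot_smul_inv_smul (x y : S) (z : X) :
    weightQuot ω x y • (ω (x * y))⁻¹ • z = (ω y)⁻¹ • (ω x)⁻¹ • z := by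
  have h1 := (ω.pos' x).ne'
  have h2 := (ω.pos' y).ne'
  have h3 := (ω.pos' (x * y)).ne'
  rw [weightQuot, Complex.coe_smul, smul_smul, smul_smul]
  congr 1
  field_simp

theorem pair_pair_eq_pair_conv (hA : HasApproxUnit S) (α : RadonMeasure S) {β : RadonMeasure S}
    (hβ : β ∈ maSubmodule S) {f : S → ℂ} (hf : Continuous f) (hfc : HasCompactSupport f) :
    pair β (fun y => (ω y)⁻¹ • pair α fun x => (ω x)⁻¹ • f (x * y)) =
      pair (conv ω α β) fun s => (ω s)⁻¹ • f s := by
  have hg : Continuous fun s => (ω s)⁻¹ • f s :=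
    (ω.continuous'.inv₀ fun s => (ω.pos' s).ne').smul hf
  have hgc : HasCompactSupport fun s => (ω s)⁻¹ • f s :=
    HasCompactSupport.smul_left (f := fun s => (ω s)⁻¹) hfc
  obtain ⟨C, hC⟩ := hgc.exists_bound_of_continuous hg
  rw [pair_conv_swap ω hA _ hβ hg hC]
  congr 1
  ext y
  rw [← pair_real_smul_right]
  simp only [weightQuot_smul_inv_smul]

theorem isConvolution_iff_pair {μ ν σ : WeightedMeasure ω} :
    WeightedMeasure.IsConvolution μ ν σ ↔ ∀ f : S → ℂ, Continuous f →
      HasCompactSupport f → pair σ.mulWeight (fun s => (ω s)⁻¹ • f s) =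
        pair ν.mulWeight (fun y => (ω y)⁻¹ • pair μ.mulWeight fun x => (ω x)⁻¹ • f (x * y)) :=
  Iff.rfl

theorem isConvolution_iff (hA : HasApproxUnit S) {μ ν σ : WeightedMeasure ω}
    (hν : ν.mulWeight ∈ maSubmodule S) : WeightedMeasure.IsConvolution μ ν σ ↔
      σ.mulWeight = conv ω μ.mulWeight ν.mulWeight := by
  rw [isConvolution_iff_pair]
  constructor
  · intro h
    refine ext_of_hasCompactSupport fun g hg hgc => ?_
    obtain ⟨f, hfg⟩ : ∃ f : S → ℂ, ∀ s, f s = ω s * g s := ⟨_, fun _ => rfl⟩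
    have hf : Continuous f :=
      ((Complex.continuous_ofReal.comp ω.continuous').mul hg).congr fun s => (hfg s).symm
    have hfc : HasCompactSupport f := hgc.mono fun s hs h0 => hs (by rw [hfg, h0, mul_zero])
    have h1 := (h f hf hfc).trans (pair_pair_eq_pair_conv ω hA _ hν hf hfc)
    have h2 : (fun s => (ω s)⁻¹ • f s) = g := by
      ext s
      rw [hfg, ← Complex.coe_smul, smul_eq_mul, Complex.ofReal_inv,
        inv_mul_cancel_left₀ (ω.ofReal_ne_zero s)]
    rwa [h2] at h1
  · intro h f hf hfc
    rw [pair_pair_eq_pair_conv ω hA _ hν hf hfc, h]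

theorem isConvolutionBanachAlgebra_weightedMa (hA : HasApproxUnit S) :
    IsConvolutionBanachAlgebra (weightedMa ω) := by
  have hmem : ∀ μ : WeightedMeasure ω, μ ∈ weightedMa ω ↔ μ.mulWeight ∈ maSubmodule S :=
    fun μ => mem_Ma_iff_mem_maSubmodule hA
  refine
    { zero_mem := (hmem _).2 (by rw [map_zero]; exact zero_mem _)
      add_mem := fun μ hμ ν hν => (hmem _).2 (by
        rw [map_add]; exact add_mem ((hmem _).1 hμ) ((hmem _).1 hν))
      smul_mem := fun c μ hμ => (hmem _).2 (by
        rw [map_smul]; exact (maSubmodule S).smul_mem c ((hmem _).1 hμ))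
      complete := ?_
      existsUnique_conv := fun μ _ ν hν =>
        ⟨WeightedMeasure.mulWeight.symm (conv ω μ.mulWeight ν.mulWeight), ?_, fun σ hσ => ?_⟩
      conv_mem := fun μ _ ν hν σ h => ?_
      norm_conv_le := fun μ _ ν hν σ h => ?_
      add_conv := fun μ₁ _ μ₂ _ ν hν σ₁ σ₂ h₁ h₂ => ?_
      conv_add := fun μ _ ν₁ hν₁ ν₂ hν₂ σ₁ σ₂ h₁ h₂ => ?_
      smul_conv := fun c μ _ ν hν σ h => ?_
      conv_smul := fun c μ _ ν hν σ h => ?_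
      conv_assoc := fun μ _ ν hν η hη α β γ hα hβ hγ => ?_ }
  · have h1 : IsComplete (maSubmodule S : Set (RadonMeasure S)) :=
      isClosed_maSubmodule.isComplete
    have h2 : weightedMa ω = (maSubmodule S : Set (RadonMeasure S)) := Set.ext hmem
    rw [h2]
    exact h1
  · change WeightedMeasure.IsConvolution _ _ _
    rw [isConvolution_iff ω hA ((hmem _).1 hν), LinearIsometryEquiv.apply_symm_apply]
  · replace hσ := (isConvolution_iff ω hA ((hmem _).1 hν)).1 hσ
    rw [← hσ, LinearIsometryEquiv.symm_apply_apply]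
  · rw [isConvolution_iff ω hA ((hmem _).1 hν)] at h
    rw [hmem, h]
    exact conv_mem ω hA _ ((hmem _).1 hν)
  · rw [isConvolution_iff ω hA ((hmem _).1 hν)] at h
    rw [← LinearIsometryEquiv.norm_map WeightedMeasure.mulWeight σ, h]
    exact norm_conv_le ω hA _ ((hmem _).1 hν)
  · rw [isConvolution_iff ω hA ((hmem _).1 hν)] at h₁ h₂ ⊢
    rw [map_add, map_add, h₁, h₂, conv_add_left ω hA _ _ ((hmem _).1 hν)]
  · have hν : (ν₁ + ν₂).mulWeight ∈ maSubmodule S := by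
      rw [map_add]; exact add_mem ((hmem _).1 hν₁) ((hmem _).1 hν₂)
    rw [isConvolution_iff ω hA hν]
    rw [isConvolution_iff ω hA ((hmem _).1 hν₁)] at h₁
    rw [isConvolution_iff ω hA ((hmem _).1 hν₂)] at h₂
    rw [map_add, map_add, h₁, h₂, conv_add_right ω hA _ ((hmem _).1 hν₁) ((hmem _).1 hν₂)]
  · rw [isConvolution_iff ω hA ((hmem _).1 hν)] at h ⊢
    rw [map_smul, map_smul, h, conv_smul_left ω hA _ _ ((hmem _).1 hν)]
  · have hν' : (c • ν).mulWeight ∈ maSubmodule S := by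
      rw [map_smul]; exact (maSubmodule S).smul_mem c ((hmem _).1 hν)
    rw [isConvolution_iff ω hA hν']
    rw [isConvolution_iff ω hA ((hmem _).1 hν)] at h
    rw [map_smul, map_smul, h, conv_smul_right ω hA _ _ ((hmem _).1 hν)]
  · rw [isConvolution_iff ω hA ((hmem _).1 hν)] at hα
    rw [isConvolution_iff ω hA ((hmem _).1 hη)] at hβ hγ
    have hβ' : β.mulWeight ∈ maSubmodule S := by
      rw [hβ]; exact conv_mem ω hA _ ((hmem _).1 hη)
    rw [isConvolution_iff ω hA hβ', hγ, hα, hβ,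
      conv_assoc ω hA _ ((hmem _).1 hν) ((hmem _).1 hη)]

/-- A weight function is also a weight function for the opposite multiplication. -/
def oppWeight : @WeightFunction S _ (oppMonoid S).toMul :=
  @WeightFunction.mk S _ (oppMonoid S).toMul ω ω.pos' ω.continuous' fun x y =>
    (ω.map_mul_le' y x).trans_eq (mul_comm _ _)

/-- Passing to the opposite multiplication reverses the order in convolutions. -/
theorem conv_opp (hA : HasApproxUnit S) {α β : RadonMeasure S} (hα : α ∈ maSubmodule S)
    (hβ : β ∈ maSubmodule S) :
    @conv S _ _ _ _ (oppMonoid S) (continuousMul_oppMonoid S) (oppWeight ω) α β =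
      conv ω β α := by
  refine ext_of_hasCompactSupport fun g hg hgc => ?_
  obtain ⟨C, hC⟩ := hgc.exists_bound_of_continuous hg
  have hβ' : β ∈ @maSubmodule S _ _ _ _ (oppMonoid S) (continuousMul_oppMonoid S) _ := by
    rwa [maSubmodule_opp]
  rw [pair_conv_swap ω hA _ hα hg hC, @pair_conv S _ _ _ _ (oppMonoid S)
    (continuousMul_oppMonoid S) ℂ _ _ _ (oppWeight ω) _ hA.opp α β hβ' g
    (RadonBounded.of_continuous hg hC)]
  congr 1
  ext x
  congr 1
  ext y
  have h1 : @weightQuot S _ (oppMonoid S) (oppWeight ω) x y = weightQuot ω y x := by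
    exact congrArg Complex.ofReal (mul_right_comm _ _ _)
  rw [h1]
  rfl

end Convolution

/-! ### Left and right integrated forms -/

section Representations

variable {S : Type*} [TopologicalSpace S] [T2Space S] [MeasurableSpace S] [BorelSpace S]
  [Monoid S] [ContinuousMul S] [LocallyCompactSpace S]
variable {X : Type*} [NormedAddCommGroup X] [NormedSpace ℂ X] [CompleteSpace X]
variable (ω : WeightFunction S)

/-- `T` is a family of operators on `X` whose integrated form on bounded measures,
`M α x = ∫ ω(s)⁻¹ T s x dα(s)`, factors all elements of `X` through `M_a(S)`, and which acts on its
integrated form through the maps `τ s` on `M_a(S)`. -/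
structure IsIntegrator (τ : S → maSubmodule S → maSubmodule S) (T : S → X → X)
    (M : RadonMeasure S →L[ℂ] X →L[ℂ] X) : Prop where
  radonBounded : ∀ x, RadonBounded fun s => (ω s)⁻¹ • T s x
  apply : ∀ α x, M α x = pair α fun s => (ω s)⁻¹ • T s x
  factor : ∀ x, ∃ α ∈ maSubmodule S, ∃ y, x = M α y
  act : ∀ s (α : maSubmodule S) x, T s (M α x) = M (τ s α) x

theorem IsLeftWeightedModule.isIntegrator (hA : HasApproxUnit S) {a : S →* Module.End ℂ X}
    (ha : IsLeftWeightedModule ω a) :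
    IsIntegrator ω (fun s => maTrans ω s) (fun s x => a s x) ha.integrated where
  radonBounded := ha.radonBounded
  apply := ha.integrated_apply
  factor := ha.exists_eq_integrated hA
  act s α x := ha.act_integrated s α x

/-- A right action, as a left action of the monoid with the opposite multiplication. -/
def oppAction (b : Sᵐᵒᵖ →* Module.End ℂ X) :
    @MonoidHom S (Module.End ℂ X) (oppMonoid S).toMulOneClass.toMulOne _ :=
  @MonoidHom.mk S (Module.End ℂ X) (oppMonoid S).toMulOneClass.toMulOne _
    (@OneHom.mk S (Module.End ℂ X) (oppMonoid S).toOne _ (fun s => b (MulOpposite.op s)) b.map_one)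
    fun s t => b.map_mul (MulOpposite.op s) (MulOpposite.op t)

/-- A left action of the monoid with the opposite multiplication, as a right action. -/
def ofOppAction (a : @MonoidHom S (Module.End ℂ X) (oppMonoid S).toMulOneClass.toMulOne _) :
    Sᵐᵒᵖ →* Module.End ℂ X where
  toFun s := a s.unop
  map_one' := @map_one _ _ _ (oppMonoid S).toOne _ _ _ a
  map_mul' s t := @map_mul _ _ _ (oppMonoid S).toMul _ _ _ a s.unop t.unop

theorem IsRightWeightedModule.opp {b : Sᵐᵒᵖ →* Module.End ℂ X} (hb : IsRightWeightedModule ω b) :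
    @IsLeftWeightedModule S _ (oppMonoid S) X _ _ (oppWeight ω) (oppAction b) :=
  @IsLeftWeightedModule.mk S _ (oppMonoid S) X _ _ (oppWeight ω) (oppAction b) hb.continuous hb.bound

theorem mem_maSubmodule_opp {α : RadonMeasure S} :
    α ∈ @maSubmodule S _ _ _ _ (oppMonoid S) (continuousMul_oppMonoid S) _ ↔
      α ∈ maSubmodule S := by
  rw [maSubmodule_opp]

/-- Right translation by `s` on `M_a(S, ω)`, carried over to `M_a(S)`. -/
noncomputable def maTransRight (s : S) (α : maSubmodule S) : maSubmodule S :=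
  ⟨(ω s : ℂ) • @wtrans S _ _ _ _ (oppMonoid S) (continuousMul_oppMonoid S) (oppWeight ω) s α,
    (maSubmodule S).smul_mem _ (mem_maSubmodule_opp.1
      (@wtrans_mem S _ _ _ _ (oppMonoid S) (continuousMul_oppMonoid S) (oppWeight ω) _ s α
        (mem_maSubmodule_opp.2 α.2)))⟩

theorem IsRightWeightedModule.exists_isIntegrator (hA : HasApproxUnit S)
    {b : Sᵐᵒᵖ →* Module.End ℂ X} (hb : IsRightWeightedModule ω b) :
    ∃ M : RadonMeasure S →L[ℂ] X →L[ℂ] X,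
      IsIntegrator ω (maTransRight ω) (fun s x => b (MulOpposite.op s) x) M ∧
      ∀ α ∈ maSubmodule S, ∀ β ∈ maSubmodule S, M (conv ω α β) = M β * M α := by
  have h := hb.opp
  refine ⟨@IsLeftWeightedModule.integrated S _ _ _ _ (oppMonoid S)
      (continuousMul_oppMonoid S) _ X _ _ _ (oppWeight ω) _ h,
    ⟨?_, ?_, ?_, ?_⟩, fun α hα β hβ => ?_⟩
  · exact @IsLeftWeightedModule.radonBounded S _ _ _ _ (oppMonoid S)
      (continuousMul_oppMonoid S) _ X _ _ _ (oppWeight ω) _ h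
  · exact fun α x => rfl
  · intro x
    obtain ⟨α, hα, y, hy⟩ := @IsLeftWeightedModule.exists_eq_integrated S _ _ _ _ (oppMonoid S)
      (continuousMul_oppMonoid S) _ X _ _ _ (oppWeight ω) _ h hA.opp x
    exact ⟨α, mem_maSubmodule_opp.1 hα, y, hy⟩
  · exact fun s α x => @IsLeftWeightedModule.act_integrated S _ _ _ _ (oppMonoid S)
      (continuousMul_oppMonoid S) _ X _ _ _ (oppWeight ω) _ h s α x
  · rw [← conv_opp ω hA hβ hα]
    exact @IsLeftWeightedModule.integrated_conv S _ _ _ _ (oppMonoid S)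
      (continuousMul_oppMonoid S) _ X _ _ _ (oppWeight ω) _ h hA.opp β α
        (mem_maSubmodule_opp.2 hα)

/-- Every neo-unital anti-representation of `M_a(S, ω)` is the integrated form of a right weighted
action of `S`. -/
theorem exists_right_action (hA : HasApproxUnit S) (M : maSubmodule S →L[ℂ] X →L[ℂ] X)
    (hM : ∀ α β σ : maSubmodule S, (σ : RadonMeasure S) = conv ω α β → M σ = M β * M α)
    (hneo : ∀ x, ∃ α y, x = M α y) :
    ∃ b : Sᵐᵒᵖ →* Module.End ℂ X, IsRightWeightedModule ω b ∧
      ∀ (α : maSubmodule S) x, M α x =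
        pair (α : RadonMeasure S) fun s => (ω s)⁻¹ • b (MulOpposite.op s) x := by
  obtain ⟨a, ha, h⟩ := @exists_action S _ _ _ _ (oppMonoid S) (continuousMul_oppMonoid S) _ X _ _ _
    (oppWeight ω) hA.opp (maSubmodule S) maSubmodule_opp.symm M
    (fun α β σ hσ => hM β α σ (by rw [hσ, conv_opp ω hA α.2 β.2])) hneo
  obtain ⟨h1, h2⟩ := ha
  exact ⟨ofOppAction a, ⟨h1, h2⟩, h⟩

end Representations

/-! ### Banach modules over `M_a(S, ω)` and weighted modules over `S` -/

section Modules

variable {S : Type*} [TopologicalSpace S] [T2Space S] [MeasurableSpace S] [BorelSpace S]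
  [Monoid S] [ContinuousMul S] [LocallyCompactSpace S]
variable {X : Type*} [NormedAddCommGroup X] [NormedSpace ℂ X]
variable {ω : WeightFunction S}

/-- The bijection `μ ↦ ωμ` of `M_a(S, ω)` onto `M_a(S)`. -/
noncomputable def weightedMaEquiv (ω : WeightFunction S) (hA : HasApproxUnit S) :
    weightedMa ω ≃ maSubmodule S where
  toFun μ := ⟨(μ : WeightedMeasure ω).mulWeight, (mem_Ma_iff_mem_maSubmodule hA).1 μ.2⟩
  invFun α := ⟨WeightedMeasure.mulWeight.symm α, (mem_Ma_iff_mem_maSubmodule hA).2 α.2⟩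
  left_inv _ := rfl
  right_inv _ := rfl

theorem IsBoundedBilinear.exists_clm (hA : HasApproxUnit S) {m : weightedMa ω → X → X}
    (hm : IsBoundedBilinear ω m) : ∃ M : maSubmodule S →L[ℂ] X →L[ℂ] X,
      ∀ μ x, m μ x = M (weightedMaEquiv ω hA μ) x := by
  refine ⟨LinearMap.mkContinuousOfExistsBound₂
    (LinearMap.mk₂ ℂ (fun α x => m ((weightedMaEquiv ω hA).symm α) x)
      (fun α β x => hm.add_map _ _ _ x rfl) (fun c α x => hm.smul_map c _ _ x rfl)
      (fun α x y => hm.map_add _ x y) (fun c α x => hm.map_smul _ c x)) ?_, fun μ x => rfl⟩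
  obtain ⟨K, -, hK⟩ := hm.bound
  exact ⟨K, fun α x => hK _ x⟩

theorem isBoundedBilinear_of_clm (M : RadonMeasure S →L[ℂ] X →L[ℂ] X) :
    IsBoundedBilinear ω fun μ x => M (μ : WeightedMeasure ω).mulWeight x where
  map_add μ x y := map_add _ x y
  map_smul μ c x := map_smul _ c x
  add_map μ ν σ x h := by rw [h, map_add, map_add, add_apply]
  smul_map c μ σ x h := by rw [h, map_smul, map_smul, smul_apply]
  bound := ⟨‖M‖ + 1, by positivity, fun μ x => by
    refine (M.le_opNorm₂ _ x).trans ?_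
    rw [LinearIsometryEquiv.norm_map]
    gcongr
    linarith⟩

theorem integrable_weightedMeasure_abs {μ : WeightedMeasure ω} {g : S → X}
    (hg : RadonBounded fun s => (ω s)⁻¹ • g s) : Integrable g μ.abs := by
  have hm : Measurable fun s => ENNReal.ofReal (ω s)⁻¹ :=
    (ω.continuous'.measurable.inv).ennreal_ofReal
  rw [WeightedMeasure.abs, integrable_withDensity_iff_integrable_smul' hm (by simp)]
  refine (hg.integrable μ.mulWeight.abs).congr (Eventually.of_forall fun s => ?_)
  simp only
  rw [ENNReal.toReal_ofReal (inv_nonneg.2 (ω.pos' s).le)]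

theorem IsIntegratedForm.unique {T : S → X → X} {m m' : weightedMa ω → X → X}
    (h : IsIntegratedForm ω T m) (h' : IsIntegratedForm ω T m') : m = m' :=
  funext fun μ => funext fun x => (h μ x).2.trans (h' μ x).2.symm

variable [CompleteSpace X]

namespace IsIntegrator

variable {τ : S → maSubmodule S → maSubmodule S} {T : S → X → X}
  {M : RadonMeasure S →L[ℂ] X →L[ℂ] X} (h : IsIntegrator ω τ T M)
include h

theorem isIntegratedForm :
    IsIntegratedForm ω T fun μ x => M (μ : WeightedMeasure ω).mulWeight x := fun _ x =>
  ⟨integrable_weightedMeasure_abs (h.radonBounded x), h.apply _ x⟩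

theorem neoUnital (hA : HasApproxUnit S) (x : X) :
    ∃ (μ : weightedMa ω) (y : X), x = M (μ : WeightedMeasure ω).mulWeight y := by
  obtain ⟨α, hα, y, hy⟩ := h.factor x
  exact ⟨(weightedMaEquiv ω hA).symm ⟨α, hα⟩, y, hy⟩

theorem act_apply (hA : HasApproxUnit S) {m : weightedMa ω → X → X} (hm : IsIntegratedForm ω T m)
    (s : S) (μ : weightedMa ω) (x : X) :
    T s (m μ x) = m ((weightedMaEquiv ω hA).symm (τ s (weightedMaEquiv ω hA μ))) x := by
  rw [hm.unique h.isIntegratedForm]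
  exact h.act s (weightedMaEquiv ω hA μ) x

end IsIntegrator

theorem clm_integrated_comm {T : S → X → X} {M : RadonMeasure S →L[ℂ] X →L[ℂ] X}
    {τ : S → maSubmodule S → maSubmodule S} (h : IsIntegrator ω τ T M) (L : X →L[ℂ] X)
    (hL : ∀ s x, T s (L x) = L (T s x)) (α : RadonMeasure S) (x : X) :
    M α (L x) = L (M α x) := by
  rw [h.apply, h.apply, clm_pair L α (h.radonBounded x)]
  congr 1
  ext s
  rw [hL, ← Complex.coe_smul, ← Complex.coe_smul, map_smul]

theorem IsLeftWeightedModule.isLeftNeoUnitalModule (hA : HasApproxUnit S)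
    {a : S →* Module.End ℂ X} (ha : IsLeftWeightedModule ω a) :
    IsLeftNeoUnitalModule ω fun μ x => ha.integrated (μ : WeightedMeasure ω).mulWeight x where
  toIsBoundedBilinear := isBoundedBilinear_of_clm _
  assoc μ ν σ x h := by
    have hν := (weightedMaEquiv ω hA ν).2
    rw [(isConvolution_iff ω hA hν).1 h]
    exact congrArg (fun L : X →L[ℂ] X => L x) (ha.integrated_conv hA _ hν)
  neoUnital := (ha.isIntegrator ω hA).neoUnital hA

theorem IsRightWeightedModule.exists_isRightNeoUnitalModule (hA : HasApproxUnit S)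
    {b : Sᵐᵒᵖ →* Module.End ℂ X} (hb : IsRightWeightedModule ω b) :
    ∃ M : RadonMeasure S →L[ℂ] X →L[ℂ] X,
      IsIntegrator ω (maTransRight ω) (fun s x => b (MulOpposite.op s) x) M ∧
      IsRightNeoUnitalModule ω fun μ x => M (μ : WeightedMeasure ω).mulWeight x := by
  obtain ⟨M, hM, hconv⟩ := hb.exists_isIntegrator ω hA
  refine ⟨M, hM, ⟨⟨isBoundedBilinear_of_clm M, fun μ ν σ x h => ?_⟩, hM.neoUnital hA⟩⟩
  have hν := (weightedMaEquiv ω hA ν).2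
  rw [(isConvolution_iff ω hA hν).1 h]
  exact congrArg (fun L : X →L[ℂ] X => L x) (hconv _ (weightedMaEquiv ω hA μ).2 _ hν)

theorem isIntegratedForm_of_clm (hA : HasApproxUnit S) {T : S → X → X}
    {m : weightedMa ω → X → X} {M : maSubmodule S →L[ℂ] X →L[ℂ] X}
    (hM : ∀ μ x, m μ x = M (weightedMaEquiv ω hA μ) x)
    (hT : ∀ x, RadonBounded fun s => (ω s)⁻¹ • T s x)
    (h : ∀ (α : maSubmodule S) x, M α x = pair (α : RadonMeasure S) fun s => (ω s)⁻¹ • T s x) :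
    IsIntegratedForm ω T m := fun μ x =>
  ⟨integrable_weightedMeasure_abs (hT x), (hM μ x).trans (h _ x)⟩

theorem IsLeftBanachModule.exists_action (hA : HasApproxUnit S) {m : weightedMa ω → X → X}
    (hm : IsLeftBanachModule ω m) (hneo : ∀ x, ∃ μ y, x = m μ y) :
    ∃ a : S →* Module.End ℂ X, IsLeftWeightedModule ω a ∧
      IsIntegratedForm ω (fun s x => a s x) m := by
  obtain ⟨M, hM⟩ := hm.toIsBoundedBilinear.exists_clm hA
  obtain ⟨a, ha, h⟩ := WeightedSemigroup.exists_action ω hA _ rfl M (fun α β σ hσ => by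
      ext x
      have h1 := hm.assoc ((weightedMaEquiv ω hA).symm α) ((weightedMaEquiv ω hA).symm β)
        ((weightedMaEquiv ω hA).symm σ) x ((isConvolution_iff ω hA β.2).2 hσ)
      rwa [hM, hM, hM] at h1)
    (fun x => by
      obtain ⟨μ, y, hy⟩ := hneo x
      exact ⟨_, y, hy.trans (hM μ y)⟩)
  exact ⟨a, ha, isIntegratedForm_of_clm hA hM ha.radonBounded h⟩

theorem IsRightBanachModule.exists_action (hA : HasApproxUnit S) {n : weightedMa ω → X → X}
    (hn : IsRightBanachModule ω n) (hneo : ∀ x, ∃ μ y, x = n μ y) :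
    ∃ b : Sᵐᵒᵖ →* Module.End ℂ X, IsRightWeightedModule ω b ∧
      IsIntegratedForm ω (fun s x => b (MulOpposite.op s) x) n := by
  obtain ⟨M, hM⟩ := hn.toIsBoundedBilinear.exists_clm hA
  obtain ⟨b, hb, h⟩ := exists_right_action ω hA M (fun α β σ hσ => by
      ext x
      have h1 := hn.assoc ((weightedMaEquiv ω hA).symm α) ((weightedMaEquiv ω hA).symm β)
        ((weightedMaEquiv ω hA).symm σ) x ((isConvolution_iff ω hA β.2).2 hσ)
      rwa [hM, hM, hM] at h1)
    (fun x => by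
      obtain ⟨μ, y, hy⟩ := hneo x
      exact ⟨_, y, hy.trans (hM μ y)⟩)
  obtain ⟨N, hN, -⟩ := hb.exists_isIntegrator ω hA
  exact ⟨b, hb, isIntegratedForm_of_clm hA hM hN.radonBounded h⟩

/-- A left weighted action is determined by its integrated form. -/
theorem IsLeftWeightedModule.eq_of_isIntegratedForm (hA : HasApproxUnit S)
    {a a' : S →* Module.End ℂ X} (ha : IsLeftWeightedModule ω a) (ha' : IsLeftWeightedModule ω a')
    {m : weightedMa ω → X → X} (hneo : ∀ x, ∃ μ y, x = m μ y)
    (hm : IsIntegratedForm ω (fun s x => a s x) m)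
    (hm' : IsIntegratedForm ω (fun s x => a' s x) m) : a = a' := by
  refine MonoidHom.ext fun s => LinearMap.ext fun x => ?_
  obtain ⟨μ, y, rfl⟩ := hneo x
  exact ((ha.isIntegrator ω hA).act_apply hA hm s μ y).trans
    ((ha'.isIntegrator ω hA).act_apply hA hm' s μ y).symm

/-- A right weighted action is determined by its integrated form. -/
theorem IsRightWeightedModule.eq_of_isIntegratedForm (hA : HasApproxUnit S)
    {b b' : Sᵐᵒᵖ →* Module.End ℂ X} (hb : IsRightWeightedModule ω b)
    (hb' : IsRightWeightedModule ω b') {n : weightedMa ω → X → X}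
    (hneo : ∀ x, ∃ μ y, x = n μ y)
    (hn : IsIntegratedForm ω (fun s x => b (MulOpposite.op s) x) n)
    (hn' : IsIntegratedForm ω (fun s x => b' (MulOpposite.op s) x) n) : b = b' := by
  obtain ⟨N, hN, -⟩ := hb.exists_isIntegrator ω hA
  obtain ⟨N', hN', -⟩ := hb'.exists_isIntegrator ω hA
  refine MonoidHom.ext fun s => LinearMap.ext fun x => ?_
  obtain ⟨μ, y, rfl⟩ := hneo x
  exact (hN.act_apply hA hn s.unop μ y).trans (hN'.act_apply hA hn' s.unop μ y).symm

/-- The integrated forms of a two-sided weighted module make up a two-sided neo-unital module. -/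
theorem IsTwoSidedWeightedModule.exists_isTwoSidedNeoUnitalModule (hA : HasApproxUnit S)
    {a : S →* Module.End ℂ X} {b : Sᵐᵒᵖ →* Module.End ℂ X}
    (h : IsTwoSidedWeightedModule ω a b) :
    ∃ m n : weightedMa ω → X → X, IsTwoSidedNeoUnitalModule ω m n ∧
      IsIntegratedForm ω (fun s x => a s x) m ∧
      IsIntegratedForm ω (fun s x => b (MulOpposite.op s) x) n := by
  obtain ⟨N, hN, hn⟩ := h.right.exists_isRightNeoUnitalModule hA
  have hM := h.left.isIntegrator ω hA
  have hm := h.left.isLeftNeoUnitalModule hA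
  refine ⟨_, _, ⟨hm.toIsLeftBanachModule, hn.toIsRightBanachModule, fun μ ν x => ?_, fun x => ?_⟩,
    hM.isIntegratedForm, hN.isIntegratedForm⟩
  · refine clm_integrated_comm hM (N (ν : WeightedMeasure ω).mulWeight) (fun s x => ?_) _ x
    exact (clm_integrated_comm hN (h.left.actL s) (fun t x => (h.compat s t x).symm) _ x).symm
  · obtain ⟨μ, y, hy⟩ := hm.neoUnital x
    obtain ⟨ν, z, hz⟩ := hn.neoUnital y
    exact ⟨μ, ν, z, by rw [hy]; exact congrArg _ hz⟩

/-- The two actions obtained from a two-sided neo-unital module commute. -/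
theorem IsTwoSidedNeoUnitalModule.isTwoSidedWeightedModule (hA : HasApproxUnit S)
    {m n : weightedMa ω → X → X} (h : IsTwoSidedNeoUnitalModule ω m n)
    {a : S →* Module.End ℂ X} {b : Sᵐᵒᵖ →* Module.End ℂ X} (ha : IsLeftWeightedModule ω a)
    (hb : IsRightWeightedModule ω b) (hm : IsIntegratedForm ω (fun s x => a s x) m)
    (hn : IsIntegratedForm ω (fun s x => b (MulOpposite.op s) x) n) :
    IsTwoSidedWeightedModule ω a b := by
  refine ⟨ha, hb, fun s t x => ?_⟩
  obtain ⟨N, hN, -⟩ := hb.exists_isIntegrator ω hA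
  have hl := (ha.isIntegrator ω hA).act_apply hA hm s
  have hr := hN.act_apply hA hn t
  obtain ⟨μ, ν, y, rfl⟩ := h.neoUnital x
  rw [hl, h.compat, h.compat, hr, hr, ← h.compat, ← h.compat, hl]

end Modules

end WeightedSemigroup

open WeightedSemigroup in
theorem lemma2p7 {S : Type*} [TopologicalSpace S] [T2Space S] [LocallyCompactSpace S]
    [MeasurableSpace S] [BorelSpace S] [Monoid S] [ContinuousMul S] (hS : IsFoundation S)
    (ω : WeightFunction S)
    {X : Type*} [NormedAddCommGroup X] [NormedSpace ℂ X] [CompleteSpace X] :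
    -- `M_a(S, ω)` is a Banach algebra
    IsConvolutionBanachAlgebra (weightedMa ω) ∧
    -- left modules
    ((∀ a : S →* Module.End ℂ X, IsLeftWeightedModule ω a →
        ∃! m : weightedMa ω → X → X,
          IsLeftNeoUnitalModule ω m ∧ IsIntegratedForm ω (fun s x => a s x) m) ∧
      (∀ m : weightedMa ω → X → X, IsLeftNeoUnitalModule ω m →
        ∃! a : S →* Module.End ℂ X,
          IsLeftWeightedModule ω a ∧ IsIntegratedForm ω (fun s x => a s x) m)) ∧
    -- right modules
    ((∀ b : Sᵐᵒᵖ →* Module.End ℂ X, IsRightWeightedModule ω b →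
        ∃! n : weightedMa ω → X → X,
          IsRightNeoUnitalModule ω n ∧
            IsIntegratedForm ω (fun s x => b (MulOpposite.op s) x) n) ∧
      (∀ n : weightedMa ω → X → X, IsRightNeoUnitalModule ω n →
        ∃! b : Sᵐᵒᵖ →* Module.End ℂ X,
          IsRightWeightedModule ω b ∧
            IsIntegratedForm ω (fun s x => b (MulOpposite.op s) x) n)) ∧
    -- two-sided modules
    ((∀ (a : S →* Module.End ℂ X) (b : Sᵐᵒᵖ →* Module.End ℂ X), IsTwoSidedWeightedModule ω a b →
        ∃! p : (weightedMa ω → X → X) × (weightedMa ω → X → X),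
          IsTwoSidedNeoUnitalModule ω p.1 p.2 ∧ IsIntegratedForm ω (fun s x => a s x) p.1 ∧
            IsIntegratedForm ω (fun s x => b (MulOpposite.op s) x) p.2) ∧
      (∀ m n : weightedMa ω → X → X, IsTwoSidedNeoUnitalModule ω m n →
        ∃! p : (S →* Module.End ℂ X) × (Sᵐᵒᵖ →* Module.End ℂ X),
          IsTwoSidedWeightedModule ω p.1 p.2 ∧ IsIntegratedForm ω (fun s x => p.1 s x) m ∧
            IsIntegratedForm ω (fun s x => p.2 (MulOpposite.op s) x) n)) := by
  have hA := hS.hasApproxUnit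
  refine ⟨isConvolutionBanachAlgebra_weightedMa ω hA, ⟨fun a ha => ?_, fun m hm => ?_⟩,
    ⟨fun b hb => ?_, fun n hn => ?_⟩, ⟨fun a b hab => ?_, fun m n hmn => ?_⟩⟩
  · exact ⟨_, ⟨ha.isLeftNeoUnitalModule hA, (ha.isIntegrator ω hA).isIntegratedForm⟩,
      fun m' hm' => hm'.2.unique (ha.isIntegrator ω hA).isIntegratedForm⟩
  · obtain ⟨a, ha, hma⟩ := hm.toIsLeftBanachModule.exists_action hA hm.neoUnital
    exact ⟨a, ⟨ha, hma⟩, fun a' ha' =>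
      ha'.1.eq_of_isIntegratedForm hA ha hm.neoUnital ha'.2 hma⟩
  · obtain ⟨N, hN, hn⟩ := hb.exists_isRightNeoUnitalModule hA
    exact ⟨_, ⟨hn, hN.isIntegratedForm⟩, fun n' hn' => hn'.2.unique hN.isIntegratedForm⟩
  · obtain ⟨b, hb, hnb⟩ := hn.toIsRightBanachModule.exists_action hA hn.neoUnital
    exact ⟨b, ⟨hb, hnb⟩, fun b' hb' =>
      hb'.1.eq_of_isIntegratedForm hA hb hn.neoUnital hb'.2 hnb⟩
  · obtain ⟨m, n, hmn, hm, hn⟩ := hab.exists_isTwoSidedNeoUnitalModule hA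
    exact ⟨(m, n), ⟨hmn, hm, hn⟩, fun p hp =>
      Prod.ext (hp.2.1.unique hm) (hp.2.2.unique hn)⟩
  · have hml : ∀ x, ∃ μ y, x = m μ y := fun x => by
      obtain ⟨μ, ν, y, h⟩ := hmn.neoUnital x
      exact ⟨μ, _, h⟩
    have hnr : ∀ x, ∃ ν y, x = n ν y := fun x => by
      obtain ⟨μ, ν, y, h⟩ := hmn.neoUnital x
      exact ⟨ν, _, h.trans (hmn.compat μ ν y)⟩
    obtain ⟨a, ha, hma⟩ := hmn.left.exists_action hA hml
    obtain ⟨b, hb, hnb⟩ := hmn.right.exists_action hA hnr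
    exact ⟨(a, b), ⟨hmn.isTwoSidedWeightedModule hA ha hb hma hnb, hma, hnb⟩, fun p hp =>
      Prod.ext (hp.1.left.eq_of_isIntegratedForm hA ha hml hp.2.1 hma)
        (hp.1.right.eq_of_isIntegratedForm hA hb hnr hp.2.2 hnb)⟩
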